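/- Let $K$ be an algebraically closed field of characteristic $0$, let $V$ be a finite-dimensional $K$-vector space, and let $G\subset \mathrm{GL}(V)$ be a finite group generated by (pseudo)reflections. Let $S$ be the algebra of polynomial functions on $V$. For $v\in V$ let $C_G(v)=\{g\in G\mid g(v)=v\}$ and let $G_v$ be the subgroup generated by the reflections of $G$ that fix $v$. For $W\in\{G,G_v\}$ let $\mathcal H_W\subset S$ be the space of $W$-harmonic polynomials, i.e. those annihilated by all $W$-invariant constant-coefficient polynomial differential operators without constant term. Let $\gamma\in \mathrm{GL}(V)$ be a semisimple element that normalises $G$ and satisfies $\gamma(v)=\zeta v$ for a scalar $\zeta\in K$ (if $v\ne 0$ this means that $\gamma\in\mathcal N_{\langle v\rangle}=\{g\in N_{\mathrm{GL}(V)}(G)\mid g(v)\in Kv\}$ and $\zeta=\theta_v(\gamma)$, where $g(v)=\theta_v(g)v$). Let $M$ be a finite-dimensional $\langle G,\gamma\rangle$-module on which $\gamma$ acts semisimply; by restriction it is also a $\langle G_v,\gamma\rangle$-module. Grade $S\otimes M^*$ by the degree in $S$. For $W\in\{G,G_v\}$ the space $(\mathcal H_W\otimes M^*)^W$ has a finite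 basis consisting of homogeneous eigenvectors of $\gamma$. If $\mathcal B(M,\gamma)$ is any such basis for $W=G$ and $\mathcal B^v(M,\gamma)$ is any such basis for $W=G_v$, and if $m_\iota$ denotes the degree and $\varepsilon_\iota$ the $\gamma$-eigenvalue of a basis element $\iota$ (the $\varepsilon_\iota$ are the $M$-factors), then the multisets $$\{\varepsilon_\iota\zeta^{m_\iota}\mid \iota\in\mathcal B(M,\gamma)\}\quad\text{and}\quad \{\varepsilon_\iota\zeta^{m_\iota}\mid \iota\in\mathcal B^v(M,\gamma)\}$$ are equal. Moreover $C_G(v)=G_v$ (Steinberg's theorem). -/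

import Mathlib

open scoped TensorProduct

noncomputable section

namespace ReflectionCoset

section Polynomials

variable (K V : Type*) [Field K] [AddCommGroup V] [Module K V]

/-- The algebra `S` of polynomial functions on `V`: the symmetric algebra of the dual space. -/
abbrev Poly : Type _ := SymmetricAlgebra K (Module.Dual K V)

/-- The inclusion of the linear forms `V^*` into `S`. -/
abbrev form : Module.Dual K V →ₗ[K] Poly K V := SymmetricAlgebra.ι K (Module.Dual K V)

variable {K V}

/-- The space of homogeneous polynomials of degree `d`. -/
def homogeneousPoly (d : ℕ) : Submodule K (Poly K V) :=
  LinearMap.range (form K V) ^ d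

/-- The natural representation of `GL(V)` on `V`. -/
def stdRep : Representation K (V ≃ₗ[K] V) V where
  toFun g := g.toLinearMap
  map_one' := rfl
  map_mul' _ _ := rfl

/-- The action `(g f)(x) = f (g⁻¹ x)` of `GL(V)` on `S` by algebra endomorphisms: the extension
to the symmetric algebra of the contragredient action on `V^*`. -/
def polyAction : (V ≃ₗ[K] V) →* (Poly K V →ₐ[K] Poly K V) where
  toFun g := SymmetricAlgebra.lift (form K V ∘ₗ stdRep.dual g)
  map_one' := by
    apply SymmetricAlgebra.algHom_ext
    ext φ
    rw [map_one]
    simp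
  map_mul' g h := by
    apply SymmetricAlgebra.algHom_ext
    ext φ
    rw [map_mul]
    simp

/-- The representation of `GL(V)` on `S`. -/
def polyRep : Representation K (V ≃ₗ[K] V) (Poly K V) where
  toFun g := (polyAction g).toLinearMap
  map_one' := by rw [map_one]; rfl
  map_mul' g h := by rw [map_mul]; rfl

theorem polyRep_form (g : V ≃ₗ[K] V) (φ : Module.Dual K V) :
    polyRep g (form K V φ) = form K V (φ ∘ₗ (g⁻¹).toLinearMap) :=
  SymmetricAlgebra.lift_ι_apply _ _

/-- The algebra homomorphism `f ↦ f + ε ∂_v f` from `S` to `S[ε]`, where `ε² = 0`. -/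
def taylor (v : V) : Poly K V →ₐ[K] DualNumber (Poly K V) :=
  SymmetricAlgebra.lift
    ((TrivSqZeroExt.inlAlgHom K (Poly K V) (Poly K V)).toLinearMap ∘ₗ form K V +
      (TrivSqZeroExt.inrHom (Poly K V) (Poly K V)).restrictScalars K ∘ₗ
        Algebra.linearMap K (Poly K V) ∘ₗ Module.Dual.eval K V v)

theorem taylor_form (v : V) (φ : Module.Dual K V) :
    taylor v (form K V φ) = TrivSqZeroExt.inl (form K V φ) +
        TrivSqZeroExt.inr (algebraMap K (Poly K V) (φ v)) :=
  SymmetricAlgebra.lift_ι_apply _ _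

theorem fst_taylor (v : V) (f : Poly K V) : (taylor v f).fst = f := by
  have h : (TrivSqZeroExt.fstHom K (Poly K V) (Poly K V)).comp (taylor v) = AlgHom.id K _ := by
    apply SymmetricAlgebra.algHom_ext
    ext φ
    simp [taylor_form]
  exact congrArg (fun F : Poly K V →ₐ[K] Poly K V => F f) h

/-- The derivative `∂_v` in the direction `v`: the derivation of `S` with `∂_v φ = φ(v)` for every
linear form `φ`. -/
def dirDeriv (v : V) : Derivation K (Poly K V) (Poly K V) where
  toFun f := (taylor v f).snd
  map_add' f g := by simp
  map_smul' c f := by simp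
  map_one_eq_zero' := by simp
  leibniz' f g := by
    simp [fst_taylor, mul_comm]

theorem dirDeriv_form (v : V) (φ : Module.Dual K V) :
    dirDeriv v (form K V φ) = algebraMap K (Poly K V) (φ v) := by
  change (taylor v (form K V φ)).snd = _
  rw [taylor_form, TrivSqZeroExt.snd_add, TrivSqZeroExt.snd_inl, TrivSqZeroExt.snd_inr, zero_add]

variable (K V) in
/-- The algebra of polynomial (constant coefficient) differential operators on `S`: all polynomials
in the directional derivatives `∂_v`. -/
def diffOps : Subalgebra K (Module.End K (Poly K V)) :=
  Algebra.adjoin K (Set.range fun v : V => (dirDeriv v).toLinearMap)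

/-- The space of `W`-harmonic polynomials: those annihilated by all `W`-invariant polynomial
differential operators `D` without constant term. The group acts on operators by conjugation, and
the constant term of `D` is `D 1`. -/
def harmonic (W : Subgroup (V ≃ₗ[K] V)) : Submodule K (Poly K V) where
  carrier := {h | ∀ D ∈ diffOps K V, (∀ g ∈ W, polyRep g * D * polyRep g⁻¹ = D) → D 1 = 0 → D h = 0}
  add_mem' ha hb D hD hW h1 := by rw [map_add, ha D hD hW h1, hb D hD hW h1, add_zero]
  zero_mem' D _ _ _ := map_zero D
  smul_mem' c h hh D hD hW h1 := by rw [map_smul, hh D hD hW h1, smul_zero]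

end Polynomials

section Groups

variable {K V : Type*} [Field K] [AddCommGroup V] [Module K V]

/-- A (pseudo)reflection: its fixed space is a hyperplane. (Elements of a finite group with this
property are the pseudoreflections of that group.) -/
def IsReflection (g : V ≃ₗ[K] V) : Prop :=
  Module.finrank K (LinearMap.ker (g.toLinearMap - LinearMap.id)) + 1 = Module.finrank K V

/-- The group `G` is generated by the reflections that it contains. -/
def GeneratedByReflections (G : Subgroup (V ≃ₗ[K] V)) : Prop :=
  Subgroup.closure {g | g ∈ G ∧ IsReflection g} = G

/-- The group `G_v` generated by the reflections in `G` that fix `v`. -/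
def parabolic (G : Subgroup (V ≃ₗ[K] V)) (v : V) : Subgroup (V ≃ₗ[K] V) :=
  Subgroup.closure {g | g ∈ G ∧ IsReflection g ∧ g v = v}

theorem parabolic_le (G : Subgroup (V ≃ₗ[K] V)) (v : V) : parabolic G v ≤ G :=
  (Subgroup.closure_le G).2 fun _ hg => hg.1

/-- The group `⟨W, γ⟩` generated by `W` and `γ`. -/
def adjoinElem (W : Subgroup (V ≃ₗ[K] V)) (γ : V ≃ₗ[K] V) : Subgroup (V ≃ₗ[K] V) :=
  W ⊔ Subgroup.zpowers γ

theorem le_adjoinElem (W : Subgroup (V ≃ₗ[K] V)) (γ : V ≃ₗ[K] V) : W ≤ adjoinElem W γ :=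
  le_sup_left

theorem adjoinElem_mono {W W' : Subgroup (V ≃ₗ[K] V)} (h : W ≤ W') (γ : V ≃ₗ[K] V) :
    adjoinElem W γ ≤ adjoinElem W' γ :=
  sup_le_sup_right h _

/-- The element `γ` of the group `⟨W, γ⟩`. -/
def adjoined (W : Subgroup (V ≃ₗ[K] V)) (γ : V ≃ₗ[K] V) : adjoinElem W γ :=
  ⟨γ, (le_sup_right : _ ≤ adjoinElem W γ) (Subgroup.mem_zpowers γ)⟩

end Groups

section Factors

variable {K V M : Type*} [Field K] [AddCommGroup V] [Module K V] [AddCommGroup M] [Module K M]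

/-- For a `Γ`-module `M`, the representation of `Γ` on `S ⊗ M^*`. -/
def tensorRep {Γ : Subgroup (V ≃ₗ[K] V)} (ρ : Representation K Γ M) :
    Representation K Γ (Poly K V ⊗[K] Module.Dual K M) :=
  Representation.tprod (polyRep.comp Γ.subtype) ρ.dual

variable (V M) in
/-- The homogeneous elements of degree `d` in `S ⊗ M^*`, where only the degree in `S` counts. -/
def homogeneousTensor (d : ℕ) : Submodule K (Poly K V ⊗[K] Module.Dual K M) :=
  LinearMap.range (LinearMap.rTensor (Module.Dual K M) (homogeneousPoly (K := K) (V := V) d).subtype)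

variable (W : Subgroup (V ≃ₗ[K] V)) (γ : V ≃ₗ[K] V) (ρ : Representation K (adjoinElem W γ) M)

/-- The space `(H ⊗ M^*)^W`, as a subspace of `S ⊗ M^*`, where `H` is the space of `W`-harmonic
polynomials. -/
def covariants : Submodule K (Poly K V ⊗[K] Module.Dual K M) :=
  LinearMap.range (LinearMap.rTensor (Module.Dual K M) (harmonic W).subtype) ⊓
    Representation.invariants ((tensorRep ρ).comp (Subgroup.inclusion (le_adjoinElem W γ)))

/-- A basis of `(H ⊗ M^*)^W` that consists of homogeneous eigenvectors of `γ`, with the degrees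
and the eigenvalues of its members. -/
structure FactorBasis where
  /-- the number of basis vectors -/
  size : ℕ
  /-- the basis -/
  basis : Module.Basis (Fin size) K (covariants W γ ρ)
  /-- the degrees -/
  deg : Fin size → ℕ
  /-- the eigenvalues of `γ`, that is the `M`-factors of the coset of `γ` -/
  factor : Fin size → K
  homogeneous : ∀ i, (basis i : Poly K V ⊗[K] Module.Dual K M) ∈ homogeneousTensor V M (deg i)
  eigen : ∀ i, tensorRep ρ (adjoined W γ) (basis i) =
    factor i • (basis i : Poly K V ⊗[K] Module.Dual K M)

variable {W γ ρ} in
/-- The multiset of all `ε_ι ζ ^ m_ι`, where `ι` runs over the basis, `ε_ι` is its eigenvalue and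
`m_ι` its degree. -/
def FactorBasis.weightedFactors (B : FactorBasis W γ ρ) (ζ : K) : Multiset K :=
  Finset.univ.val.map fun i => B.factor i * ζ ^ B.deg i

end Factors

end ReflectionCoset

end

/-!
Fix a reflection group `G`, an element `γ` of its normalizer, and representations on `U` and `E`;
put `S = Sym U`. The covariants `(S ⊗ E) ^ G` form a free module over the invariants `S ^ G`, and
there is a basis of homogeneous eigenvectors of `γ` (`nonempty_covBasis`). Eigenvectors that span
the covariants modulo the invariants without constant term generate the module by the graded form of
Nakayama's lemma, and they are independent by Chevalley's argument: the divided differences of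
reflections turn a relation over the invariants into a relation over `K` modulo the ideal generated
by the invariants without constant term (`sum_smul_mem_of_degLT`, `eq_zero_of_sum_mul_eq_zero`). The
rank is the dimension of `E` (`CovBasis.card_eq`).

Let `P` be a reflection subgroup of `G`, and let `y` be a point whose stabilizer in `G` lies in `P`.
Modulo the invariants of `P` that vanish at `y`, every covariant of `P` agrees with a covariant of
`G` (`exists_covariant_congr`). So the matrix that expresses a basis for `G` in a basis for `P`,
evaluated at `y`, is invertible (`exists_mul_transitionAt_eq_one`). Its entries come from
homogeneous eigenvectors of `γ`. If `γ` multiplies `y` by `ζ`, then the matrix intertwines the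
diagonal matrices with the entries `ε * ζ ^ m`, for the eigenvalues `ε` and the degrees `m` of the
two bases, and these agree up to order (`map_weighted_eq`).

The same matrix proves Steinberg's theorem (`mem_pointGroup`). Let `P` be generated by the
reflections that fix `y`, without assuming that it is the stabilizer. The zeros of the determinant
have stabilizers that are not contained in `P`. A hypersurface through `y` that consists of such
zeros would, by the Nullstellensatz, lie in the fixed space of an element outside `P`, which would
then be a reflection that fixes `y`. So the matrix is invertible at `y`, and the stabilizer of `y`
fixes every vector that `P` fixes, in any representation; the permutation representation on the
cosets of `P` shows that the stabilizer is `P`.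

It remains to pass from generators of covariants to harmonic covariants, for the covariants in
`Sym V^* ⊗ M^*`. Constant-coefficient differential operators give a perfect pairing in each degree
with `Sym V ⊗ M` (`covPairing`), and multiplication in `Sym V` is adjoint to differentiation. Hence
`(H ⊗ M^*) ^ G` is the orthogonal of the products of covariants in `Sym V ⊗ M` with invariants
without constant term (`covariants_eq_harmonicCov`). It has a basis dual to a basis of the module
`(Sym V ⊗ M) ^ G`, with equal degrees and inverse eigenvalues (`exists_basis_harmonicCov`). Finally,
the traces of powers of `γ` on covariants of given degree agree with those of the inverses on the
dual side. Dividing out the graded trace on the invariants, which is also self-dual, one finds that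
the generators of `(Sym V ⊗ M) ^ G` and of `(Sym V^* ⊗ M^*) ^ G` have equal degrees and inverse
eigenvalues (`sum_monomial_eq`, `weighted_eq_of_dual`).
-/

noncomputable section

namespace ReflectionCoset

/-! ### Homogeneous components in a symmetric algebra -/

section Grading

variable {K U : Type*} [Field K] [AddCommGroup U] [Module K U]

variable (K U) in
/-- The symmetric power of degree `d`, as a subspace of the symmetric algebra of `U`. -/
def symPower (d : ℕ) : Submodule K (SymmetricAlgebra K U) :=
  LinearMap.range (SymmetricAlgebra.ι K U) ^ d

variable (K U) in
/-- The grading of the symmetric algebra, encoded as the homomorphism `f ↦ f(T · )` to polynomials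
in `T`: a homogeneous element `f` of degree `d` is mapped to `f T ^ d`. -/
def gradeHom : SymmetricAlgebra K U →ₐ[K] Polynomial (SymmetricAlgebra K U) :=
  SymmetricAlgebra.lift
    ((Polynomial.monomial 1).restrictScalars K ∘ₗ SymmetricAlgebra.ι K U)

theorem gradeHom_ι (u : U) :
    gradeHom K U (SymmetricAlgebra.ι K U u) =
      Polynomial.monomial 1 (SymmetricAlgebra.ι K U u) := by
  simp [gradeHom]

/-- The homogeneous component of degree `d`. -/
def comp (d : ℕ) : SymmetricAlgebra K U →ₗ[K] SymmetricAlgebra K U :=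
  (Polynomial.lcoeff _ d).restrictScalars K ∘ₗ (gradeHom K U).toLinearMap

theorem comp_apply (d : ℕ) (f : SymmetricAlgebra K U) : comp d f = (gradeHom K U f).coeff d := rfl

theorem ι_mem_symPower (u : U) : SymmetricAlgebra.ι K U u ∈ symPower K U 1 := by
  rw [symPower, pow_one]; exact ⟨u, rfl⟩

theorem algebraMap_mem_symPower (c : K) :
    algebraMap K (SymmetricAlgebra K U) c ∈ symPower K U 0 := by
  rw [symPower, pow_zero]; exact Submodule.algebraMap_mem c

theorem mul_mem_symPower {d e : ℕ} {f g : SymmetricAlgebra K U} (hf : f ∈ symPower K U d)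
    (hg : g ∈ symPower K U e) : f * g ∈ symPower K U (d + e) := by
  rw [symPower, pow_add]; exact Submodule.mul_mem_mul hf hg

theorem gradeHom_of_mem {d : ℕ} {f : SymmetricAlgebra K U} (hf : f ∈ symPower K U d) :
    gradeHom K U f = Polynomial.monomial d f := by
  induction d generalizing f with
  | zero =>
    rw [symPower, pow_zero] at hf
    obtain ⟨c, rfl⟩ := Submodule.mem_one.1 hf
    rw [AlgHom.commutes]; rfl
  | succ d ih =>
    rw [symPower, pow_succ] at hf
    induction hf using Submodule.mul_induction_on' with
    | mem_mul_mem m hm n hn =>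
      obtain ⟨u, rfl⟩ := hn
      rw [map_mul, ih hm, gradeHom_ι, Polynomial.monomial_mul_monomial]
    | add x _ y _ hx hy => rw [map_add, map_add, hx, hy]

theorem comp_of_mem {d : ℕ} {f : SymmetricAlgebra K U} (hf : f ∈ symPower K U d) (e : ℕ) :
    comp e f = if d = e then f else 0 := by
  rw [comp_apply, gradeHom_of_mem hf, Polynomial.coeff_monomial]

theorem comp_self {d : ℕ} {f : SymmetricAlgebra K U} (hf : f ∈ symPower K U d) :
    comp d f = f := by
  rw [comp_of_mem hf, if_pos rfl]

theorem comp_mem (d : ℕ) (f : SymmetricAlgebra K U) : comp d f ∈ symPower K U d := by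
  induction f using SymmetricAlgebra.induction generalizing d with
  | algebraMap r =>
    rw [comp_of_mem (algebraMap_mem_symPower r)]
    split_ifs with h
    · exact h ▸ algebraMap_mem_symPower r
    · exact zero_mem _
  | ι x =>
    rw [comp_of_mem (ι_mem_symPower x)]
    split_ifs with h
    · exact h ▸ ι_mem_symPower x
    · exact zero_mem _
  | mul a b ha hb =>
    rw [comp_apply, map_mul, Polynomial.coeff_mul]
    refine Submodule.sum_mem _ fun x hx => ?_
    rw [← Finset.HasAntidiagonal.mem_antidiagonal.1 hx]
    exact mul_mem_symPower (ha _) (hb _)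
  | add a b ha hb => rw [map_add]; exact add_mem (ha _) (hb _)

theorem eval_gradeHom (f : SymmetricAlgebra K U) : (gradeHom K U f).eval 1 = f := by
  have h : ((Polynomial.aeval (1 : SymmetricAlgebra K U)).restrictScalars K).comp (gradeHom K U) =
      AlgHom.id K _ := by
    apply SymmetricAlgebra.algHom_ext
    ext u
    simp [gradeHom_ι]
  have := congrArg (fun F : SymmetricAlgebra K U →ₐ[K] SymmetricAlgebra K U => F f) h
  simpa [Polynomial.aeval_def, Polynomial.eval₂_eq_eval_map] using this

/-- The elements all of whose homogeneous components have degree less than `n`. -/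
def degLT (n : ℕ) : Submodule K (SymmetricAlgebra K U) where
  carrier := {f | ∀ d, n ≤ d → comp d f = 0}
  add_mem' ha hb d hd := by rw [map_add, ha d hd, hb d hd, add_zero]
  zero_mem' d _ := map_zero _
  smul_mem' c f hf d hd := by rw [map_smul, hf d hd, smul_zero]

theorem sum_comp_of_mem_degLT {n : ℕ} {f : SymmetricAlgebra K U} (hf : f ∈ degLT n) :
    ∑ d ∈ Finset.range n, comp d f = f := by
  conv_rhs => rw [← eval_gradeHom f]
  rw [Polynomial.eval_eq_sum, Polynomial.sum_def]
  simp only [one_pow, mul_one]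
  refine (Finset.sum_subset (fun d hd => ?_) fun d _ hd => ?_).symm
  · by_contra h
    exact Polynomial.mem_support_iff.1 hd (hf d (by simpa using h))
  · exact Polynomial.notMem_support_iff.1 hd

theorem exists_mem_degLT (f : SymmetricAlgebra K U) : ∃ n, ∀ m, n ≤ m → f ∈ degLT m :=
  ⟨(gradeHom K U f).natDegree + 1, fun _ hm _ hd =>
    Polynomial.coeff_eq_zero_of_natDegree_lt (Nat.lt_of_succ_le (hm.trans hd))⟩

theorem exists_sum_comp (f : SymmetricAlgebra K U) :
    ∃ n, ∀ m, n ≤ m → ∑ d ∈ Finset.range m, comp d f = f := by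
  obtain ⟨n, hn⟩ := exists_mem_degLT f
  exact ⟨n, fun m hm => sum_comp_of_mem_degLT (hn m hm)⟩

theorem eq_zero_of_comp {f : SymmetricAlgebra K U} (h : ∀ d, comp d f = 0) : f = 0 := by
  obtain ⟨n, hn⟩ := exists_sum_comp f
  rw [← hn n le_rfl]
  exact Finset.sum_eq_zero fun d _ => h d

theorem comp_add_mul {e : ℕ} {f : SymmetricAlgebra K U} (hf : f ∈ symPower K U e) (d : ℕ)
    (g : SymmetricAlgebra K U) : comp (d + e) (f * g) = f * comp d g := by
  rw [comp_apply, map_mul, gradeHom_of_mem hf, Polynomial.coeff_monomial_mul, comp_apply]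

theorem comp_mul (d : ℕ) (f g : SymmetricAlgebra K U) :
    comp d (f * g) = ∑ x ∈ Finset.HasAntidiagonal.antidiagonal d, comp x.1 f * comp x.2 g := by
  rw [comp_apply, map_mul, Polynomial.coeff_mul]; rfl

theorem comp_comp (d e : ℕ) (f : SymmetricAlgebra K U) :
    comp d (comp e f) = if e = d then comp e f else 0 :=
  comp_of_mem (comp_mem e f) d

theorem mem_symPower_iff {d : ℕ} {f : SymmetricAlgebra K U} :
    f ∈ symPower K U d ↔ comp d f = f :=
  ⟨comp_self, fun h => h ▸ comp_mem d f⟩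

/-- The constant term. -/
def constTerm : SymmetricAlgebra K U →ₐ[K] K := SymmetricAlgebra.algebraMapInv

theorem constTerm_ι (u : U) : constTerm (SymmetricAlgebra.ι K U u) = 0 :=
  SymmetricAlgebra.algebraMapInv_ι u

theorem comp_zero_eq (f : SymmetricAlgebra K U) : comp 0 f = algebraMap K _ (constTerm f) := by
  induction f using SymmetricAlgebra.induction with
  | algebraMap r => rw [comp_self (algebraMap_mem_symPower r), AlgHom.commutes]; rfl
  | ι x => rw [comp_of_mem (ι_mem_symPower x), constTerm_ι]; simp
  | mul a b ha hb => simp [comp_mul, ha, hb]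
  | add a b ha hb => rw [map_add, ha, hb, map_add, map_add]

theorem constTerm_of_mem {d : ℕ} (hd : d ≠ 0) {f : SymmetricAlgebra K U}
    (hf : f ∈ symPower K U d) : constTerm f = 0 := by
  have h := comp_zero_eq f
  rw [comp_of_mem hf, if_neg hd] at h
  exact (SymmetricAlgebra.algebraMap_eq_zero_iff (M := U) _).1 h.symm

theorem constTerm_comp (d : ℕ) (f : SymmetricAlgebra K U) :
    constTerm (comp d f) = if d = 0 then constTerm f else 0 := by
  split_ifs with h
  · subst h; rw [comp_zero_eq, AlgHom.commutes]; rfl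
  · exact constTerm_of_mem h (comp_mem d f)

theorem exists_eq_algebraMap {f : SymmetricAlgebra K U} (hf : f ∈ symPower K U 0) :
    f = algebraMap K _ (constTerm f) := by
  rw [← comp_zero_eq, comp_self hf]

instance finiteDimensional_symPower [FiniteDimensional K U] (d : ℕ) :
    FiniteDimensional K (symPower K U d) := by
  rw [FiniteDimensional, Module.Finite.iff_fg]
  exact Submodule.FG.pow (Module.Finite.iff_fg.1 inferInstance) d

variable {U' : Type*} [AddCommGroup U'] [Module K U']

theorem map_comp_of_linear {F : SymmetricAlgebra K U →ₐ[K] SymmetricAlgebra K U'} {φ : U →ₗ[K] U'}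
    (hF : ∀ u, F (SymmetricAlgebra.ι K U u) = SymmetricAlgebra.ι K U' (φ u)) (d : ℕ)
    (f : SymmetricAlgebra K U) : F (comp d f) = comp d (F f) := by
  have h : (gradeHom K U').comp F = (Polynomial.mapAlgHom F).comp (gradeHom K U) := by
    apply SymmetricAlgebra.algHom_ext
    ext u
    simp [gradeHom_ι, hF, Polynomial.map_monomial]
  have := congrArg (fun F : SymmetricAlgebra K U →ₐ[K] Polynomial (SymmetricAlgebra K U') =>
    (F f).coeff d) h
  simp only [AlgHom.comp_apply, Polynomial.coe_mapAlgHom, Polynomial.coeff_map] at this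
  exact this.symm

end Grading

/-! ### Averages over a finite group -/

section Average

variable {K W Γ : Type*} [Field K] [AddCommGroup W] [Module K W] [Group Γ]

/-- The vectors fixed by a subgroup `G` of the group that acts. -/
def fixedBy (r : Representation K Γ W) (G : Subgroup Γ) : Submodule K W where
  carrier := {w | ∀ g ∈ G, r g w = w}
  add_mem' ha hb g hg := by rw [map_add, ha g hg, hb g hg]
  zero_mem' g _ := map_zero _
  smul_mem' c w hw g hg := by rw [map_smul, hw g hg]

variable (r : Representation K Γ W) (G : Subgroup Γ) [Finite G]

/-- The projection to the vectors fixed by a finite subgroup. -/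
def average : W →ₗ[K] W :=
  letI := Fintype.ofFinite G
  (Nat.card G : K)⁻¹ • ∑ g : G, r g

theorem average_apply [Fintype G] (w : W) :
    average r G w = (Nat.card G : K)⁻¹ • ∑ g : G, r g w := by
  rw [average, LinearMap.smul_apply, LinearMap.sum_apply]
  congr!

theorem average_mem (w : W) : average r G w ∈ fixedBy r G := by
  have := Fintype.ofFinite G
  intro g hg
  rw [average_apply, map_smul, map_sum]
  congr 1
  refine Fintype.sum_equiv (Equiv.mulLeft ⟨g, hg⟩) _ _ fun x => ?_
  rw [← Module.End.mul_apply, ← map_mul]; rfl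

theorem average_sub_mem [CharZero K] {p : Submodule K W} {w : W} (h : ∀ g ∈ G, r g w - w ∈ p) :
    average r G w - w ∈ p := by
  have := Fintype.ofFinite G
  have hc : (Nat.card G : K) ≠ 0 := Nat.cast_ne_zero.2 Nat.card_pos.ne'
  have : average r G w - w = (Nat.card G : K)⁻¹ • ∑ g : G, (r g w - w) := by
    rw [average_apply, Finset.sum_sub_distrib, smul_sub, Finset.sum_const, Finset.card_univ,
      ← Nat.card_eq_fintype_card, ← Nat.cast_smul_eq_nsmul K, smul_smul, inv_mul_cancel₀ hc,
      one_smul]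
  rw [this]
  exact p.smul_mem _ (Submodule.sum_mem _ fun g _ => h g g.2)

theorem average_of_mem [CharZero K] {w : W} (hw : w ∈ fixedBy r G) : average r G w = w := by
  have := average_sub_mem r G (p := ⊥) (w := w) fun g hg => by simp [hw g hg]
  simpa [sub_eq_zero] using this

theorem average_mem_of_mem {p : Submodule K W} {w : W} (h : ∀ g ∈ G, r g w ∈ p) :
    average r G w ∈ p := by
  have := Fintype.ofFinite G
  rw [average_apply]
  exact p.smul_mem _ (Submodule.sum_mem _ fun g _ => h g g.2)

omit [Finite G] in
variable {r G} in
theorem normalizer_apply_mem {x : Γ} (hx : x ∈ Subgroup.normalizer (G : Set Γ)) {w : W}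
    (hw : w ∈ fixedBy r G) : r x w ∈ fixedBy r G := by
  intro g hg
  have h : x⁻¹ * g * x ∈ G := by
    have := (Subgroup.mem_normalizer_iff.1 (inv_mem hx) g).1 hg
    simpa using this
  have h2 := hw _ h
  calc r g (r x w) = r (x * (x⁻¹ * g * x)) w := by
        rw [← Module.End.mul_apply, ← map_mul]; congr 2; group
    _ = r x w := by rw [map_mul, Module.End.mul_apply, h2]

end Average

/-! ### Group actions on a symmetric algebra and invariants -/

section Action

variable {K U Γ : Type*} [Field K] [AddCommGroup U] [Module K U] [Group Γ]

/-- The action on the symmetric algebra by algebra endomorphisms that extends a linear action. -/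
def symAct (rU : Representation K Γ U) :
    Γ →* (SymmetricAlgebra K U →ₐ[K] SymmetricAlgebra K U) where
  toFun g := SymmetricAlgebra.lift (SymmetricAlgebra.ι K U ∘ₗ rU g)
  map_one' := by
    apply SymmetricAlgebra.algHom_ext
    ext φ
    simp
  map_mul' g h := by
    apply SymmetricAlgebra.algHom_ext
    ext φ
    simp

/-- The linear representation that underlies `symAct`. -/
def symRep (rU : Representation K Γ U) : Representation K Γ (SymmetricAlgebra K U) where
  toFun g := (symAct rU g).toLinearMap
  map_one' := by rw [map_one]; rfl
  map_mul' g h := by rw [map_mul]; rfl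

variable (rU : Representation K Γ U)

theorem symRep_ι (g : Γ) (u : U) :
    symRep rU g (SymmetricAlgebra.ι K U u) = SymmetricAlgebra.ι K U (rU g u) :=
  SymmetricAlgebra.lift_ι_apply _ _

theorem symRep_mul (g : Γ) (f f' : SymmetricAlgebra K U) :
    symRep rU g (f * f') = symRep rU g f * symRep rU g f' := map_mul (symAct rU g) f f'

theorem symRep_algebraMap (g : Γ) (c : K) :
    symRep rU g (algebraMap K _ c) = algebraMap K _ c := (symAct rU g).commutes c

theorem symRep_comp (g : Γ) (d : ℕ) (f : SymmetricAlgebra K U) :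
    symRep rU g (comp d f) = comp d (symRep rU g f) :=
  map_comp_of_linear (F := symAct rU g) (symRep_ι rU g) d f

theorem symRep_mem_symPower (g : Γ) {d : ℕ} {f : SymmetricAlgebra K U} (hf : f ∈ symPower K U d) :
    symRep rU g f ∈ symPower K U d := by
  rw [mem_symPower_iff, ← symRep_comp, comp_self hf]

theorem constTerm_symRep (g : Γ) (f : SymmetricAlgebra K U) :
    constTerm (symRep rU g f) = constTerm f := by
  have h : constTerm.comp (symAct rU g) = constTerm := by
    apply SymmetricAlgebra.algHom_ext
    ext u
    change constTerm (symRep rU g (SymmetricAlgebra.ι K U u)) = constTerm (SymmetricAlgebra.ι K U u)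
    rw [symRep_ι, constTerm_ι, constTerm_ι]
  exact congrArg (fun F : SymmetricAlgebra K U →ₐ[K] K => F f) h

/-- The algebra of invariants `S ^ G`. -/
def invAlg (G : Subgroup Γ) : Subalgebra K (SymmetricAlgebra K U) where
  carrier := {f | ∀ g ∈ G, symRep rU g f = f}
  mul_mem' ha hb g hg := by rw [symRep_mul, ha g hg, hb g hg]
  add_mem' ha hb g hg := by rw [map_add, ha g hg, hb g hg]
  algebraMap_mem' c g _ := symRep_algebraMap rU g c

theorem comp_mem_invAlg {G : Subgroup Γ} {f : SymmetricAlgebra K U} (hf : f ∈ invAlg rU G) (d : ℕ) :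
    comp d f ∈ invAlg rU G := fun g hg => by rw [symRep_comp, hf g hg]

variable (G : Subgroup Γ)

/-- The ideal of the invariants without constant term, in the algebra of invariants. Comments denote
it by `𝔪`. -/
def posInv : Ideal (invAlg rU G) :=
  RingHom.ker ((constTerm (K := K) (U := U)).comp (invAlg rU G).val)

theorem mem_posInv {f : invAlg rU G} :
    f ∈ posInv rU G ↔ constTerm (f : SymmetricAlgebra K U) = 0 := Iff.rfl

/-- The extension of an ideal of the algebra of invariants to the symmetric algebra. -/
def extIdeal (J : Ideal (invAlg rU G)) : Ideal (SymmetricAlgebra K U) :=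
  J.map (algebraMap (invAlg rU G) (SymmetricAlgebra K U))

variable {rU G}

theorem coe_mem_extIdeal {J : Ideal (invAlg rU G)} {x : invAlg rU G} (hx : x ∈ J) :
    (x : SymmetricAlgebra K U) ∈ extIdeal rU G J :=
  Ideal.mem_map_of_mem (algebraMap (invAlg rU G) (SymmetricAlgebra K U)) hx

/-- The ideal `J S` is the additive span of the products of elements of `S` and of `J`. -/
theorem extIdeal_induction {J : Ideal (invAlg rU G)} {p : SymmetricAlgebra K U → Prop}
    (hmul : ∀ x ∈ J, ∀ s : SymmetricAlgebra K U, p (s * x)) (hadd : ∀ s t, p s → p t → p (s + t))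
    {f : SymmetricAlgebra K U} (hf : f ∈ extIdeal rU G J) : p f := by
  have key : ∀ s : SymmetricAlgebra K U, p (s * f) := by
    refine Submodule.span_induction ?_ ?_ ?_ ?_ hf
    · rintro _ ⟨x, hx, rfl⟩ s
      exact hmul x hx s
    · intro s
      have := hmul 0 (zero_mem _) 0
      simpa using this
    · intro x y _ _ hx hy s
      rw [mul_add]; exact hadd _ _ (hx s) (hy s)
    · intro a x _ hx s
      rw [smul_eq_mul, ← mul_assoc]; exact hx _
  simpa using key 1

theorem symRep_mem_extIdeal {J : Ideal (invAlg rU G)} {g : Γ} (hg : g ∈ G)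
    {f : SymmetricAlgebra K U} (hf : f ∈ extIdeal rU G J) :
    symRep rU g f ∈ extIdeal rU G J := by
  refine extIdeal_induction (p := fun f => symRep rU g f ∈ extIdeal rU G J) ?_ ?_ hf
  · intro x hx s
    rw [symRep_mul, x.2 g hg]
    exact Ideal.mul_mem_left _ _ (coe_mem_extIdeal hx)
  · intro s t hs ht
    rw [map_add]; exact add_mem hs ht

section Finite

variable [Finite G]

theorem average_mul_of_mem {x : SymmetricAlgebra K U} (hx : x ∈ invAlg rU G)
    (s : SymmetricAlgebra K U) : average (symRep rU) G (s * x) = average (symRep rU) G s * x := by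
  have := Fintype.ofFinite G
  rw [average_apply, average_apply, smul_mul_assoc, Finset.sum_mul]
  congr 1
  refine Finset.sum_congr rfl fun g _ => ?_
  rw [symRep_mul, hx g g.2]

/-- The average, as an element of the algebra of invariants. -/
def reynolds (f : SymmetricAlgebra K U) : invAlg rU G :=
  ⟨average (symRep rU) G f, average_mem _ _ f⟩

theorem coe_reynolds (f : SymmetricAlgebra K U) :
    ((reynolds f : invAlg rU G) : SymmetricAlgebra K U) = average (symRep rU) G f := rfl

theorem reynolds_mem {J : Ideal (invAlg rU G)} {f : SymmetricAlgebra K U}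
    (hf : f ∈ extIdeal rU G J) : (reynolds f : invAlg rU G) ∈ J := by
  refine extIdeal_induction (p := fun f => (reynolds f : invAlg rU G) ∈ J) ?_ ?_ hf
  · intro x hx s
    have : (reynolds (s * x) : invAlg rU G) = reynolds s * x :=
      Subtype.ext (average_mul_of_mem x.2 s)
    rw [this]
    exact J.mul_mem_left _ hx
  · intro s t hs ht
    have : (reynolds (s + t) : invAlg rU G) = reynolds s + reynolds t :=
      Subtype.ext (map_add _ s t)
    rw [this]
    exact add_mem hs ht

theorem constTerm_average [CharZero K] (f : SymmetricAlgebra K U) :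
    constTerm (average (symRep rU) G f) = constTerm f := by
  have := average_sub_mem (symRep rU) G
    (p := LinearMap.ker (constTerm (K := K) (U := U)).toLinearMap)
    (w := f) fun g _ => by simp [constTerm_symRep]
  simpa [sub_eq_zero] using this

end Finite

end Action

/-! ### Divided differences and Chevalley's argument -/

section Chevalley

variable {K U Γ : Type*} [Field K] [AddCommGroup U] [Module K U] [Group Γ]

/-- An element acts on `U` as a reflection, or trivially, if it moves all vectors along a line. -/
def ActsAsReflection (rU : Representation K Γ U) (g : Γ) : Prop :=
  ∃ a : U, ∀ u, ∃ c : K, rU g u - u = c • a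

/-- The group `G` is generated by elements that act as reflections or trivially. -/
def GeneratedByActing (rU : Representation K Γ U) (G : Subgroup Γ) : Prop :=
  Subgroup.closure {g | g ∈ G ∧ ActsAsReflection rU g} = G

variable {rU : Representation K Γ U} {G : Subgroup Γ}

/-- Divided differences: if `g` moves all linear forms along `a`, then it moves every polynomial by
a multiple of `a`. -/
theorem exists_symRep_sub_eq {g : Γ} {a : U} (ha : ∀ u, ∃ c : K, rU g u - u = c • a)
    (f : SymmetricAlgebra K U) :
    ∃ q, symRep rU g f - f = SymmetricAlgebra.ι K U a * q := by
  induction f using SymmetricAlgebra.induction with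
  | algebraMap r => exact ⟨0, by rw [symRep_algebraMap]; simp⟩
  | ι x =>
    obtain ⟨c, hc⟩ := ha x
    refine ⟨algebraMap K _ c, ?_⟩
    rw [symRep_ι, ← map_sub, hc, map_smul, Algebra.smul_def, mul_comm]
  | mul x y hx hy =>
    obtain ⟨q, hq⟩ := hx
    obtain ⟨q', hq'⟩ := hy
    refine ⟨q * symRep rU g y + x * q', ?_⟩
    rw [symRep_mul]
    linear_combination symRep rU g y * hq + x * hq'
  | add x y hx hy =>
    obtain ⟨q, hq⟩ := hx
    obtain ⟨q', hq'⟩ := hy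
    refine ⟨q + q', ?_⟩
    rw [map_add]
    linear_combination hq + hq'

theorem ι_ne_zero {a : U} (ha : a ≠ 0) : SymmetricAlgebra.ι K U a ≠ 0 := by
  obtain ⟨φ, hφ⟩ := Module.Projective.exists_dual_ne_zero K ha
  intro h
  have := congrArg (SymmetricAlgebra.lift φ) h
  rw [SymmetricAlgebra.lift_ι_apply, map_zero] at this
  exact hφ this

theorem symRep_eq_self_of_trivial {g : Γ} (hg : ∀ u, rU g u = u) (f : SymmetricAlgebra K U) :
    symRep rU g f = f := by
  obtain ⟨q, hq⟩ := exists_symRep_sub_eq (a := (0 : U)) (fun u => ⟨0, by rw [hg]; simp⟩) f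
  simpa [sub_eq_zero] using hq

theorem mem_degLT_of_ι_mul_mem {a : U} (ha : a ≠ 0) {n : ℕ} {q : SymmetricAlgebra K U}
    (h : SymmetricAlgebra.ι K U a * q ∈ degLT (n + 1)) : q ∈ degLT n := by
  intro d hd
  have h1 := h (d + 1) (by omega)
  rw [comp_add_mul (ι_mem_symPower a)] at h1
  exact (mul_eq_zero.1 h1).resolve_left (ι_ne_zero ha)

theorem symRep_mem_degLT (g : Γ) {n : ℕ} {f : SymmetricAlgebra K U} (hf : f ∈ degLT n) :
    symRep rU g f ∈ degLT n := fun d hd => by rw [← symRep_comp, hf d hd, map_zero]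

/-- Divided differences preserve the ideals that are generated by invariants. -/
theorem mem_extIdeal_of_ι_mul_eq {J : Ideal (invAlg rU G)} {g : Γ} (hg : g ∈ G) {a : U}
    (ha : ∀ u, ∃ c : K, rU g u - u = c • a) (ha0 : a ≠ 0) {f q : SymmetricAlgebra K U}
    (hf : f ∈ extIdeal rU G J) (hq : symRep rU g f - f = SymmetricAlgebra.ι K U a * q) :
    q ∈ extIdeal rU G J := by
  have key : ∃ q' ∈ extIdeal rU G J, symRep rU g f - f = SymmetricAlgebra.ι K U a * q' := by
    refine extIdeal_induction (p := fun f => ∃ q' ∈ extIdeal rU G J,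
      symRep rU g f - f = SymmetricAlgebra.ι K U a * q') ?_ ?_ hf
    · intro x hx s
      obtain ⟨t, ht⟩ := exists_symRep_sub_eq ha s
      refine ⟨t * x, Ideal.mul_mem_left _ _ (coe_mem_extIdeal hx), ?_⟩
      rw [symRep_mul, x.2 g hg]
      linear_combination (x : SymmetricAlgebra K U) * ht
    · rintro s t ⟨q, hq, hqs⟩ ⟨q', hq', hqt⟩
      refine ⟨q + q', add_mem hq hq', ?_⟩
      rw [map_add]
      linear_combination hqs + hqt
  obtain ⟨q', hq', h⟩ := key
  rwa [mul_left_cancel₀ (ι_ne_zero ha0) (hq.symm.trans h)]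

/-- Invariance modulo a `G`-stable ideal may be tested on the generating reflections. -/
theorem symRep_sub_mem_of_generators {I : Ideal (SymmetricAlgebra K U)}
    (hI : ∀ g ∈ G, ∀ f ∈ I, symRep rU g f ∈ I) (hG : GeneratedByActing rU G)
    {q : SymmetricAlgebra K U}
    (h : ∀ g ∈ G, ActsAsReflection rU g → symRep rU g q - q ∈ I) :
    ∀ g ∈ G, symRep rU g q - q ∈ I := by
  intro g hg
  rw [← hG] at hg
  induction hg using Subgroup.closure_induction with
  | mem x hx => exact h x hx.1 hx.2
  | one => simp
  | mul x y hx hy ihx ihy =>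
    have hxG : x ∈ G := by rw [← hG]; exact hx
    have : symRep rU (x * y) q - q = symRep rU x (symRep rU y q - q) + (symRep rU x q - q) := by
      rw [map_mul, Module.End.mul_apply, map_sub]; ring
    rw [this]
    exact add_mem (hI x hxG _ ihy) ihx
  | inv x hx ih =>
    have hxG : x ∈ G := by rw [← hG]; exact hx
    have : symRep rU x⁻¹ q - q = - symRep rU x⁻¹ (symRep rU x q - q) := by
      rw [map_sub, ← Module.End.mul_apply, ← map_mul, inv_mul_cancel, map_one,
        Module.End.one_apply]; ring
    rw [this]
    exact neg_mem (hI _ (inv_mem hxG) _ ih)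

variable [CharZero K] [Finite G]

/-- Chevalley's argument. A functional `θ` on the invariants that vanishes on `𝔪 ^ (k + 1)` turns a
relation modulo `𝔪 ^ (k + 1) S` with coefficients in `𝔪 ^ k` into a relation modulo `𝔪 S` with
coefficients in `K`. The divided differences of a reflection are linear over the invariants and
lower degrees, so by induction the sum is invariant modulo `𝔪 S`. -/
theorem sum_smul_mem_of_degLT (hG : GeneratedByActing rU G) (k : ℕ) (θ : invAlg rU G →ₗ[K] K)
    (hθ : ∀ x ∈ posInv rU G ^ (k + 1), θ x = 0) {ι : Type*} (t : Finset ι) (u : ι → invAlg rU G)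
    (hu : ∀ i, u i ∈ posInv rU G ^ k) (n : ℕ) (p : ι → SymmetricAlgebra K U)
    (hp : ∀ i, p i ∈ degLT n)
    (h : ∑ i ∈ t, (u i : SymmetricAlgebra K U) * p i ∈ extIdeal rU G (posInv rU G ^ (k + 1))) :
    ∑ i ∈ t, θ (u i) • p i ∈ extIdeal rU G (posInv rU G) := by
  induction n generalizing p with
  | zero =>
    have hp0 : ∀ i, p i = 0 := fun i => eq_zero_of_comp fun d => hp i d (Nat.zero_le d)
    simp [hp0]
  | succ n ih =>
    set q := ∑ i ∈ t, θ (u i) • p i with hq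
    have hsub : ∀ g ∈ G, ActsAsReflection rU g →
        symRep rU g q - q ∈ extIdeal rU G (posInv rU G) := by
      rintro g hg ⟨a, ha⟩
      by_cases ha0 : a = 0
      · rw [symRep_eq_self_of_trivial, sub_self]
        · exact zero_mem _
        · intro u
          obtain ⟨c, hc⟩ := ha u
          rw [ha0, smul_zero] at hc
          exact sub_eq_zero.1 hc
      -- The divided differences satisfy a relation of the same kind in lower degree.
      choose Δ hΔ using fun f => exists_symRep_sub_eq (rU := rU) ha f
      have h1 : ∑ i ∈ t, (u i : SymmetricAlgebra K U) * Δ (p i) ∈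
          extIdeal rU G (posInv rU G ^ (k + 1)) := by
        refine mem_extIdeal_of_ι_mul_eq hg ha ha0 h ?_
        rw [map_sum, ← Finset.sum_sub_distrib, Finset.mul_sum]
        refine Finset.sum_congr rfl fun i _ => ?_
        rw [symRep_mul, (u i).2 g hg]
        linear_combination (u i : SymmetricAlgebra K U) * hΔ (p i)
      have h2 := ih (fun i => Δ (p i)) (fun i => by
        refine mem_degLT_of_ι_mul_mem ha0 ?_
        rw [← hΔ]
        exact sub_mem (symRep_mem_degLT g (hp i)) (hp i)) h1
      have h3 : symRep rU g q - q =
          SymmetricAlgebra.ι K U a * ∑ i ∈ t, θ (u i) • Δ (p i) := by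
        rw [hq, map_sum, ← Finset.sum_sub_distrib, Finset.mul_sum]
        refine Finset.sum_congr rfl fun i _ => ?_
        rw [map_smul, ← smul_sub, hΔ, mul_smul_comm]
      rw [h3]
      exact Ideal.mul_mem_left _ _ h2
    have hinv := average_sub_mem (symRep rU) G
      (p := (extIdeal rU G (posInv rU G)).restrictScalars K)
      (symRep_sub_mem_of_generators (fun g hg f hf => symRep_mem_extIdeal hg hf) hG hsub)
    -- The polynomial `q` is congruent to its average, which therefore is all that has to be
    -- studied.
    suffices hav : average (symRep rU) G q ∈ extIdeal rU G (posInv rU G) by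
      have := sub_mem hav hinv
      simpa using this
    -- each average is a constant plus an invariant without constant term
    set c : ι → K := fun i => constTerm (p i) with hc
    have hm : ∀ i, (reynolds (p i) : invAlg rU G) - algebraMap K _ (c i) ∈ posInv rU G := by
      intro i
      rw [mem_posInv]
      simp [coe_reynolds, constTerm_average, hc]
    have h0 : ∑ i ∈ t, u i * (reynolds (p i) : invAlg rU G) ∈ posInv rU G ^ (k + 1) := by
      have := reynolds_mem h
      convert this using 1
      apply Subtype.ext
      rw [coe_reynolds, map_sum, AddSubmonoidClass.coe_finsetSum]
      refine Finset.sum_congr rfl fun i _ => ?_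
      rw [mul_comm ((u i : SymmetricAlgebra K U)), average_mul_of_mem (u i).2, mul_comm]
      rfl
    have h1 : ∑ i ∈ t, c i • u i ∈ posInv rU G ^ (k + 1) := by
      have h2 : ∑ i ∈ t, u i * ((reynolds (p i) : invAlg rU G) - algebraMap K _ (c i)) ∈
          posInv rU G ^ (k + 1) :=
        Submodule.sum_mem _ fun i _ => by
          rw [pow_succ]; exact Ideal.mul_mem_mul (hu i) (hm i)
      have := sub_mem h0 h2
      rw [← Finset.sum_sub_distrib] at this
      convert this using 1
      refine Finset.sum_congr rfl fun i _ => ?_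
      rw [← mul_sub, sub_sub_cancel, Algebra.smul_def, mul_comm]
    have h2 := hθ _ h1
    have h3 : average (symRep rU) G q =
        ∑ i ∈ t, θ (u i) • ((((reynolds (p i) : invAlg rU G) - algebraMap K _ (c i) :
          invAlg rU G)) : SymmetricAlgebra K U) := by
      have h4 : ∑ i ∈ t, θ (u i) • algebraMap K (SymmetricAlgebra K U) (c i) = 0 := by
        rw [map_sum] at h2
        have := congrArg (algebraMap K (SymmetricAlgebra K U)) h2
        rw [map_zero, map_sum] at this
        rw [← this]
        refine Finset.sum_congr rfl fun i _ => ?_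
        rw [map_smul, smul_eq_mul, map_mul, Algebra.smul_def, mul_comm]
      rw [hq, map_sum]
      simp only [map_smul, AddSubgroupClass.coe_sub, smul_sub, Finset.sum_sub_distrib, coe_reynolds,
        SubalgebraClass.coe_algebraMap, h4, sub_zero]
    rw [h3]
    exact Submodule.sum_mem _ fun i _ => Submodule.smul_of_tower_mem _ _ (coe_mem_extIdeal (hm i))

theorem sum_smul_mem (hG : GeneratedByActing rU G) (k : ℕ) (θ : invAlg rU G →ₗ[K] K)
    (hθ : ∀ x ∈ posInv rU G ^ (k + 1), θ x = 0) {ι : Type*} (t : Finset ι) (u : ι → invAlg rU G)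
    (hu : ∀ i, u i ∈ posInv rU G ^ k) (p : ι → SymmetricAlgebra K U)
    (h : ∑ i ∈ t, (u i : SymmetricAlgebra K U) * p i = 0) :
    ∑ i ∈ t, θ (u i) • p i ∈ extIdeal rU G (posInv rU G) := by
  classical
  choose n hn using fun i => exists_mem_degLT (p i)
  have := sum_smul_mem_of_degLT hG k θ hθ t u hu (t.sup n) (fun i => if i ∈ t then p i else 0)
    (fun i => by
      split_ifs with hi
      · exact hn i _ (Finset.le_sup hi)
      · exact zero_mem _)
    (by
      rw [Finset.sum_congr rfl (g := fun i => (u i : SymmetricAlgebra K U) * p i)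
        fun i hi => by rw [if_pos hi], h]
      exact zero_mem _)
  rwa [Finset.sum_congr rfl (g := fun i => θ (u i) • p i) fun i hi => by rw [if_pos hi]] at this

omit [CharZero K] [Finite G] in
theorem comp_eq_zero_of_mem_posInv_pow {k : ℕ} {x : invAlg rU G} (hx : x ∈ posInv rU G ^ k) {d : ℕ}
    (hd : d < k) : comp d (x : SymmetricAlgebra K U) = 0 := by
  induction k generalizing x d with
  | zero => omega
  | succ k ih =>
    rw [pow_succ] at hx
    induction hx using Submodule.mul_induction_on' with
    | mem_mul_mem m hm n hn =>
      rw [MulMemClass.coe_mul, comp_mul]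
      refine Finset.sum_eq_zero fun y hy => ?_
      have h := Finset.HasAntidiagonal.mem_antidiagonal.1 hy
      by_cases hy2 : y.2 = 0
      · rw [hy2, comp_zero_eq, (mem_posInv rU G).1 hn, map_zero, mul_zero]
      · rw [ih hm (by omega), zero_mul]
    | add x _ y _ hx hy => rw [AddMemClass.coe_add, map_add, hx, hy, add_zero]

/-- The relations over the invariants between polynomials that are linearly independent modulo the
ideal generated by the invariants without constant term are trivial. The statement is for vectors
of polynomials, with independence tested coordinatewise. -/
theorem eq_zero_of_sum_mul_eq_zero (hG : GeneratedByActing rU G) {ι κ : Type*} (t : Finset ι)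
    (p : ι → κ → SymmetricAlgebra K U)
    (hp : ∀ c : ι → K, (∀ l, ∑ i ∈ t, c i • p i l ∈ extIdeal rU G (posInv rU G)) →
      ∀ i ∈ t, c i = 0)
    (u : ι → invAlg rU G) (h : ∀ l, ∑ i ∈ t, (u i : SymmetricAlgebra K U) * p i l = 0) :
    ∀ i ∈ t, u i = 0 := by
  classical
  have key : ∀ k, ∀ i ∈ t, u i ∈ posInv rU G ^ k := by
    intro k
    induction k with
    | zero => intro i _; simp
    | succ k ih =>
      intro i hi
      -- By induction all coefficients lie in `𝔪 ^ k`. If one of them were outside `𝔪 ^ (k + 1)`,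
      -- then a functional that detects it would produce a nontrivial relation over `K` modulo
      -- `𝔪 S`.
      by_contra hne
      obtain ⟨θ, hθ, hle⟩ := Submodule.exists_le_ker_of_notMem
        (p := (posInv rU G ^ (k + 1)).restrictScalars K) (v := u i) hne
      have h0 : ∀ l, ∑ i ∈ t, θ (u i) • p i l ∈ extIdeal rU G (posInv rU G) := by
        intro l
        have := sum_smul_mem hG k θ (fun x hx => hle hx) t (fun i => if i ∈ t then u i else 0)
          (fun i => by
            split_ifs with hi
            · exact ih i hi
            · exact zero_mem _) (fun i => p i l)
          (by rw [← h l]; exact Finset.sum_congr rfl fun i hi => by rw [if_pos hi])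
        rwa [Finset.sum_congr rfl (g := fun i => θ (u i) • p i l)
          fun i hi => by rw [if_pos hi]] at this
      exact hθ (hp _ h0 i hi)
  intro i hi
  apply Subtype.ext
  exact eq_zero_of_comp fun d =>
    comp_eq_zero_of_mem_posInv_pow (key (d + 1) i hi) (Nat.lt_succ_self d)

end Chevalley

/-! ### Operators that are spanned by eigenvectors -/

section Eigenvectors

variable {K W : Type*} [Field K] [AddCommGroup W] [Module K W]

/-- The space, which may have infinite dimension, is spanned by eigenvectors of the operator. -/
def EigenSpanned (f : Module.End K W) : Prop :=
  ∀ w, w ∈ Submodule.span K {w | ∃ μ : K, f w = μ • w}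

/-- Each vector is killed by a polynomial in `f` with simple roots, which may be enlarged at will.
-/
theorem EigenSpanned.exists_finset {f : Module.End K W} (hf : EigenSpanned f) (w : W) :
    ∃ s : Finset K, ∀ t, s ⊆ t →
      Polynomial.aeval f (∏ μ ∈ t, (Polynomial.X - Polynomial.C μ)) w = 0 := by
  classical
  induction hf w using Submodule.span_induction with
  | mem x hx =>
    obtain ⟨μ, hμ⟩ := hx
    refine ⟨{μ}, fun t ht => ?_⟩
    rw [← Finset.prod_erase_mul _ _ (ht (Finset.mem_singleton_self μ)), map_mul,
      Module.End.mul_apply]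
    simp [hμ]
  | zero => exact ⟨∅, fun t _ => map_zero _⟩
  | add x y _ _ hx hy =>
    obtain ⟨s, hs⟩ := hx
    obtain ⟨s', hs'⟩ := hy
    refine ⟨s ∪ s', fun t ht => ?_⟩
    rw [map_add, hs t (Finset.union_subset_left ht), hs' t (Finset.union_subset_right ht), add_zero]
  | smul a x _ hx =>
    obtain ⟨s, hs⟩ := hx
    exact ⟨s, fun t ht => by rw [map_smul, hs t ht, smul_zero]⟩

theorem EigenSpanned.isSemisimple_restrict {f : Module.End K W} (hf : EigenSpanned f)
    {Z : Submodule K W} [FiniteDimensional K Z] (hZ : ∀ z ∈ Z, f z ∈ Z) :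
    Module.End.IsSemisimple (f.restrict hZ) := by
  classical
  choose s hs using hf.exists_finset
  let b := Module.finBasis K Z
  let t := Finset.univ.biUnion fun i => s (b i : W)
  refine Module.End.isSemisimple_of_squarefree_aeval_eq_zero
    (p := ∏ μ ∈ t, (Polynomial.X - Polynomial.C μ)) ?_ ?_
  · exact (Polynomial.separable_prod_X_sub_C_iff'.2 fun _ _ _ _ h => h).squarefree
  · refine b.ext fun i => ?_
    apply Subtype.ext
    have h1 : ∀ (p : Polynomial K) (z : Z),
        ((Polynomial.aeval (f.restrict hZ) p z : Z) : W) = Polynomial.aeval f p (z : W) := by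
      intro p z
      induction p using Polynomial.induction_on' with
      | add p q hp hq => simp [hp, hq]
      | monomial n a =>
        simp only [Polynomial.aeval_monomial, Module.End.mul_apply, Module.algebraMap_end_apply,
          Submodule.coe_smul]
        congr 1
        induction n generalizing z with
        | zero => simp
        | succ n ih => rw [pow_succ, pow_succ, Module.End.mul_apply, Module.End.mul_apply, ih]; rfl
    rw [h1, hs _ t (Finset.subset_biUnion_of_mem (fun i => s (b i : W)) (Finset.mem_univ i))]
    simp

theorem exists_eigenbasis_of_isSemisimple [IsAlgClosed K] [FiniteDimensional K W]
    {f : Module.End K W} (hf : f.IsSemisimple) :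
    ∃ (ι : Type) (_ : Fintype ι) (b : Module.Basis ι K W) (μ : ι → K),
      ∀ i, f (b i) = μ i • b i := by
  classical
  have htop : ⨆ μ, Module.End.eigenspace f μ = ⊤ := by
    have h := Module.End.iSup_maxGenEigenspace_eq_top f
    simpa only [hf.isFinitelySemisimple.maxGenEigenspace_eq_eigenspace] using h
  have hspan : ⊤ ≤ Submodule.span K {w | ∃ μ : K, f w = μ • w} := by
    rw [← htop]
    refine iSup_le fun μ => fun x hx => Submodule.subset_span ⟨μ, ?_⟩
    exact Module.End.mem_eigenspace_iff.1 hx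
  obtain ⟨t, hts, hspan', hli⟩ := exists_linearIndependent K {w : W | ∃ μ : K, f w = μ • w}
  let b : Module.Basis t K W := Module.Basis.mk hli (by
    rw [Subtype.range_coe, hspan']; exact hspan)
  have hfin : Finite t := Module.Finite.finite_basis b
  let e := Finite.equivFin t
  choose μ hμ using fun i : t => hts i.2
  refine ⟨Fin (Nat.card t), inferInstance, b.reindex e, fun i => μ (e.symm i), fun i => ?_⟩
  rw [Module.Basis.reindex_apply]
  simpa [b] using hμ (e.symm i)

/-- A stable subspace of a finite dimensional space has a complement spanned by eigenvectors. -/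
theorem EigenSpanned.exists_complement [IsAlgClosed K] {f : Module.End K W} (hf : EigenSpanned f)
    {Y Z : Submodule K W} [FiniteDimensional K Z] (hZ : ∀ z ∈ Z, f z ∈ Z)
    (hY : ∀ y ∈ Y, f y ∈ Y) :
    ∃ (ι : Type) (_ : Fintype ι) (b : ι → W) (μ : ι → K), (∀ i, b i ∈ Z) ∧
      (∀ i, f (b i) = μ i • b i) ∧ (∀ c : ι → K, ∑ i, c i • b i ∈ Y → c = 0) ∧
      ∀ z ∈ Z, ∃ c : ι → K, z - ∑ i, c i • b i ∈ Y := by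
  have hss := hf.isSemisimple_restrict hZ
  obtain ⟨q, hq, hcompl⟩ := Module.End.isSemisimple_iff.1 hss (Y.comap Z.subtype)
    (by intro z hz; exact hY _ hz)
  obtain ⟨ι, hι, b, μ, hb⟩ := exists_eigenbasis_of_isSemisimple (hss.restrict hq)
  refine ⟨ι, hι, fun i => ((b i : Z) : W), μ, fun i => (b i : Z).2, fun i => ?_, fun c hc => ?_,
    fun z hz => ?_⟩
  · exact congrArg (fun z : q => ((z : Z) : W)) (hb i)
  · have h1 : ((∑ i, c i • b i : q) : Z) ∈ Y.comap Z.subtype ⊓ q := by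
      refine ⟨?_, Subtype.property _⟩
      simpa using hc
    rw [hcompl.inf_eq_bot] at h1
    have h2 : ∑ i, c i • b i = 0 := Subtype.ext h1
    funext i
    exact Fintype.linearIndependent_iff.1 b.linearIndependent c h2 i
  · have h1 : (⟨z, hz⟩ : Z) ∈ Y.comap Z.subtype ⊔ q := by rw [hcompl.sup_eq_top]; trivial
    obtain ⟨y, hy, w, hw, hyw⟩ := Submodule.mem_sup.1 h1
    refine ⟨fun i => b.repr ⟨w, hw⟩ i, ?_⟩
    have h2 := congrArg (fun z : q => ((z : Z) : W)) (b.sum_repr ⟨w, hw⟩)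
    simp only [AddSubmonoidClass.coe_finsetSum, Submodule.coe_smul] at h2
    rw [h2]
    have h3 : z = (y : W) + w := congrArg Subtype.val hyw.symm
    rw [h3, add_sub_cancel_right]
    exact hy

end Eigenvectors

/-! ### The module `S ⊗ E` -/

section Covariants

variable {K U E Γ : Type*} [Field K] [AddCommGroup U] [Module K U] [AddCommGroup E] [Module K E]
  [Group Γ]

/-- The representation on `S ⊗ E`. -/
def covRep (rU : Representation K Γ U) (rE : Representation K Γ E) :
    Representation K Γ (SymmetricAlgebra K U ⊗[K] E) :=
  Representation.tprod (symRep rU) rE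

variable (rU : Representation K Γ U) (rE : Representation K Γ E)

theorem covRep_tmul (g : Γ) (f : SymmetricAlgebra K U) (e : E) :
    covRep rU rE g (f ⊗ₜ e) = symRep rU g f ⊗ₜ rE g e := rfl

theorem covRep_smul (g : Γ) (f : SymmetricAlgebra K U) (x : SymmetricAlgebra K U ⊗[K] E) :
    covRep rU rE g (f • x) = symRep rU g f • covRep rU rE g x := by
  induction x using TensorProduct.induction_on with
  | zero => simp
  | tmul f' e =>
    rw [TensorProduct.smul_tmul', covRep_tmul, covRep_tmul, TensorProduct.smul_tmul', smul_eq_mul,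
      smul_eq_mul, symRep_mul]
  | add x y hx hy => rw [smul_add, map_add, hx, hy, map_add, smul_add]

/-- The homogeneous component of degree `d` of an element of `S ⊗ E`. -/
def covComp (d : ℕ) : SymmetricAlgebra K U ⊗[K] E →ₗ[K] SymmetricAlgebra K U ⊗[K] E :=
  LinearMap.rTensor E (comp d)

theorem covComp_tmul (d : ℕ) (f : SymmetricAlgebra K U) (e : E) :
    covComp d (f ⊗ₜ[K] e) = comp d f ⊗ₜ e := rfl

variable (K U E) in
/-- The elements of degree `d` in `S ⊗ E`. -/
def covPower (d : ℕ) : Submodule K (SymmetricAlgebra K U ⊗[K] E) :=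
  LinearMap.range (LinearMap.rTensor E (symPower K U d).subtype)

theorem covComp_covComp (d e : ℕ) (x : SymmetricAlgebra K U ⊗[K] E) :
    covComp d (covComp e x) = if e = d then covComp e x else 0 := by
  induction x using TensorProduct.induction_on with
  | zero => simp
  | tmul f v =>
    rw [covComp_tmul, covComp_tmul, comp_comp]
    split_ifs <;> simp
  | add x y hx hy =>
    rw [map_add, map_add, hx, hy]
    split_ifs <;> simp

theorem covComp_mem (d : ℕ) (x : SymmetricAlgebra K U ⊗[K] E) : covComp d x ∈ covPower K U E d := by
  induction x using TensorProduct.induction_on with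
  | zero => simp
  | tmul f v => exact ⟨(⟨comp d f, comp_mem d f⟩ : symPower K U d) ⊗ₜ v, rfl⟩
  | add x y hx hy => rw [map_add]; exact add_mem hx hy

theorem mem_covPower_iff {d : ℕ} {x : SymmetricAlgebra K U ⊗[K] E} :
    x ∈ covPower K U E d ↔ covComp d x = x := by
  refine ⟨?_, fun h => h ▸ covComp_mem d x⟩
  rintro ⟨y, rfl⟩
  induction y using TensorProduct.induction_on with
  | zero => simp
  | tmul f v =>
    rw [LinearMap.rTensor_tmul, covComp_tmul, Submodule.subtype_apply, comp_self f.2]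
  | add x y hx hy => rw [map_add, map_add, hx, hy]

theorem covComp_of_mem {d : ℕ} {x : SymmetricAlgebra K U ⊗[K] E} (hx : x ∈ covPower K U E d)
    (e : ℕ) : covComp e x = if d = e then x else 0 := by
  rw [← mem_covPower_iff.1 hx, covComp_covComp]

theorem covRep_covComp (g : Γ) (d : ℕ) (x : SymmetricAlgebra K U ⊗[K] E) :
    covRep rU rE g (covComp d x) = covComp d (covRep rU rE g x) := by
  induction x using TensorProduct.induction_on with
  | zero => simp
  | tmul f v => rw [covComp_tmul, covRep_tmul, covRep_tmul, covComp_tmul, symRep_comp]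
  | add x y hx hy => simp only [map_add, hx, hy]

theorem covRep_mem_covPower (g : Γ) {d : ℕ} {x : SymmetricAlgebra K U ⊗[K] E}
    (hx : x ∈ covPower K U E d) : covRep rU rE g x ∈ covPower K U E d := by
  rw [mem_covPower_iff, ← covRep_covComp, mem_covPower_iff.1 hx]

theorem covComp_mem_fixedBy {G : Subgroup Γ} {x : SymmetricAlgebra K U ⊗[K] E}
    (hx : x ∈ fixedBy (covRep rU rE) G) (d : ℕ) : covComp d x ∈ fixedBy (covRep rU rE) G :=
  fun g hg => by rw [covRep_covComp, hx g hg]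

theorem exists_sum_covComp (x : SymmetricAlgebra K U ⊗[K] E) :
    ∃ n, ∀ m, n ≤ m → ∑ d ∈ Finset.range m, covComp d x = x := by
  induction x using TensorProduct.induction_on with
  | zero => exact ⟨0, fun m _ => by simp⟩
  | tmul f v =>
    obtain ⟨n, hn⟩ := exists_sum_comp f
    refine ⟨n, fun m hm => ?_⟩
    simp only [covComp_tmul]
    rw [← TensorProduct.sum_tmul, hn m hm]
  | add x y hx hy =>
    obtain ⟨n, hn⟩ := hx
    obtain ⟨n', hn'⟩ := hy
    refine ⟨max n n', fun m hm => ?_⟩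
    simp only [map_add, Finset.sum_add_distrib]
    rw [hn m (le_trans (le_max_left _ _) hm), hn' m (le_trans (le_max_right _ _) hm)]

theorem mem_of_covComp_mem {p : Submodule K (SymmetricAlgebra K U ⊗[K] E)}
    {x : SymmetricAlgebra K U ⊗[K] E} (h : ∀ d, covComp d x ∈ p) : x ∈ p := by
  obtain ⟨n, hn⟩ := exists_sum_covComp x
  rw [← hn n le_rfl]
  exact Submodule.sum_mem _ fun d _ => h d

theorem covComp_smul (d : ℕ) (f : SymmetricAlgebra K U) (x : SymmetricAlgebra K U ⊗[K] E) :
    covComp d (f • x) =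
      ∑ y ∈ Finset.HasAntidiagonal.antidiagonal d, comp y.1 f • covComp y.2 x := by
  induction x using TensorProduct.induction_on with
  | zero => simp
  | tmul f' v =>
    rw [TensorProduct.smul_tmul', covComp_tmul, smul_eq_mul, comp_mul, TensorProduct.sum_tmul]
    rfl
  | add x y hx hy => simp only [smul_add, map_add, hx, hy, Finset.sum_add_distrib]

theorem covComp_smul_of_mem {d : ℕ} (e : ℕ) (f : SymmetricAlgebra K U)
    {x : SymmetricAlgebra K U ⊗[K] E} (hx : x ∈ covPower K U E d) :
    covComp e (f • x) = if d ≤ e then comp (e - d) f • x else 0 := by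
  rw [covComp_smul]
  simp only [covComp_of_mem hx, smul_ite, smul_zero]
  split_ifs with h
  · rw [Finset.sum_eq_single (e - d, d)]
    · simp
    · intro y hy hne
      have := Finset.HasAntidiagonal.mem_antidiagonal.1 hy
      rw [if_neg]
      rintro rfl
      exact hne (by ext <;> simp; omega)
    · intro hn
      exact absurd (Finset.HasAntidiagonal.mem_antidiagonal.2 (by simp; omega)) hn
  · refine Finset.sum_eq_zero fun y hy => ?_
    have := Finset.HasAntidiagonal.mem_antidiagonal.1 hy
    rw [if_neg (by omega)]

theorem smul_mem_covPower {d e : ℕ} {f : SymmetricAlgebra K U} {x : SymmetricAlgebra K U ⊗[K] E}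
    (hf : f ∈ symPower K U d) (hx : x ∈ covPower K U E e) : f • x ∈ covPower K U E (d + e) := by
  rw [mem_covPower_iff, covComp_smul_of_mem _ _ hx, if_pos (by omega), Nat.add_sub_cancel,
    comp_self hf]

instance [FiniteDimensional K U] [FiniteDimensional K E] (d : ℕ) :
    FiniteDimensional K (covPower K U E d) := by
  have h : (covPower K U E d).FG := by
    rw [covPower, LinearMap.range_eq_map]
    exact Submodule.FG.map _ Module.Finite.fg_top
  exact Module.Finite.iff_fg.2 h

/-- The coordinate with respect to a linear form on `E`. -/
def coord (ξ : Module.Dual K E) :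
    SymmetricAlgebra K U ⊗[K] E →ₗ[SymmetricAlgebra K U] SymmetricAlgebra K U :=
  Module.Dual.baseChange (SymmetricAlgebra K U) ξ

theorem coord_tmul (ξ : Module.Dual K E) (f : SymmetricAlgebra K U) (e : E) :
    coord ξ (f ⊗ₜ e) = ξ e • f := by
  simp [coord]

theorem eq_sum_coord [FiniteDimensional K E] {ι : Type*} [Fintype ι] (b : Module.Basis ι K E)
    (x : SymmetricAlgebra K U ⊗[K] E) :
    x = ∑ i, coord (b.coord i) x • ((1 : SymmetricAlgebra K U) ⊗ₜ[K] b i) := by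
  induction x using TensorProduct.induction_on with
  | zero => simp
  | tmul f v =>
    simp only [coord_tmul, TensorProduct.smul_tmul', smul_eq_mul, mul_one, TensorProduct.smul_tmul]
    rw [← TensorProduct.tmul_sum]
    congr 1
    exact (b.sum_repr v).symm
  | add x y hx hy =>
    simp only [map_add, add_smul, Finset.sum_add_distrib]
    rw [← hx, ← hy]

theorem EigenSpanned.symRep {γ : Γ} (hU : EigenSpanned (rU γ)) : EigenSpanned (symRep rU γ) := by
  intro f
  induction f using SymmetricAlgebra.induction with
  | algebraMap r => exact Submodule.subset_span ⟨1, by rw [symRep_algebraMap, one_smul]⟩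
  | ι x =>
    induction hU x using Submodule.span_induction with
    | mem x hx =>
      obtain ⟨μ, hμ⟩ := hx
      exact Submodule.subset_span ⟨μ, by rw [symRep_ι, hμ, map_smul]⟩
    | zero => rw [map_zero]; exact zero_mem _
    | add x y _ _ hx hy => rw [map_add]; exact add_mem hx hy
    | smul a x _ hx => rw [map_smul]; exact Submodule.smul_mem _ _ hx
  | mul a b ha hb =>
    have := Submodule.mul_mem_mul ha hb
    rw [Submodule.span_mul_span] at this
    refine Submodule.span_mono ?_ this
    rintro _ ⟨x, ⟨μ, hμ⟩, y, ⟨ν, hν⟩, rfl⟩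
    exact ⟨μ * ν, by
      change ReflectionCoset.symRep rU γ (x * y) = (μ * ν) • (x * y)
      rw [symRep_mul, hμ, hν, smul_mul_smul_comm]⟩
  | add a b ha hb => exact add_mem ha hb

theorem EigenSpanned.covRep {γ : Γ} (hU : EigenSpanned (rU γ)) (hE : EigenSpanned (rE γ)) :
    EigenSpanned (covRep rU rE γ) := by
  intro x
  induction x using TensorProduct.induction_on with
  | zero => exact zero_mem _
  | tmul f v =>
    have key := Submodule.apply_mem_map₂ (TensorProduct.mk K (SymmetricAlgebra K U) E)
      (EigenSpanned.symRep rU hU f) (hE v)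
    rw [Submodule.map₂_span_span] at key
    refine Submodule.span_mono ?_ key
    rintro _ ⟨x, ⟨μ, hμ⟩, y, ⟨ν, hν⟩, rfl⟩
    refine ⟨μ * ν, ?_⟩
    simp only [TensorProduct.mk_apply]
    rw [covRep_tmul, hμ, hν, TensorProduct.smul_tmul_smul]
  | add x y hx hy => exact add_mem hx hy

end Covariants

/-! ### Ideals generated by invariants -/

section Ideals

variable {K U E Γ : Type*} [Field K] [AddCommGroup U] [Module K U] [AddCommGroup E] [Module K E]
  [Group Γ] {rU : Representation K Γ U} {rE : Representation K Γ E} {G : Subgroup Γ}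

variable (rU G) in
/-- The ideal of the invariants that vanish at a point; points of the spectrum of `S` are given by
homomorphisms to `K`. The ideal `posInv` belongs to the origin. -/
def maxInv (φ : SymmetricAlgebra K U →ₐ[K] K) : Ideal (invAlg rU G) :=
  RingHom.ker (φ.comp (invAlg rU G).val)

theorem mem_maxInv {φ : SymmetricAlgebra K U →ₐ[K] K} {f : invAlg rU G} :
    f ∈ maxInv rU G φ ↔ φ (f : SymmetricAlgebra K U) = 0 := Iff.rfl

/-- A power of a polynomial `h` that vanishes on the orbit of a point lies in the ideal generated
by the invariants that vanish at the point: `h` is a root of the polynomial `∏ (T - g h)`. -/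
theorem pow_card_mem [Finite G] {φ : SymmetricAlgebra K U →ₐ[K] K} {h : SymmetricAlgebra K U}
    (hφ : ∀ g ∈ G, φ (symRep rU g h) = 0) :
    h ^ Nat.card G ∈ extIdeal rU G (maxInv rU G φ) := by
  classical
  have := Fintype.ofFinite G
  -- The coefficients of `P` are invariant, and those below the leading one vanish at the point.
  set P : Polynomial (SymmetricAlgebra K U) :=
    ∏ g : G, (Polynomial.X - Polynomial.C (symRep rU (g : Γ) h)) with hP
  have hmonic : P.Monic := Polynomial.monic_prod_of_monic _ _ fun g _ => Polynomial.monic_X_sub_C _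
  have hdeg : P.natDegree = Nat.card G := by
    rw [hP, Polynomial.natDegree_prod_of_monic _ _ fun g _ => Polynomial.monic_X_sub_C _]
    simp
  have hroot : P.eval h = 0 := by
    rw [hP, Polynomial.eval_prod]
    refine Finset.prod_eq_zero (Finset.mem_univ (1 : G)) ?_
    simp
  have hinv : ∀ i, P.coeff i ∈ invAlg rU G := by
    intro i g hg
    have : P.map (symAct rU g).toRingHom = P := by
      rw [hP, Polynomial.map_prod]
      refine Fintype.prod_equiv (Equiv.mulLeft ⟨g, hg⟩) _ _ fun x => ?_
      rw [Polynomial.map_sub, Polynomial.map_X, Polynomial.map_C]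
      congr 2
      change symRep rU g (symRep rU (x : Γ) h) = symRep rU (g * x) h
      rw [map_mul]; rfl
    conv_rhs => rw [← this]
    rw [Polynomial.coeff_map]; rfl
  have hvan : ∀ i < Nat.card G, φ (P.coeff i) = 0 := by
    intro i hi
    have : P.map φ.toRingHom = Polynomial.X ^ Nat.card G := by
      rw [hP, Polynomial.map_prod]
      have : ∀ g : G, (Polynomial.X - Polynomial.C (symRep rU (g : Γ) h)).map φ.toRingHom =
          Polynomial.X := by
        intro g
        rw [Polynomial.map_sub, Polynomial.map_X, Polynomial.map_C]
        have := hφ g g.2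
        change Polynomial.X - Polynomial.C (φ (symRep rU (g : Γ) h)) = _
        rw [this, map_zero, sub_zero]
      rw [Finset.prod_congr rfl fun g _ => this g, Finset.prod_const, Finset.card_univ,
        Nat.card_eq_fintype_card]
    have h2 := congrArg (fun p => Polynomial.coeff p i) this
    simp only [Polynomial.coeff_map, Polynomial.coeff_X_pow, if_neg hi.ne] at h2
    exact h2
  have hsum : h ^ Nat.card G = - ∑ i ∈ Finset.range (Nat.card G), P.coeff i * h ^ i := by
    rw [Polynomial.eval_eq_sum_range, hdeg, Finset.sum_range_succ, ← hdeg, hmonic.coeff_natDegree,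
      hdeg, one_mul] at hroot
    linear_combination hroot
  rw [hsum]
  refine neg_mem (Submodule.sum_mem _ fun i hi => Ideal.mul_mem_right _ _ ?_)
  exact coe_mem_extIdeal (x := ⟨P.coeff i, hinv i⟩) (hvan i (Finset.mem_range.1 hi))

/-- The ideal generated by the invariants without constant term contains all polynomials of large
degree, since its zero set is the origin. -/
theorem exists_symPower_le [Finite G] [FiniteDimensional K U] :
    ∃ D, ∀ d, D ≤ d → ∀ f ∈ symPower K U d, f ∈ extIdeal rU G (posInv rU G) := by
  classical
  let b := Module.finBasis K U
  let L : Ideal (SymmetricAlgebra K U) :=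
    Ideal.span (Set.range fun i => SymmetricAlgebra.ι K U (b i))
  have hL : ∀ u, SymmetricAlgebra.ι K U u ∈ L := by
    intro u
    rw [← b.sum_repr u, map_sum]
    refine Submodule.sum_mem _ fun i _ => ?_
    rw [map_smul]
    exact Submodule.smul_of_tower_mem _ _ (Ideal.subset_span ⟨i, rfl⟩)
  have hrad : L ≤ (extIdeal rU G (posInv rU G)).radical := by
    refine Ideal.span_le.2 ?_
    rintro _ ⟨i, rfl⟩
    refine ⟨Nat.card G, pow_card_mem (φ := constTerm) fun g _ => ?_⟩
    rw [constTerm_symRep, constTerm_ι]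
  obtain ⟨D, hD⟩ := Ideal.exists_pow_le_of_le_radical_of_fg hrad
    ⟨Finset.univ.image fun i => SymmetricAlgebra.ι K U (b i), by simp [L]⟩
  refine ⟨D, fun d hd f hf => hD (Ideal.pow_le_pow_right hd ?_)⟩
  clear hd
  induction d generalizing f with
  | zero => simp
  | succ d ih =>
    rw [symPower, pow_succ] at hf
    induction hf using Submodule.mul_induction_on' with
    | mem_mul_mem m hm n hn =>
      obtain ⟨u, rfl⟩ := hn
      rw [pow_succ]
      exact Ideal.mul_mem_mul (ih m hm) (hL u)
    | add x _ y _ hx hy => exact add_mem hx hy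

variable (rU G E) in
/-- The subspace `J (S ⊗ E)`, for an ideal `J` of the algebra of invariants: all coordinates lie in
`J S`. -/
def extSub (J : Ideal (invAlg rU G)) :
    Submodule (SymmetricAlgebra K U) (SymmetricAlgebra K U ⊗[K] E) where
  carrier := {x | ∀ ξ, coord ξ x ∈ extIdeal rU G J}
  add_mem' ha hb ξ := by rw [map_add]; exact add_mem (ha ξ) (hb ξ)
  zero_mem' ξ := by rw [map_zero]; exact zero_mem _
  smul_mem' f x hx ξ := by rw [map_smul]; exact Ideal.mul_mem_left _ _ (hx ξ)

theorem smul_mem_extSub {J : Ideal (invAlg rU G)} {f : SymmetricAlgebra K U}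
    (hf : f ∈ extIdeal rU G J) (x : SymmetricAlgebra K U ⊗[K] E) : f • x ∈ extSub E rU G J := by
  intro ξ
  rw [map_smul]; exact Ideal.mul_mem_right _ _ hf

theorem mem_extSub_of_basis [FiniteDimensional K E] {ι : Type*} [Fintype ι]
    (b : Module.Basis ι K E) {J : Ideal (invAlg rU G)} {x : SymmetricAlgebra K U ⊗[K] E}
    (hx : ∀ i, coord (b.coord i) x ∈ extIdeal rU G J) : x ∈ extSub E rU G J := by
  rw [eq_sum_coord b x]
  exact Submodule.sum_mem _ fun i _ => smul_mem_extSub (hx i) _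

variable (rU rE G) in
/-- The subspace `J (S ⊗ E) ^ G`, for an ideal `J` of the algebra of invariants. -/
def invMul (J : Ideal (invAlg rU G)) : Submodule K (SymmetricAlgebra K U ⊗[K] E) :=
  Submodule.span K {z | ∃ a ∈ J, ∃ n ∈ fixedBy (covRep rU rE) G,
    z = (a : SymmetricAlgebra K U) • n}

theorem smul_mem_fixedBy {a : SymmetricAlgebra K U} (ha : a ∈ invAlg rU G)
    {n : SymmetricAlgebra K U ⊗[K] E} (hn : n ∈ fixedBy (covRep rU rE) G) :
    a • n ∈ fixedBy (covRep rU rE) G := fun g hg => by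
  rw [covRep_smul, ha g hg, hn g hg]

theorem average_smul_of_mem [Finite G] {a : SymmetricAlgebra K U} (ha : a ∈ invAlg rU G)
    (x : SymmetricAlgebra K U ⊗[K] E) :
    average (covRep rU rE) G (a • x) = a • average (covRep rU rE) G x := by
  have := Fintype.ofFinite G
  have h : ∀ g : G, covRep rU rE g (a • x) = a • covRep rU rE g x := fun g => by
    rw [covRep_smul, ha g g.2]
  rw [average_apply, average_apply, Finset.sum_congr rfl fun g _ => h g, ← Finset.smul_sum,
    smul_comm]

/-- Averaging maps `J (S ⊗ E)` to `J (S ⊗ E) ^ G`. -/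
theorem average_mem_invMul [Finite G] [FiniteDimensional K E] {J : Ideal (invAlg rU G)}
    {x : SymmetricAlgebra K U ⊗[K] E} (hx : x ∈ extSub E rU G J) :
    average (covRep rU rE) G x ∈ invMul rU rE G J := by
  have key : ∀ f ∈ extIdeal rU G J, ∀ z : SymmetricAlgebra K U ⊗[K] E,
      average (covRep rU rE) G (f • z) ∈ invMul rU rE G J := by
    intro f hf
    refine extIdeal_induction (p := fun f : SymmetricAlgebra K U =>
      ∀ z : SymmetricAlgebra K U ⊗[K] E,
      average (covRep rU rE) G (f • z) ∈ invMul rU rE G J) ?_ ?_ hf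
    · intro a ha s z
      have h : (a : SymmetricAlgebra K U) ∈ invAlg rU G := a.2
      rw [mul_comm s, mul_smul, average_smul_of_mem h]
      exact Submodule.subset_span ⟨a, ha, _, average_mem _ _ _, rfl⟩
    · intro s t hs ht z
      rw [add_smul, map_add]; exact add_mem (hs z) (ht z)
  rw [eq_sum_coord (Module.finBasis K E) x, map_sum]
  exact Submodule.sum_mem _ fun i _ => key _ (hx _) _

/-- `J (S ⊗ E)` and `J (S ⊗ E) ^ G` contain the same covariants, by averaging. -/
theorem mem_invMul_of_mem [CharZero K] [Finite G] [FiniteDimensional K E] {J : Ideal (invAlg rU G)}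
    {x : SymmetricAlgebra K U ⊗[K] E} (hx : x ∈ extSub E rU G J)
    (hG : x ∈ fixedBy (covRep rU rE) G) : x ∈ invMul rU rE G J := by
  rw [← average_of_mem _ _ hG]; exact average_mem_invMul hx

theorem coord_covComp (ξ : Module.Dual K E) (d : ℕ) (x : SymmetricAlgebra K U ⊗[K] E) :
    coord ξ (covComp d x) = comp d (coord ξ x) := by
  induction x using TensorProduct.induction_on with
  | zero => simp
  | tmul f v => rw [covComp_tmul, coord_tmul, coord_tmul, map_smul]
  | add x y hx hy => simp only [map_add, hx, hy]

theorem comp_mem_extIdeal {f : SymmetricAlgebra K U} (hf : f ∈ extIdeal rU G (posInv rU G))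
    (d : ℕ) : comp d f ∈ extIdeal rU G (posInv rU G) := by
  refine extIdeal_induction (p := fun f => comp d f ∈ extIdeal rU G (posInv rU G)) ?_ ?_ hf
  · intro a ha s
    rw [comp_mul]
    refine Submodule.sum_mem _ fun y _ => Ideal.mul_mem_left _ _ ?_
    refine coe_mem_extIdeal (x := (⟨comp y.2 a, comp_mem_invAlg rU a.2 _⟩ : invAlg rU G)) ?_
    rw [mem_posInv, constTerm_comp, (mem_posInv rU G).1 ha, ite_self]
  · intro s t hs ht
    rw [map_add]; exact add_mem hs ht

theorem covComp_mem_extSub {x : SymmetricAlgebra K U ⊗[K] E}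
    (hx : x ∈ extSub E rU G (posInv rU G)) (d : ℕ) :
    covComp d x ∈ extSub E rU G (posInv rU G) := fun ξ => by
  rw [coord_covComp]; exact comp_mem_extIdeal (hx ξ) d

theorem symRep_mem_invAlg {γ : Γ} (hγ : γ ∈ Subgroup.normalizer (G : Set Γ))
    {a : SymmetricAlgebra K U} (ha : a ∈ invAlg rU G) : symRep rU γ a ∈ invAlg rU G :=
  normalizer_apply_mem (r := symRep rU) hγ ha

theorem symRep_mem_extIdeal_posInv {γ : Γ} (hγ : γ ∈ Subgroup.normalizer (G : Set Γ))
    {f : SymmetricAlgebra K U} (hf : f ∈ extIdeal rU G (posInv rU G)) :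
    symRep rU γ f ∈ extIdeal rU G (posInv rU G) := by
  refine extIdeal_induction (p := fun f => symRep rU γ f ∈ extIdeal rU G (posInv rU G)) ?_ ?_ hf
  · intro a ha s
    rw [symRep_mul]
    refine Ideal.mul_mem_left _ _ ?_
    refine coe_mem_extIdeal (x := (⟨symRep rU γ a, symRep_mem_invAlg hγ a.2⟩ : invAlg rU G)) ?_
    rw [mem_posInv, constTerm_symRep, (mem_posInv rU G).1 ha]
  · intro s t hs ht
    rw [map_add]; exact add_mem hs ht

theorem covRep_mem_extSub [FiniteDimensional K E] {γ : Γ}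
    (hγ : γ ∈ Subgroup.normalizer (G : Set Γ))
    {x : SymmetricAlgebra K U ⊗[K] E} (hx : x ∈ extSub E rU G (posInv rU G)) :
    covRep rU rE γ x ∈ extSub E rU G (posInv rU G) := by
  rw [eq_sum_coord (Module.finBasis K E) x, map_sum]
  refine Submodule.sum_mem _ fun i _ => ?_
  rw [covRep_smul]
  exact smul_mem_extSub (symRep_mem_extIdeal_posInv hγ (hx _)) _

end Ideals

/-! ### Covariants form a free module over the invariants -/

section Bases

variable {K U E Γ : Type*} [Field K] [AddCommGroup U] [Module K U] [AddCommGroup E] [Module K E]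
  [Group Γ] (rU : Representation K Γ U) (rE : Representation K Γ E) (G : Subgroup Γ)

variable {rU G} in
/-- The linear combination of a family with coefficients in the algebra of invariants. -/
def invComb {ι : Type*} [Fintype ι] (b : ι → SymmetricAlgebra K U ⊗[K] E) :
    (ι → invAlg rU G) →ₗ[K] SymmetricAlgebra K U ⊗[K] E where
  toFun u := ∑ i, (u i : SymmetricAlgebra K U) • b i
  map_add' u w := by
    rw [← Finset.sum_add_distrib]
    exact Finset.sum_congr rfl fun i _ => add_smul _ _ _
  map_smul' c u := by
    rw [Finset.smul_sum]
    exact Finset.sum_congr rfl fun i _ => smul_assoc _ _ _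

variable {rU G} in
theorem invComb_apply {ι : Type*} [Fintype ι] (b : ι → SymmetricAlgebra K U ⊗[K] E)
    (u : ι → invAlg rU G) : invComb b u = ∑ i, (u i : SymmetricAlgebra K U) • b i := rfl

variable {rU G} in
theorem invComb_mul {ι : Type*} [Fintype ι] (b : ι → SymmetricAlgebra K U ⊗[K] E)
    (a : invAlg rU G) (u : ι → invAlg rU G) :
    invComb b (fun i => a * u i) = (a : SymmetricAlgebra K U) • invComb b u := by
  rw [invComb_apply, invComb_apply, Finset.smul_sum]
  exact Finset.sum_congr rfl fun i _ =>
    mul_smul (a : SymmetricAlgebra K U) (u i : SymmetricAlgebra K U) (b i)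

variable {rU G} in
theorem invComb_single {ι : Type*} [Fintype ι] [DecidableEq ι]
    (b : ι → SymmetricAlgebra K U ⊗[K] E) (j : ι) :
    invComb b (Pi.single j (1 : invAlg rU G)) = b j := by
  rw [invComb_apply, Finset.sum_eq_single j]
  · rw [Pi.single_eq_same]
    exact one_smul (SymmetricAlgebra K U) _
  · intro k _ hk
    rw [Pi.single_eq_of_ne hk]
    exact zero_smul (SymmetricAlgebra K U) _
  · intro h; exact absurd (Finset.mem_univ _) h

/-- A basis of the module `(S ⊗ E) ^ G` over the algebra of invariants `S ^ G` that consists of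
homogeneous eigenvectors of `γ`. -/
structure CovBasis (γ : Γ) where
  /-- the index set -/
  Idx : Type
  /-- the index set is finite -/
  fintype : Fintype Idx
  /-- the basis vectors -/
  vec : Idx → SymmetricAlgebra K U ⊗[K] E
  /-- the degrees -/
  deg : Idx → ℕ
  /-- the eigenvalues -/
  eig : Idx → K
  mem : ∀ i, vec i ∈ fixedBy (covRep rU rE) G
  homogeneous : ∀ i, vec i ∈ covPower K U E (deg i)
  eigen : ∀ i, covRep rU rE γ (vec i) = eig i • vec i
  indep : ∀ u : Idx → invAlg rU G, invComb vec u = 0 → u = 0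
  span : ∀ n ∈ fixedBy (covRep rU rE) G, ∃ u : Idx → invAlg rU G, invComb vec u = n

attribute [instance] CovBasis.fintype

variable {rU rE G}

/-- The graded form of Nakayama's lemma. -/
theorem mem_range_invComb [CharZero K] [Finite G] [FiniteDimensional K E] {ι : Type*} [Fintype ι]
    {b : ι → SymmetricAlgebra K U ⊗[K] E}
    (h : ∀ d, ∀ n ∈ covPower K U E d ⊓ fixedBy (covRep rU rE) G,
      ∃ c : ι → K, n - ∑ i, c i • b i ∈
        (covPower K U E d ⊓ fixedBy (covRep rU rE) G) ⊓
          (extSub E rU G (posInv rU G)).restrictScalars K)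
    {n : SymmetricAlgebra K U ⊗[K] E} (hn : n ∈ fixedBy (covRep rU rE) G) :
    n ∈ LinearMap.range (invComb (rU := rU) (G := G) b) := by
  have hmul : ∀ a ∈ invAlg rU G, ∀ x ∈ LinearMap.range (invComb (rU := rU) (G := G) b),
      a • x ∈ LinearMap.range (invComb (rU := rU) (G := G) b) := by
    rintro a ha _ ⟨u, rfl⟩
    refine ⟨fun i => (⟨a, ha⟩ : invAlg rU G) * u i, ?_⟩
    exact invComb_mul b (⟨a, ha⟩ : invAlg rU G) u
  have key : ∀ d, ∀ n ∈ covPower K U E d ⊓ fixedBy (covRep rU rE) G,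
      n ∈ LinearMap.range (invComb (rU := rU) (G := G) b) := by
    intro d
    induction d using Nat.strong_induction_on with
    | _ d ih =>
      intro n hn
      obtain ⟨c, hc⟩ := h d n hn
      have h1 : ∑ i, c i • b i ∈ LinearMap.range (invComb (rU := rU) (G := G) b) := by
        refine ⟨fun i => algebraMap K _ (c i), ?_⟩
        rw [invComb_apply]
        exact Finset.sum_congr rfl fun i _ => algebraMap_smul _ _ _
      rw [← sub_add_cancel n (∑ i, c i • b i)]
      refine add_mem ?_ h1
      generalize n - ∑ i, c i • b i = m at hc
      rw [← mem_covPower_iff.1 hc.1.1]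
      have h2 := mem_invMul_of_mem hc.2 hc.1.2
      clear hc
      induction h2 using Submodule.span_induction with
      | mem x hx =>
        obtain ⟨a, ha, n, hn, rfl⟩ := hx
        rw [covComp_smul]
        refine Submodule.sum_mem _ fun y hy => ?_
        have := Finset.HasAntidiagonal.mem_antidiagonal.1 hy
        by_cases hy1 : y.1 = 0
        · rw [hy1, comp_zero_eq, (mem_posInv rU G).1 ha, map_zero, zero_smul]
          exact zero_mem _
        · exact hmul _ (comp_mem_invAlg rU a.2 _) _ (ih y.2 (by omega) _
            ⟨covComp_mem _ _, covComp_mem_fixedBy rU rE hn _⟩)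
      | zero => rw [map_zero]; exact zero_mem _
      | add x y _ _ hx hy => rw [map_add]; exact add_mem hx hy
      | smul a x _ hx => rw [map_smul]; exact Submodule.smul_mem _ _ hx
  exact mem_of_covComp_mem fun d => key d _ ⟨covComp_mem _ _, covComp_mem_fixedBy rU rE hn _⟩

theorem mem_extSub_of_covPower {D : ℕ}
    (hD : ∀ d, D ≤ d → ∀ f ∈ symPower K U d, f ∈ extIdeal rU G (posInv rU G)) {d : ℕ}
    (hd : D ≤ d) {x : SymmetricAlgebra K U ⊗[K] E} (hx : x ∈ covPower K U E d) :
    x ∈ extSub E rU G (posInv rU G) := by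
  intro ξ
  rw [← mem_covPower_iff.1 hx, coord_covComp]
  exact hD d hd _ (comp_mem _ _)

variable (rU rE G) in
/-- The covariants of a group generated by reflections form a free module over the invariants. -/
theorem nonempty_covBasis [IsAlgClosed K] [CharZero K] [Finite G] [FiniteDimensional K U]
    [FiniteDimensional K E] (hG : GeneratedByActing rU G) {γ : Γ}
    (hγ : γ ∈ Subgroup.normalizer (G : Set Γ)) (hU : EigenSpanned (rU γ))
    (hE : EigenSpanned (rE γ)) : Nonempty (CovBasis rU rE G γ) := by
  classical
  obtain ⟨D, hD⟩ := exists_symPower_le (rU := rU) (G := G)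
  have hX := EigenSpanned.covRep rU rE hU hE
  have hZ : ∀ d, ∀ z ∈ covPower K U E d ⊓ fixedBy (covRep rU rE) G,
      covRep rU rE γ z ∈ covPower K U E d ⊓ fixedBy (covRep rU rE) G := fun d z hz =>
    ⟨covRep_mem_covPower rU rE γ hz.1, normalizer_apply_mem hγ hz.2⟩
  -- In each degree, choose eigenvectors that span the covariants modulo `𝔪 (S ⊗ E)`. Only the
  -- degrees below `D` contribute.
  choose ι hι b μ hbZ hbe hbi hbs using fun d => hX.exists_complement
    (Y := (covPower K U E d ⊓ fixedBy (covRep rU rE) G) ⊓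
      (extSub E rU G (posInv rU G)).restrictScalars K) (hZ d)
    (fun y hy => ⟨hZ d y hy.1, covRep_mem_extSub hγ hy.2⟩)
  -- The chosen vectors are independent modulo `𝔪 (S ⊗ E)`, as one sees degree by degree. This is
  -- what Chevalley's argument needs; generation follows from Nakayama's lemma.
  have hmod : ∀ c : (Σ d : Fin D, ι d) → K,
      ∑ i, c i • b i.1 i.2 ∈ extSub E rU G (posInv rU G) → c = 0 := by
    intro c hc
    funext ⟨d, i⟩
    have h1 := covComp_mem_extSub hc d
    have h2 : covComp (d : ℕ) (∑ i : (Σ d : Fin D, ι d), c i • b i.1 i.2) =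
        ∑ i, c ⟨d, i⟩ • b d i := by
      rw [map_sum, Fintype.sum_sigma, Finset.sum_eq_single d]
      · refine Finset.sum_congr rfl fun i _ => ?_
        rw [map_smul, mem_covPower_iff.1 (hbZ d i).1]
      · intro e _ hed
        refine Finset.sum_eq_zero fun i _ => ?_
        rw [map_smul, covComp_of_mem (hbZ e i).1, if_neg fun h => hed (Fin.ext h), smul_zero]
      · intro h; exact absurd (Finset.mem_univ _) h
    rw [h2] at h1
    exact congrFun (hbi d (fun i => c ⟨d, i⟩)
      ⟨Submodule.sum_mem _ fun i _ => Submodule.smul_mem _ _ (hbZ d i), h1⟩) i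
  refine ⟨⟨Σ d : Fin D, ι d, inferInstance, fun i => b i.1 i.2, fun i => i.1, fun i => μ i.1 i.2,
    fun i => (hbZ _ _).2, fun i => (hbZ _ _).1, fun i => hbe _ _, fun u hu => ?_,
    fun n hn => mem_range_invComb (fun d n hn => ?_) hn⟩⟩
  · let e := Module.finBasis K E
    have := eq_zero_of_sum_mul_eq_zero hG Finset.univ
      (fun (i : Σ d : Fin D, ι d) l => coord (e.coord l) (b i.1 i.2)) (fun c hc => by
        have := hmod c (mem_extSub_of_basis e fun l => by
          rw [map_sum]
          convert hc l using 1
          exact Finset.sum_congr rfl fun i _ => LinearMap.map_smul_of_tower _ _ _)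
        intro i _
        rw [this]; rfl) u (fun l => by
        rw [invComb_apply] at hu
        have := congrArg (coord (e.coord l)) hu
        rw [map_sum, map_zero] at this
        rw [← this]
        exact Finset.sum_congr rfl fun i _ => ((coord (e.coord l)).map_smul _ _).symm)
    funext i
    exact this i (Finset.mem_univ i)
  · by_cases hd : d < D
    · obtain ⟨c, hc⟩ := hbs d n hn
      refine ⟨fun i => if h : (i.1 : ℕ) = d then c (h ▸ i.2) else 0, ?_⟩
      convert hc using 2
      rw [Fintype.sum_sigma, Finset.sum_eq_single ⟨d, hd⟩]
      · simp
      · intro e _ hed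
        refine Finset.sum_eq_zero fun i _ => ?_
        have hne : ¬ (e : ℕ) = d := fun h => hed (Fin.ext h)
        simp only [dif_neg hne, zero_smul]
      · intro h; exact absurd (Finset.mem_univ _) h
    · refine ⟨0, ?_⟩
      simp only [Pi.zero_apply, zero_smul, Finset.sum_const_zero, sub_zero]
      exact ⟨hn, mem_extSub_of_covPower hD (not_lt.1 hd) hn.1⟩

end Bases

/-! ### Evaluation at points and local extension of covariants -/

section Points

variable {K U E Γ : Type*} [Field K] [AddCommGroup U] [Module K U] [AddCommGroup E] [Module K E]
  [Group Γ]

/-- The evaluation at a point, given by a linear form on `U`. -/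
def evalAt (y : Module.Dual K U) : SymmetricAlgebra K U →ₐ[K] K := SymmetricAlgebra.lift y

theorem evalAt_ι (y : Module.Dual K U) (u : U) : evalAt y (SymmetricAlgebra.ι K U u) = y u :=
  SymmetricAlgebra.lift_ι_apply _ _

theorem evalAt_symRep (rU : Representation K Γ U) (y : Module.Dual K U) (g : Γ)
    (f : SymmetricAlgebra K U) : evalAt y (symRep rU g f) = evalAt (y ∘ₗ rU g) f := by
  have h : (evalAt y).comp (symAct rU g) = evalAt (y ∘ₗ rU g) := by
    apply SymmetricAlgebra.algHom_ext
    ext u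
    change evalAt y (symRep rU g (SymmetricAlgebra.ι K U u)) =
      evalAt (y ∘ₗ rU g) (SymmetricAlgebra.ι K U u)
    rw [symRep_ι, evalAt_ι, evalAt_ι, LinearMap.comp_apply]
  exact congrArg (fun F : SymmetricAlgebra K U →ₐ[K] K => F f) h

theorem evalAt_eq_aeval {ι : Type*} (b : Module.Basis ι K U) (y : Module.Dual K U)
    (f : SymmetricAlgebra K U) :
    evalAt y f =
      MvPolynomial.aeval (fun i => y (b i)) (SymmetricAlgebra.equivMvPolynomial b f) := by
  have h : evalAt y = (MvPolynomial.aeval (R := K) (fun i => y (b i))).comp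
      (SymmetricAlgebra.equivMvPolynomial b).toAlgHom := by
    apply SymmetricAlgebra.algHom_ext
    refine b.ext fun i => ?_
    change evalAt y (SymmetricAlgebra.ι K U (b i)) =
      MvPolynomial.aeval _ (SymmetricAlgebra.equivMvPolynomial b (SymmetricAlgebra.ι K U (b i)))
    rw [evalAt_ι, SymmetricAlgebra.equivMvPolynomial_ι_apply, MvPolynomial.aeval_X]
  exact congrArg (fun F : SymmetricAlgebra K U →ₐ[K] K => F f) h

theorem evalAt_constr {ι : Type*} (b : Module.Basis ι K U) (x : ι → K)
    (f : SymmetricAlgebra K U) :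
    evalAt (b.constr K x) f = MvPolynomial.aeval x (SymmetricAlgebra.equivMvPolynomial b f) := by
  rw [evalAt_eq_aeval b]
  simp

theorem exists_evalAt_ne_zero [CharZero K] [FiniteDimensional K U] {f : SymmetricAlgebra K U}
    (hf : f ≠ 0) : ∃ y, evalAt y f ≠ 0 := by
  by_contra! h
  apply hf
  let b := Module.finBasis K U
  apply (SymmetricAlgebra.equivMvPolynomial b).injective
  rw [map_zero]
  refine MvPolynomial.funext fun x => ?_
  have := h (b.constr K x)
  rw [evalAt_constr] at this
  simpa [MvPolynomial.aeval_eq_eval] using this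

/-- Points are separated from finite sets by polynomials. -/
theorem exists_eval_eq_one (y : Module.Dual K U) (T : Set (Module.Dual K U)) (hT : T.Finite)
    (hy : y ∉ T) : ∃ f : SymmetricAlgebra K U, evalAt y f = 1 ∧ ∀ z ∈ T, evalAt z f = 0 := by
  classical
  have h : ∀ z : Module.Dual K U, z ≠ y → ∃ f : SymmetricAlgebra K U,
      evalAt y f = 1 ∧ evalAt z f = 0 := by
    intro z hz
    obtain ⟨u, hu⟩ : ∃ u, y u - z u ≠ 0 := by
      by_contra! h
      exact hz (LinearMap.ext fun u => (sub_eq_zero.1 (h u)).symm)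
    refine ⟨(y u - z u)⁻¹ • (SymmetricAlgebra.ι K U u - algebraMap K _ (z u)), ?_, ?_⟩
    · rw [map_smul, map_sub, evalAt_ι, AlgHom.commutes, smul_eq_mul]
      exact inv_mul_cancel₀ hu
    · rw [map_smul, map_sub, evalAt_ι, AlgHom.commutes]; simp
  choose! F hF1 hF2 using h
  refine ⟨∏ z ∈ hT.toFinset, F z, ?_, fun z hz => ?_⟩
  · rw [map_prod]
    refine Finset.prod_eq_one fun z hz => hF1 z ?_
    rintro rfl
    exact hy (hT.mem_toFinset.1 hz)
  · rw [map_prod]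
    refine Finset.prod_eq_zero (hT.mem_toFinset.2 hz) (hF2 z ?_)
    rintro rfl
    exact hy hz

/-- The evaluation of an element of `S ⊗ E` at a point. -/
def evalCov (φ : SymmetricAlgebra K U →ₐ[K] K) : SymmetricAlgebra K U ⊗[K] E →ₗ[K] E :=
  (TensorProduct.lid K E).toLinearMap ∘ₗ LinearMap.rTensor E φ.toLinearMap

theorem evalCov_tmul (φ : SymmetricAlgebra K U →ₐ[K] K) (f : SymmetricAlgebra K U) (e : E) :
    evalCov φ (f ⊗ₜ[K] e) = φ f • e := by
  simp [evalCov]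

theorem evalCov_smul (φ : SymmetricAlgebra K U →ₐ[K] K) (f : SymmetricAlgebra K U)
    (x : SymmetricAlgebra K U ⊗[K] E) : evalCov φ (f • x) = φ f • evalCov φ x := by
  induction x using TensorProduct.induction_on with
  | zero => simp
  | tmul f' e =>
    rw [TensorProduct.smul_tmul', evalCov_tmul, evalCov_tmul, smul_eq_mul, map_mul, mul_smul]
  | add x y hx hy => simp only [smul_add, map_add, hx, hy]

variable {rU : Representation K Γ U} {rE : Representation K Γ E} {G P : Subgroup Γ}

theorem evalCov_covRep {φ : SymmetricAlgebra K U →ₐ[K] K} {g : Γ}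
    (hg : ∀ f, φ (symRep rU g f) = φ f) (x : SymmetricAlgebra K U ⊗[K] E) :
    evalCov φ (covRep rU rE g x) = rE g (evalCov φ x) := by
  induction x using TensorProduct.induction_on with
  | zero => simp
  | tmul f e => rw [covRep_tmul, evalCov_tmul, evalCov_tmul, hg, map_smul]
  | add x y hx hy => simp only [map_add, hx, hy]

/-- A polynomial that is invariant under a subgroup `P` which contains the stabilizer of the point
`y` in `G`, has the value `1` at `y`, and vanishes at the points of `G y` outside `P y`. -/
theorem exists_invariant_separating [CharZero K] [Finite G] (hPG : P ≤ G) {y : Module.Dual K U}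
    (hy : ∀ g ∈ G, y ∘ₗ rU g = y → g ∈ P) :
    ∃ a ∈ invAlg rU P, evalAt y a = 1 ∧ ∀ g ∈ G, g ∉ P → evalAt y (symRep rU g a) = 0 := by
  classical
  have hfinP : Finite P := Finite.of_injective _ (Subgroup.inclusion_injective hPG)
  have := Fintype.ofFinite P
  obtain ⟨f, hf1, hf0⟩ := exists_eval_eq_one y {z | z ≠ y ∧ ∃ g : G, y ∘ₗ rU (g : Γ) = z}
    ((Set.finite_range fun g : G => y ∘ₗ rU (g : Γ)).subset fun z hz => hz.2) (fun h => h.1 rfl)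
  have hval : ∀ g ∈ G, evalAt y (symRep rU g f) = if y ∘ₗ rU g = y then 1 else 0 := by
    intro g hg
    rw [evalAt_symRep]
    split_ifs with h
    · rw [h, hf1]
    · exact hf0 _ ⟨h, ⟨g, hg⟩, rfl⟩
  set c : K := ((Finset.univ.filter fun p : P => y ∘ₗ rU (p : Γ) = y).card : K) with hc
  have hc0 : c ≠ 0 := by
    rw [hc, Nat.cast_ne_zero, Finset.card_ne_zero]
    exact ⟨1, by simp [Module.End.one_eq_id]⟩
  refine ⟨c⁻¹ • ∑ p : P, symRep rU p f, ?_, ?_, ?_⟩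
  · refine Subalgebra.smul_mem _ ?_ _
    intro g hg
    rw [map_sum]
    refine Fintype.sum_equiv (Equiv.mulLeft ⟨g, hg⟩) _ _ fun x => ?_
    rw [← Module.End.mul_apply, ← map_mul]; rfl
  · rw [map_smul, map_sum, smul_eq_mul]
    rw [Finset.sum_congr rfl fun (p : P) _ => hval p (hPG p.2)]
    rw [Finset.sum_ite, Finset.sum_const, Finset.sum_const_zero, add_zero, nsmul_one, ← hc,
      inv_mul_cancel₀ hc0]
  · intro g hg hgP
    rw [map_smul, map_smul, map_sum, map_sum]
    rw [Finset.sum_eq_zero, smul_zero]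
    intro p _
    rw [← Module.End.mul_apply, ← map_mul, hval _ (mul_mem hg (hPG p.2)), if_neg]
    intro h
    exact hgP ((Subgroup.mul_mem_cancel_right P p.2).1 (hy _ (mul_mem hg (hPG p.2)) h))

/-- Covariants of `P` extend to covariants of `G` near a point `y` whose stabilizer in `G` lies in
`P`: modulo the invariants of `P` that vanish at `y`, every covariant of `P` agrees with a
covariant of `G`. It is the sum of the `G`-translates of its product with a power of a
separating polynomial. -/
theorem exists_covariant_congr [CharZero K] [Finite G] [FiniteDimensional K E] (hPG : P ≤ G)
    {y : Module.Dual K U} (hy : ∀ g ∈ G, y ∘ₗ rU g = y → g ∈ P)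
    {f : SymmetricAlgebra K U ⊗[K] E} (hf : f ∈ fixedBy (covRep rU rE) P) :
    ∃ F ∈ fixedBy (covRep rU rE) G, F - f ∈ invMul rU rE P (maxInv rU P (evalAt y)) := by
  classical
  have hfinP : Finite P := Finite.of_injective _ (Subgroup.inclusion_injective hPG)
  have := Fintype.ofFinite G
  have := Fintype.ofFinite P
  obtain ⟨a, haP, ha1, ha0⟩ := exists_invariant_separating hPG hy
  -- The power is chosen so that the translates of `e` by elements outside `P`, which vanish on the
  -- `P`-orbit of `y`, lie in the ideal generated by the invariants of `P` that vanish at `y`.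
  set e := a ^ Nat.card P with he
  have heP : e ∈ invAlg rU P := pow_mem haP _
  have he1 : e - 1 ∈ extIdeal rU P (maxInv rU P (evalAt y)) := by
    refine coe_mem_extIdeal (x := (⟨e - 1, sub_mem heP (one_mem _)⟩ : invAlg rU P)) ?_
    rw [mem_maxInv]
    simp [he, ha1]
  have he0 : ∀ g ∈ G, g ∉ P → symRep rU g e ∈ extIdeal rU P (maxInv rU P (evalAt y)) := by
    intro g hg hgP
    have : symRep rU g e = (symRep rU g a) ^ Nat.card P := map_pow (symAct rU g) a _
    rw [this]
    refine pow_card_mem fun p hp => ?_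
    rw [← Module.End.mul_apply, ← map_mul]
    exact ha0 _ (mul_mem (hPG hp) hg) fun h => hgP ((Subgroup.mul_mem_cancel_left P hp).1 h)
  have hcG : (Nat.card G : K) ≠ 0 := Nat.cast_ne_zero.2 Nat.card_pos.ne'
  have hcP : (Nat.card P : K) ≠ 0 := Nat.cast_ne_zero.2 Nat.card_pos.ne'
  set F := ((Nat.card P : K)⁻¹ * Nat.card G) • average (covRep rU rE) G (e • f) with hF
  have hFG : F ∈ fixedBy (covRep rU rE) G := Submodule.smul_mem _ _ (average_mem _ _ _)
  refine ⟨F, hFG, mem_invMul_of_mem ?_ (sub_mem (fun g hg => hFG g (hPG hg)) hf)⟩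
  have hsum : F = (Nat.card P : K)⁻¹ • ∑ g : G, covRep rU rE g (e • f) := by
    rw [hF, average_apply, smul_smul, mul_assoc, mul_inv_cancel₀ hcG, mul_one]
  -- The summands for elements of `P` give back `e f`, the other ones are negligible.
  have hsplit : ∑ g : G, covRep rU rE g (e • f) = (Nat.card P : K) • (e • f) +
      ∑ g : G, if (g : Γ) ∈ P then 0 else covRep rU rE g (e • f) := by
    have h1 : ∀ g : G, covRep rU rE g (e • f) = (if (g : Γ) ∈ P then e • f else 0) +
        if (g : Γ) ∈ P then 0 else covRep rU rE g (e • f) := by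
      intro g
      split_ifs with h
      · rw [covRep_smul, heP _ h, hf _ h, add_zero]
      · rw [zero_add]
    rw [Finset.sum_congr rfl fun g _ => h1 g, Finset.sum_add_distrib]
    congr 1
    rw [← Finset.sum_filter, Finset.sum_const, Nat.cast_smul_eq_nsmul]
    congr 1
    rw [Nat.card_eq_fintype_card, ← Finset.card_univ]
    refine (Finset.card_nbij' (fun p : P => (⟨p, hPG p.2⟩ : G)) (fun g => if h : (g : Γ) ∈ P then
      (⟨g, h⟩ : P) else 1) ?_ ?_ ?_ ?_).symm
    · intro p _; simp
    · intro g _; simp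
    · intro p _; simp
    · intro g hg
      have : (g : Γ) ∈ P := by simpa using hg
      simp [this]
  have hfin : F - f = (e - 1) • f + (Nat.card P : K)⁻¹ •
      ∑ g : G, if (g : Γ) ∈ P then 0 else covRep rU rE g (e • f) := by
    rw [hsum, hsplit, smul_add, smul_smul, inv_mul_cancel₀ hcP, one_smul,
      show (e - 1) • f = e • f - f by rw [sub_smul e 1 f, one_smul (SymmetricAlgebra K U) f]]
    abel
  rw [hfin]
  refine add_mem (smul_mem_extSub he1 _) (Submodule.smul_of_tower_mem _ _
    (Submodule.sum_mem _ fun g _ => ?_))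
  split_ifs with h
  · exact zero_mem _
  · rw [covRep_smul]
    exact smul_mem_extSub (he0 g g.2 h) _

/-- A finite group that acts faithfully has a point with trivial stabilizer, because the product of
the linear forms `g u - u`, one for each `g ≠ 1`, is not the zero polynomial. -/
theorem exists_generic_point [CharZero K] [Finite G] [FiniteDimensional K U]
    (hfaith : ∀ g ∈ G, (∀ u, rU g u = u) → g = 1) :
    ∃ y : Module.Dual K U, ∀ g ∈ G, y ∘ₗ rU g = y → g = 1 := by
  classical
  have := Fintype.ofFinite G
  have h : ∀ g : G, (g : Γ) ≠ 1 → ∃ u, rU g u - u ≠ 0 := by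
    intro g hg
    by_contra! h
    exact hg (hfaith g g.2 fun u => sub_eq_zero.1 (h u))
  choose! w hw using h
  have hne : ∏ g : G, (if (g : Γ) = 1 then (1 : SymmetricAlgebra K U) else
      SymmetricAlgebra.ι K U (rU g (w g) - w g)) ≠ 0 := by
    refine Finset.prod_ne_zero_iff.2 fun g _ => ?_
    split_ifs with h
    · exact one_ne_zero
    · exact ι_ne_zero (hw g h)
  obtain ⟨y, hy⟩ := exists_evalAt_ne_zero hne
  refine ⟨y, fun g hg hgy => ?_⟩
  by_contra h1
  rw [map_prod] at hy
  have := Finset.prod_ne_zero_iff.1 hy ⟨g, hg⟩ (Finset.mem_univ _)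
  rw [if_neg h1, evalAt_ι, map_sub] at this
  exact this (sub_eq_zero.2 (LinearMap.congr_fun hgy _))

end Points

/-! ### The rank of the module of covariants -/

section Rank

variable {K U E Γ : Type*} [Field K] [AddCommGroup U] [Module K U] [AddCommGroup E] [Module K E]
  [Group Γ] {rU : Representation K Γ U} {rE : Representation K Γ E} {G P : Subgroup Γ}

/-- The trace form of the invariants is nondegenerate, by the linear independence of characters. -/
theorem eq_zero_of_average_mul [CharZero K] [Finite G]
    (hfaith : ∀ g ∈ G, (∀ u, rU g u = u) → g = 1) {f : SymmetricAlgebra K U}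
    (h : ∀ s, average (symRep rU) G (s * f) = 0) : f = 0 := by
  have := Fintype.ofFinite G
  let χ : G → (SymmetricAlgebra K U →* SymmetricAlgebra K U) := fun g =>
    (symAct rU g : SymmetricAlgebra K U →* SymmetricAlgebra K U)
  have hχ : Function.Injective χ := by
    intro g g' hgg'
    have h1 : ∀ u, rU g u = rU g' u := by
      intro u
      have : symRep rU g (SymmetricAlgebra.ι K U u) = symRep rU g' (SymmetricAlgebra.ι K U u) :=
        congrArg (fun F : SymmetricAlgebra K U →* SymmetricAlgebra K U => F _) hgg'
      rw [symRep_ι, symRep_ι] at this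
      by_contra hne
      exact ι_ne_zero (sub_ne_zero.2 hne) (by rw [map_sub, this, sub_self])
    have h2 : (g' : Γ)⁻¹ * g = 1 := by
      refine hfaith _ (mul_mem (inv_mem g'.2) g.2) fun u => ?_
      rw [map_mul, Module.End.mul_apply, h1, ← Module.End.mul_apply, ← map_mul, inv_mul_cancel,
        map_one, Module.End.one_apply]
    exact Subtype.ext (inv_mul_eq_one.1 h2).symm
  have hli := (linearIndependent_monoidHom (SymmetricAlgebra K U) (SymmetricAlgebra K U)).comp χ hχ
  have h3 : ∑ g : G, symRep rU g f • (χ g : SymmetricAlgebra K U → SymmetricAlgebra K U) = 0 := by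
    funext s
    have hs := h s
    rw [average_apply, smul_eq_zero] at hs
    have hs2 := hs.resolve_left (inv_ne_zero (Nat.cast_ne_zero.2 Nat.card_pos.ne'))
    rw [Finset.sum_apply, Pi.zero_apply, ← hs2]
    refine Finset.sum_congr rfl fun g _ => ?_
    rw [symRep_mul, mul_comm]; rfl
  have h4 := Fintype.linearIndependent_iff.1 hli (fun g => symRep rU g f) h3 1
  simpa using h4

variable {γ : Γ}

/-- A basis of the covariants over the invariants stays linearly independent over `S`: multiply a
relation by an arbitrary polynomial and average. -/
theorem CovBasis.linearIndependent [CharZero K] [Finite G] (B : CovBasis rU rE G γ)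
    (hfaith : ∀ g ∈ G, (∀ u, rU g u = u) → g = 1) :
    LinearIndependent (SymmetricAlgebra K U) B.vec := by
  rw [Fintype.linearIndependent_iff]
  intro f hf i
  refine eq_zero_of_average_mul hfaith fun s => ?_
  have h1 : invComb B.vec (fun i => (reynolds (s * f i) : invAlg rU G)) = 0 := by
    have h2 : average (covRep rU rE) G (s • ∑ i, f i • B.vec i) = 0 := by
      rw [hf, smul_zero, map_zero]
    rw [← h2, Finset.smul_sum, map_sum, invComb_apply]
    refine Finset.sum_congr rfl fun i _ => ?_
    have := Fintype.ofFinite G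
    rw [coe_reynolds, average_apply, average_apply, smul_assoc, Finset.sum_smul, smul_smul]
    congr 1
    refine Finset.sum_congr rfl fun g _ => ?_
    rw [covRep_smul, B.mem i g g.2]
  exact congrArg Subtype.val (congrFun (B.indep _ h1) i)

/-- The rank of the module of covariants is the dimension of `E`. -/
theorem CovBasis.card_eq [CharZero K] [Finite G] [FiniteDimensional K U] [FiniteDimensional K E]
    (B : CovBasis rU rE G γ) (hfaith : ∀ g ∈ G, (∀ u, rU g u = u) → g = 1) :
    Fintype.card B.Idx = Module.finrank K E := by
  apply le_antisymm
  · have := (B.linearIndependent hfaith).fintype_card_le_finrank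
    rwa [Module.finrank_baseChange] at this
  -- At a point with trivial stabilizer the covariants take all values in `E`.
  · obtain ⟨y, hy⟩ := exists_generic_point hfaith
    have hspan : ⊤ ≤ Submodule.span K (Set.range fun i => evalCov (evalAt y) (B.vec i)) := by
      intro e _
      obtain ⟨F, hF, hFe⟩ := exists_covariant_congr (rE := rE) (P := ⊥) bot_le
        (fun g hg h => Subgroup.mem_bot.2 (hy g hg h)) (f := (1 : SymmetricAlgebra K U) ⊗ₜ[K] e)
        (fun g hg => by rw [Subgroup.mem_bot.1 hg]; simp)
      have h1 : evalCov (evalAt y) F = e := by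
        have h2 : ∀ x ∈ invMul rU rE ⊥ (maxInv rU ⊥ (evalAt y)), evalCov (evalAt y) x = 0 := by
          intro x hx
          induction hx using Submodule.span_induction with
          | mem x hx =>
            obtain ⟨a, ha, n, _, rfl⟩ := hx
            rw [evalCov_smul, mem_maxInv.1 ha, zero_smul]
          | zero => exact map_zero _
          | add x y _ _ hx hy => rw [map_add, hx, hy, add_zero]
          | smul c x _ hx => rw [map_smul, hx, smul_zero]
        have := h2 _ hFe
        rwa [map_sub, evalCov_tmul, map_one, one_smul, sub_eq_zero] at this
      obtain ⟨u, hu⟩ := B.span F hF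
      rw [← h1, ← hu, invComb_apply, map_sum]
      refine Submodule.sum_mem _ fun i _ => ?_
      rw [evalCov_smul]
      exact Submodule.smul_mem _ _ (Submodule.subset_span ⟨i, rfl⟩)
    have := finrank_le_of_span_eq_top (top_le_iff.1 hspan)
    exact this

end Rank

/-! ### The transition matrix to a subgroup -/

section Transition

variable {K U E Γ : Type*} [Field K] [AddCommGroup U] [Module K U] [AddCommGroup E] [Module K E]
  [Group Γ] {rU : Representation K Γ U} {rE : Representation K Γ E} {G P : Subgroup Γ} {γ γ' : Γ}

/-- The coefficients of a covariant in a basis. -/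
def CovBasis.coeff (B : CovBasis rU rE G γ) {n : SymmetricAlgebra K U ⊗[K] E}
    (hn : n ∈ fixedBy (covRep rU rE) G) : B.Idx → invAlg rU G :=
  (B.span n hn).choose

theorem CovBasis.invComb_coeff (B : CovBasis rU rE G γ) {n : SymmetricAlgebra K U ⊗[K] E}
    (hn : n ∈ fixedBy (covRep rU rE) G) : invComb B.vec (B.coeff hn) = n :=
  (B.span n hn).choose_spec

theorem CovBasis.invComb_injective (B : CovBasis rU rE G γ) :
    Function.Injective (invComb (rU := rU) (G := G) B.vec) :=
  (injective_iff_map_eq_zero _).2 B.indep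

/-- The coefficients of an element of `𝔫 (S ⊗ E) ^ G`, where `𝔫` consists of the invariants that
vanish at a point, vanish at that point. -/
theorem CovBasis.eval_eq_zero (B : CovBasis rU rE G γ) {φ : SymmetricAlgebra K U →ₐ[K] K}
    {u : B.Idx → invAlg rU G} (h : invComb B.vec u ∈ invMul rU rE G (maxInv rU G φ)) (i : B.Idx) :
    φ (u i : SymmetricAlgebra K U) = 0 := by
  have key : ∀ x ∈ invMul rU rE G (maxInv rU G φ),
      ∃ w : B.Idx → invAlg rU G, invComb B.vec w = x ∧ ∀ i, φ (w i : SymmetricAlgebra K U) = 0 := by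
    intro x hx
    induction hx using Submodule.span_induction with
    | mem x hx =>
      obtain ⟨a, ha, n, hn, rfl⟩ := hx
      refine ⟨fun i => a * B.coeff hn i, ?_, fun i => ?_⟩
      · conv_rhs => rw [← B.invComb_coeff hn]
        exact invComb_mul _ _ _
      · rw [MulMemClass.coe_mul, map_mul, mem_maxInv.1 ha, zero_mul]
    | zero => exact ⟨0, map_zero _, fun i => map_zero φ⟩
    | add x y _ _ hx hy =>
      obtain ⟨w, rfl, hw⟩ := hx
      obtain ⟨w', rfl, hw'⟩ := hy
      exact ⟨w + w', map_add _ _ _, fun i => by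
        rw [Pi.add_apply, AddMemClass.coe_add, map_add, hw, hw', add_zero]⟩
    | smul c x _ hx =>
      obtain ⟨w, rfl, hw⟩ := hx
      exact ⟨c • w, map_smul _ _ _, fun i => by
        rw [Pi.smul_apply, Subalgebra.coe_smul, map_smul, hw, smul_zero]⟩
  obtain ⟨w, hw, hw0⟩ := key _ h
  rw [← B.invComb_injective hw]
  exact hw0 i

variable (B : CovBasis rU rE G γ) (B' : CovBasis rU rE P γ') (hPG : P ≤ G)

/-- The matrix that expresses a basis of the covariants of `G` in a basis of the covariants of a
subgroup `P`. -/
def transition (i : B.Idx) : B'.Idx → invAlg rU P :=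
  B'.coeff (n := B.vec i) fun g hg => B.mem i g (hPG hg)

theorem invComb_transition (i : B.Idx) : invComb B'.vec (transition B B' hPG i) = B.vec i :=
  B'.invComb_coeff _

/-- The transition matrix at a point. -/
def transitionAt (φ : SymmetricAlgebra K U →ₐ[K] K) : Matrix B.Idx B'.Idx K :=
  fun i j => φ (transition B B' hPG i j : SymmetricAlgebra K U)

/-- The transition matrix is invertible at the points whose stabilizer in `G` lies in `P`. -/
theorem exists_mul_transitionAt_eq_one [CharZero K] [Finite G] [FiniteDimensional K E]
    [DecidableEq B'.Idx] {y : Module.Dual K U} (hy : ∀ g ∈ G, y ∘ₗ rU g = y → g ∈ P) :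
    ∃ C : Matrix B'.Idx B.Idx K, C * transitionAt B B' hPG (evalAt y) = 1 := by
  have h := fun j => exists_covariant_congr hPG hy (B'.mem j)
  -- The coefficients of lifts to `G` of the basis covariants of `P` give the inverse matrix.
  choose F hFG hF using h
  refine ⟨Matrix.of fun j i => evalAt y (B.coeff (hFG j) i : SymmetricAlgebra K U), ?_⟩
  ext j k
  have hle : ∀ a ∈ invAlg rU G, a ∈ invAlg rU P := fun a ha g hg => ha g (hPG hg)
  have h1 : invComb B'.vec ((∑ i, fun k => (⟨B.coeff (hFG j) i, hle _ (B.coeff (hFG j) i).2⟩ :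
      invAlg rU P) * transition B B' hPG i k) - Pi.single j 1) = F j - B'.vec j := by
    rw [map_sub, invComb_single, map_sum]
    congr 1
    conv_rhs => rw [← B.invComb_coeff (hFG j), invComb_apply]
    refine Finset.sum_congr rfl fun i _ => ?_
    rw [invComb_mul, invComb_transition]
  have h2 := B'.eval_eq_zero (h1 ▸ hF j) k
  rw [Pi.sub_apply, AddSubgroupClass.coe_sub, map_sub, sub_eq_zero] at h2
  simp only [Finset.sum_apply, AddSubmonoidClass.coe_finsetSum, MulMemClass.coe_mul, map_sum,
    map_mul] at h2
  rw [Matrix.mul_apply, Matrix.one_apply]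
  refine h2.trans ?_
  rw [Pi.single_apply]
  by_cases h : j = k
  · rw [if_pos h, if_pos h.symm]; exact map_one _
  · rw [if_neg h, if_neg (Ne.symm h)]; exact map_zero _

/-- If the transition matrix is invertible at a point, then the vectors fixed by `P` are fixed by
the stabilizer of the point in `G`. -/
theorem fixed_of_mul_transitionAt_eq_one [DecidableEq B'.Idx] {φ : SymmetricAlgebra K U →ₐ[K] K}
    {C : Matrix B'.Idx B.Idx K} (hC : C * transitionAt B B' hPG φ = 1) {e : E}
    (he : ∀ p ∈ P, rE p e = e) {c : Γ} (hc : c ∈ G) (hcφ : ∀ f, φ (symRep rU c f) = φ f) :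
    rE c e = e := by
  have h1 : ∀ i, rE c (evalCov φ (B.vec i)) = evalCov φ (B.vec i) := fun i => by
    rw [← evalCov_covRep hcφ, B.mem i c hc]
  have h2 : ∀ i, evalCov φ (B.vec i) =
      ∑ j, transitionAt B B' hPG φ i j • evalCov φ (B'.vec j) := by
    intro i
    conv_lhs => rw [← invComb_transition B B' hPG i]
    rw [invComb_apply, map_sum]
    exact Finset.sum_congr rfl fun j _ => evalCov_smul _ _ _
  have h3 : ∀ j, evalCov φ (B'.vec j) = ∑ i, C j i • evalCov φ (B.vec i) := by
    intro j
    simp only [h2, Finset.smul_sum, smul_smul]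
    rw [Finset.sum_comm]
    simp only [← Finset.sum_smul, ← Matrix.mul_apply, hC, Matrix.one_apply]
    simp
  have h4 : ∀ j, rE c (evalCov φ (B'.vec j)) = evalCov φ (B'.vec j) := by
    intro j
    rw [h3, map_sum]
    exact Finset.sum_congr rfl fun i _ => by rw [map_smul, h1]
  have hmem : (1 : SymmetricAlgebra K U) ⊗ₜ[K] e ∈ fixedBy (covRep rU rE) P := fun p hp => by
    have : symRep rU p 1 = 1 := map_one (symAct rU p)
    rw [covRep_tmul, he p hp, this]
  have h5 : e = ∑ j, φ (B'.coeff hmem j : SymmetricAlgebra K U) • evalCov φ (B'.vec j) := by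
    have h6 := congrArg (evalCov φ) (B'.invComb_coeff hmem)
    rw [evalCov_tmul, map_one, one_smul, invComb_apply, map_sum] at h6
    refine h6.symm.trans ?_
    exact Finset.sum_congr rfl fun j _ => evalCov_smul _ _ _
  rw [h5, map_sum]
  exact Finset.sum_congr rfl fun j _ => by rw [map_smul, h4]

end Transition

/-! ### Prime factors of polynomials and of linear forms -/

section LinearFactors

variable {K U : Type*} [Field K] [AddCommGroup U] [Module K U]

theorem uniqueFactorizationMonoid_symmetricAlgebra :
    UniqueFactorizationMonoid (SymmetricAlgebra K U) := by
  obtain ⟨b⟩ : Nonempty (Module.Basis _ K U) := ⟨Module.Basis.ofVectorSpace K U⟩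
  exact (SymmetricAlgebra.equivMvPolynomial b).symm.toMulEquiv.uniqueFactorizationMonoid
    inferInstance

theorem exists_prime_dvd_eval {f : SymmetricAlgebra K U} (hf : f ≠ 0)
    {φ : SymmetricAlgebra K U →ₐ[K] K} (hφ : φ f = 0) :
    ∃ q, Prime q ∧ q ∣ f ∧ φ q = 0 := by
  have := uniqueFactorizationMonoid_symmetricAlgebra (K := K) (U := U)
  obtain ⟨s, hs, u, hu⟩ := UniqueFactorizationMonoid.exists_prime_factors f hf
  rw [← hu, map_mul, mul_eq_zero] at hφ
  have h0 : φ s.prod = 0 := hφ.resolve_right (u.isUnit.map φ).ne_zero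
  rw [map_multiset_prod, Multiset.prod_eq_zero_iff, Multiset.mem_map] at h0
  obtain ⟨q, hq, hq0⟩ := h0
  exact ⟨q, hs q hq, (Multiset.dvd_prod hq).trans ⟨u, hu.symm⟩, hq0⟩

/-- Hilbert's Nullstellensatz for a principal ideal. -/
theorem exists_dvd_pow [IsAlgClosed K] [FiniteDimensional K U] {q f : SymmetricAlgebra K U}
    (h : ∀ y : Module.Dual K U, evalAt y q = 0 → evalAt y f = 0) : ∃ n, q ∣ f ^ n := by
  let b := Module.finBasis K U
  let e := SymmetricAlgebra.equivMvPolynomial b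
  have h1 : e f ∈ MvPolynomial.vanishingIdeal K
      (MvPolynomial.zeroLocus K (Ideal.span {e q})) := by
    rw [MvPolynomial.mem_vanishingIdeal_iff]
    intro x hx
    rw [MvPolynomial.mem_zeroLocus_iff] at hx
    have := hx (e q) (Ideal.mem_span_singleton_self _)
    rw [← evalAt_constr] at this ⊢
    exact h _ this
  rw [MvPolynomial.vanishingIdeal_zeroLocus_eq_radical] at h1
  obtain ⟨n, hn⟩ := h1
  refine ⟨n, ?_⟩
  rw [Ideal.mem_span_singleton, ← map_pow] at hn
  exact (map_dvd_iff e.toMulEquiv).1 hn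

theorem eq_algebraMap_of_natDegree {r : SymmetricAlgebra K U}
    (hr : (gradeHom K U r).natDegree = 0) : r = algebraMap K _ (constTerm r) := by
  rw [← comp_zero_eq]
  have h : r ∈ degLT 1 := fun d hd => Polynomial.coeff_eq_zero_of_natDegree_lt
    (hr.symm ▸ hd : (gradeHom K U r).natDegree < d)
  have := sum_comp_of_mem_degLT h
  simpa using this.symm

/-- A prime that divides a linear form is proportional to it. -/
theorem exists_ι_eq_smul {q : SymmetricAlgebra K U} (hq : Prime q) {a : U}
    (h : q ∣ SymmetricAlgebra.ι K U a) : ∃ c : K, SymmetricAlgebra.ι K U a = c • q := by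
  by_cases ha : a = 0
  · exact ⟨0, by rw [ha, map_zero, zero_smul]⟩
  obtain ⟨r, hr⟩ := h
  have hne := ι_ne_zero (K := K) ha
  have hr0 : r ≠ 0 := by rintro rfl; exact hne (by rw [hr, mul_zero])
  have hinj : Function.Injective (gradeHom K U) := fun x y hxy => by
    rw [← eval_gradeHom x, hxy, eval_gradeHom]
  have hdeg : (gradeHom K U q).natDegree + (gradeHom K U r).natDegree = 1 := by
    rw [← Polynomial.natDegree_mul ((map_ne_zero_iff _ hinj).2 hq.ne_zero)
      ((map_ne_zero_iff _ hinj).2 hr0), ← map_mul, ← hr, gradeHom_ι,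
      Polynomial.natDegree_monomial_eq _ hne]
  by_cases hqd : (gradeHom K U q).natDegree = 0
  · exfalso
    have h1 := eq_algebraMap_of_natDegree hqd
    have h2 : constTerm q ≠ 0 := fun h0 => hq.ne_zero (by rw [h1, h0, map_zero])
    exact hq.not_isUnit (h1 ▸ (isUnit_iff_ne_zero.2 h2).map (algebraMap K _))
  · have h1 := eq_algebraMap_of_natDegree (r := r) (by omega)
    exact ⟨constTerm r, by rw [hr, Algebra.smul_def, ← h1, mul_comm]⟩

/-- The linear forms divisible by a given prime lie on a line. -/
theorem exists_smul_of_dvd_ι {q : SymmetricAlgebra K U} (hq : Prime q) {W : Set U}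
    (h : ∀ u ∈ W, q ∣ SymmetricAlgebra.ι K U u) : ∃ a : U, ∀ u ∈ W, ∃ c : K, u = c • a := by
  by_cases hW : ∃ a ∈ W, a ≠ 0
  · obtain ⟨a, haW, ha⟩ := hW
    obtain ⟨c, hc⟩ := exists_ι_eq_smul hq (h a haW)
    have hc0 : c ≠ 0 := by rintro rfl; exact ι_ne_zero ha (by rw [hc, zero_smul])
    refine ⟨a, fun u hu => ?_⟩
    obtain ⟨d, hd⟩ := exists_ι_eq_smul hq (h u hu)
    refine ⟨d * c⁻¹, ?_⟩
    by_contra hne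
    refine ι_ne_zero (K := K) (sub_ne_zero.2 hne) ?_
    rw [map_sub, map_smul, hc, hd, smul_smul, mul_assoc, inv_mul_cancel₀ hc0, mul_one, sub_self]
  · push Not at hW
    exact ⟨0, fun u hu => ⟨0, by rw [hW u hu, smul_zero]⟩⟩

end LinearFactors

/-! ### Steinberg's fixed point theorem -/

section Steinberg

variable {K U Γ : Type*} [Field K] [AddCommGroup U] [Module K U] [Group Γ]

/-- The subgroup generated by the elements that act as reflections and fix the point `y`. -/
def pointGroup (rU : Representation K Γ U) (y : Module.Dual K U) : Subgroup Γ :=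
  Subgroup.closure {g | ActsAsReflection rU g ∧ y ∘ₗ rU g = y}

theorem generatedByActing_pointGroup (rU : Representation K Γ U) (y : Module.Dual K U) :
    GeneratedByActing rU (pointGroup rU y) := by
  refine le_antisymm ((Subgroup.closure_le _).2 fun g hg => hg.1) ?_
  exact Subgroup.closure_mono fun g hg => ⟨Subgroup.subset_closure hg, hg.1⟩

/-- Steinberg's fixed point theorem. The determinant of the transition matrix from covariants of
the full group to covariants of `P` does not vanish at points whose stabilizer lies in `P`, hence
its zeros lie on the fixed spaces of the elements outside `P`. A hypersurface through `y` cannot be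
contained in a union of such spaces, because those that contain `y` have codimension at least two.
So the determinant does not vanish at `y`, and then the stabilizer of `y` fixes all vectors that are
fixed by `P`, in every representation. -/
theorem mem_pointGroup [IsAlgClosed K] [CharZero K] [Finite Γ] [FiniteDimensional K U]
    (rU : Representation K Γ U) (hfaith : ∀ g, (∀ u, rU g u = u) → g = 1)
    (hG : GeneratedByActing rU ⊤) (y : Module.Dual K U) {c : Γ} (hc : y ∘ₗ rU c = y) :
    c ∈ pointGroup rU y := by
  classical
  have := Fintype.ofFinite Γ
  set P := pointGroup rU y with hP
  -- The permutation representation on functions on `Γ ⧸ P`: here the indicator of the coset of `1`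
  -- is fixed by `P`, and its stabilizer is `P`.
  let rE : Representation K Γ (Γ ⧸ P → K) :=
    { toFun := fun g => LinearMap.funLeft K K fun x => g⁻¹ • x
      map_one' := by ext f x; simp [LinearMap.funLeft_apply]
      map_mul' := fun g h => by ext f x; simp [LinearMap.funLeft_apply, mul_smul] }
  have hU : EigenSpanned (rU 1) := fun w => Submodule.subset_span ⟨1, by simp⟩
  have hE : EigenSpanned (rE 1) := fun w => Submodule.subset_span ⟨1, by simp⟩
  obtain ⟨B⟩ := nonempty_covBasis rU rE ⊤ hG (γ := 1) (one_mem _) hU hE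
  obtain ⟨B'⟩ := nonempty_covBasis rU rE P (generatedByActing_pointGroup rU y) (γ := 1)
    (one_mem _) hU hE
  have hcard : Fintype.card B'.Idx = Fintype.card B.Idx := by
    rw [B.card_eq fun g _ => hfaith g, B'.card_eq fun g _ => hfaith g]
  let e : B'.Idx ≃ B.Idx := Fintype.equivOfCardEq hcard
  let Δ : SymmetricAlgebra K U := Matrix.det
    (Matrix.of fun i j : B.Idx => (transition B B' le_top i (e.symm j) : SymmetricAlgebra K U))
  have hΔ : ∀ z : Module.Dual K U, evalAt z Δ = Matrix.det
      ((transitionAt B B' le_top (evalAt z)).submatrix id e.symm) := by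
    intro z
    rw [AlgHom.map_det]
    rfl
  -- The transition matrix is invertible at points whose stabilizer lies in `P`.
  have hΔ0 : ∀ z : Module.Dual K U, (∀ g, z ∘ₗ rU g = z → g ∈ P) → evalAt z Δ ≠ 0 := by
    intro z hz h0
    obtain ⟨C, hC⟩ := exists_mul_transitionAt_eq_one B B' le_top (y := z) fun g _ => hz g
    rw [hΔ] at h0
    have h1 : C.submatrix e.symm id * (transitionAt B B' le_top (evalAt z)).submatrix id e.symm =
        1 := by
      have h := Matrix.submatrix_mul_equiv C (transitionAt B B' le_top (evalAt z)) e.symm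
        (Equiv.refl _) e.symm
      rw [hC, Matrix.submatrix_one_equiv] at h
      exact h
    have h2 := congrArg Matrix.det h1
    rw [Matrix.det_mul, h0, mul_zero, Matrix.det_one] at h2
    exact zero_ne_one h2
  have hΔy : evalAt y Δ ≠ 0 := by
    intro h0
    have hΔne : Δ ≠ 0 := by
      obtain ⟨z, hz⟩ := exists_generic_point (rU := rU) (G := ⊤) fun g _ => hfaith g
      intro h
      refine hΔ0 z (fun g hg => ?_) (by rw [h, map_zero])
      rw [hz g trivial hg]; exact one_mem _
    -- Suppose that `Δ` vanishes at `y`, and take an irreducible component of its zero set through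
    -- `y`.
    obtain ⟨q, hq, hqΔ, hqy⟩ := exists_prime_dvd_eval hΔne h0
    -- This component is not contained in the fixed space of any element `g` outside `P`: otherwise
    -- `g` would fix `y` and act as a reflection, hence belong to `P`.
    have hex : ∀ g, g ∉ P → ∃ u, ¬ q ∣ SymmetricAlgebra.ι K U (rU g u - u) := by
      intro g hg
      by_contra! hdvd
      by_cases hgy : y ∘ₗ rU g = y
      · refine hg (Subgroup.subset_closure ⟨?_, hgy⟩)
        obtain ⟨a, ha⟩ := exists_smul_of_dvd_ι hq (W := Set.range fun u => rU g u - u)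
          (by rintro _ ⟨u, rfl⟩; exact hdvd u)
        exact ⟨a, fun u => ha _ ⟨u, rfl⟩⟩
      · apply hgy
        ext u
        obtain ⟨r, hr⟩ := hdvd u
        have := congrArg (evalAt y) hr
        rw [map_mul, hqy, zero_mul, evalAt_ι, map_sub, sub_eq_zero] at this
        exact this
    choose! w hw using hex
    -- But the component is covered by these fixed spaces, so by the Nullstellensatz the prime `q`
    -- divides one of the linear forms `g (w g) - w g`.
    obtain ⟨n, hn⟩ := exists_dvd_pow (q := q)
      (f := ∏ g ∈ Finset.univ.filter fun g => g ∉ P, SymmetricAlgebra.ι K U (rU g (w g) - w g))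
      (by
        intro z hz
        obtain ⟨r, hr⟩ := hqΔ
        have hz0 : evalAt z Δ = 0 := by rw [hr, map_mul, hz, zero_mul]
        have : ∃ g, z ∘ₗ rU g = z ∧ g ∉ P := by
          by_contra! h
          exact hΔ0 z h hz0
        obtain ⟨g, hgz, hgP⟩ := this
        rw [map_prod]
        refine Finset.prod_eq_zero (Finset.mem_filter.2 ⟨Finset.mem_univ g, hgP⟩) ?_
        rw [evalAt_ι, map_sub, sub_eq_zero]
        exact LinearMap.congr_fun hgz _)
    obtain ⟨g, hg, hgq⟩ := hq.exists_mem_finset_dvd (hq.dvd_of_dvd_pow hn)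
    exact hw g (Finset.mem_filter.1 hg).2 hgq
  set T := (transitionAt B B' le_top (evalAt y)).submatrix id e.symm with hT
  have hTinv : T⁻¹ * T = 1 := Matrix.nonsing_inv_mul _ (by
    rw [← hΔ]; exact isUnit_iff_ne_zero.2 hΔy)
  have hC : T⁻¹.submatrix e id * transitionAt B B' le_top (evalAt y) = 1 := by
    have h := Matrix.submatrix_mul_equiv T⁻¹ T e (Equiv.refl _) e
    rw [hTinv, Matrix.submatrix_one_equiv] at h
    rw [← h, hT, Matrix.submatrix_submatrix]
    congr 1
    ext i j
    simp
  -- The stabilizer of `y` thus fixes the indicator of the coset of `1`.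
  have hfix := fixed_of_mul_transitionAt_eq_one B B' le_top hC
    (e := Pi.single ((1 : Γ) : Γ ⧸ P) 1) (fun p hp => ?_) (c := c) trivial
    (fun f => by rw [evalAt_symRep, hc])
  · have h1 := congrFun hfix ((c : Γ) : Γ ⧸ P)
    have h2 : rE c (Pi.single ((1 : Γ) : Γ ⧸ P) 1) ((c : Γ) : Γ ⧸ P) = 1 := by
      change (Pi.single ((1 : Γ) : Γ ⧸ P) 1 : Γ ⧸ P → K) (c⁻¹ • ((c : Γ) : Γ ⧸ P)) = 1
      rw [MulAction.Quotient.smul_coe, smul_eq_mul, inv_mul_cancel, Pi.single_eq_same]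
    rw [h2] at h1
    by_contra hcP
    have hne : ((c : Γ) : Γ ⧸ P) ≠ ((1 : Γ) : Γ ⧸ P) := by
      intro h
      have := QuotientGroup.eq.1 h
      exact hcP (by simpa using this)
    rw [Pi.single_eq_of_ne hne] at h1
    exact one_ne_zero h1
  · have hp1 : p • ((1 : Γ) : Γ ⧸ P) = ((1 : Γ) : Γ ⧸ P) := by
      rw [MulAction.Quotient.smul_coe, smul_eq_mul, mul_one]
      exact QuotientGroup.eq.2 (by simpa using hp)
    ext x
    change (Pi.single ((1 : Γ) : Γ ⧸ P) 1 : Γ ⧸ P → K) (p⁻¹ • x) =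
      (Pi.single ((1 : Γ) : Γ ⧸ P) 1 : Γ ⧸ P → K) x
    simp only [Pi.single_apply, inv_smul_eq_iff, hp1]

end Steinberg

/-! ### Multisets of eigenvalues -/

section Multisets

variable {K : Type*} [Field K]

/-- Two diagonal matrices that are intertwined by an invertible matrix have the same entries. -/
theorem map_eq_map_of_intertwine {ι κ : Type*} [Fintype ι] [Fintype κ] [DecidableEq κ]
    (hcard : Fintype.card ι = Fintype.card κ) {T : Matrix ι κ K} {C : Matrix κ ι K}
    (hC : C * T = 1) {l : ι → K} {l' : κ → K} (h : ∀ i j, l i * T i j = l' j * T i j) :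
    (Finset.univ : Finset ι).val.map l = (Finset.univ : Finset κ).val.map l' := by
  classical
  let e : κ ≃ ι := Fintype.equivOfCardEq hcard.symm
  have key : ∀ l₂ : ι → K, (Matrix.diagonal l₂).charpoly.roots =
      (Finset.univ : Finset ι).val.map l₂ := by
    intro l₂
    rw [Matrix.charpoly_diagonal]
    have := Polynomial.roots_multiset_prod_X_sub_C ((Finset.univ : Finset ι).val.map l₂)
    rw [Multiset.map_map] at this
    exact this
  have h1 : C.submatrix e.symm id * T.submatrix id e.symm = 1 := by
    have h := Matrix.submatrix_mul_equiv C T e.symm (Equiv.refl _) e.symm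
    rw [hC, Matrix.submatrix_one_equiv] at h
    exact h
  have h2 : Matrix.diagonal l * T.submatrix id e.symm =
      T.submatrix id e.symm * Matrix.diagonal (l' ∘ e.symm) := by
    ext i j
    rw [Matrix.diagonal_mul, Matrix.mul_diagonal, Matrix.submatrix_apply, mul_comm _ ((l' ∘ _) j)]
    exact h i (e.symm j)
  have h3 : (Matrix.diagonal l).charpoly = (Matrix.diagonal (l' ∘ e.symm)).charpoly := by
    calc (Matrix.diagonal l).charpoly
        = (Matrix.diagonal l * T.submatrix id e.symm * C.submatrix e.symm id).charpoly := by
          rw [Matrix.mul_assoc, mul_eq_one_comm.1 h1, Matrix.mul_one]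
      _ = (C.submatrix e.symm id * (Matrix.diagonal l * T.submatrix id e.symm)).charpoly :=
          Matrix.charpoly_mul_comm _ _
      _ = _ := by rw [h2, ← Matrix.mul_assoc, h1, Matrix.one_mul]
  rw [← key l, h3, key, ← Multiset.map_map]
  congr 1
  have := congrArg Finset.val (Finset.map_univ_equiv e.symm)
  rwa [Finset.map_val] at this

/-- Power sums in terms of multiplicities. -/
theorem sum_pow_eq_sum_count [DecidableEq K] {ι : Type*} [Fintype ι] (l : ι → K) {s : Finset K}
    (hs : Finset.univ.image l ⊆ s) (k : ℕ) :
    ∑ i, l i ^ k =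
      ∑ a ∈ s, (Multiset.count a ((Finset.univ : Finset ι).val.map l) : K) * a ^ k := by
  have h1 : ∑ i, l i ^ k = (((Finset.univ : Finset ι).val.map l).map fun a => a ^ k).sum := by
    rw [Multiset.map_map]; rfl
  rw [h1, Finset.sum_multiset_map_count]
  rw [Finset.sum_subset (s₂ := s)]
  · exact Finset.sum_congr rfl fun a _ => nsmul_eq_mul _ _
  · intro a ha
    apply hs
    simpa using ha
  · intro a _ ha
    rw [Multiset.count_eq_zero_of_notMem fun h => ha (Multiset.mem_toFinset.2 h), zero_smul]

/-- In characteristic zero a finite family is determined, up to order, by its power sums. -/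
theorem map_eq_map_of_sum_pow [CharZero K] {ι κ : Type*} [Fintype ι] [Fintype κ] {l : ι → K}
    {l' : κ → K} (h : ∀ k : ℕ, ∑ i, l i ^ k = ∑ j, l' j ^ k) :
    (Finset.univ : Finset ι).val.map l = (Finset.univ : Finset κ).val.map l' := by
  classical
  -- The sequences `k ↦ a ^ k` are distinct characters of `ℕ`, hence linearly independent.
  let χ : K → (Multiplicative ℕ →* K) := fun a => powersHom K a
  have hχ : Function.Injective χ := (powersHom K).injective
  have hli := (linearIndependent_monoidHom (Multiplicative ℕ) K).comp χ hχ
  set s := Finset.univ.image l ∪ Finset.univ.image l' with hs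
  have h0 : ∑ a ∈ s, ((Multiset.count a ((Finset.univ : Finset ι).val.map l) : K) -
      Multiset.count a ((Finset.univ : Finset κ).val.map l')) •
        (χ a : Multiplicative ℕ → K) = 0 := by
    funext k
    rw [Finset.sum_apply, Pi.zero_apply]
    have h1 := sum_pow_eq_sum_count l (s := s) Finset.subset_union_left k.toAdd
    have h2 := sum_pow_eq_sum_count l' (s := s) Finset.subset_union_right k.toAdd
    rw [h, h2] at h1
    rw [← sub_eq_zero.2 h1.symm, ← Finset.sum_sub_distrib]
    refine Finset.sum_congr rfl fun a _ => ?_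
    rw [← sub_mul]
    rfl
  have h3 := linearIndependent_iff'.1 hli s _ h0
  ext a
  by_cases ha : a ∈ s
  · exact_mod_cast sub_eq_zero.1 (h3 a ha)
  · rw [hs, Finset.mem_union, not_or] at ha
    rw [Multiset.count_eq_zero_of_notMem, Multiset.count_eq_zero_of_notMem]
    · intro h; apply ha.2; simpa using h
    · intro h; apply ha.1; simpa using h

end Multisets

/-! ### Comparison of covariants of a group and of a subgroup -/

section Comparison

variable {K U E Γ : Type*} [Field K] [AddCommGroup U] [Module K U] [AddCommGroup E] [Module K E]
  [Group Γ] {rU : Representation K Γ U} {rE : Representation K Γ E} {G P : Subgroup Γ} {γ : Γ}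

/-- If the linear form `y` composed with `γ` is `ζ⁻¹ y`, then `γ` multiplies the values at `y` of
elements of degree `d` by `ζ ^ (-d)`. Hypothesis and conclusion are written without inverses, which
admits `y = 0` and `ζ = 0`. -/
theorem pow_mul_evalAt_symRep {y : Module.Dual K U} {ζ : K}
    (hζ : ∀ u, ζ * y (rU γ u) = y u) {d : ℕ} {f : SymmetricAlgebra K U} (hf : f ∈ symPower K U d) :
    ζ ^ d * evalAt y (symRep rU γ f) = evalAt y f := by
  induction d generalizing f with
  | zero =>
    rw [exists_eq_algebraMap hf, symRep_algebraMap, pow_zero, one_mul]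
  | succ d ih =>
    rw [symPower, pow_succ] at hf
    induction hf using Submodule.mul_induction_on' with
    | mem_mul_mem m hm n hn =>
      obtain ⟨u, rfl⟩ := hn
      rw [symRep_mul, symRep_ι, map_mul, map_mul, evalAt_ι, evalAt_ι, ← ih hm, ← hζ u]
      ring
    | add x _ y _ hx hy => rw [map_add, map_add, map_add, mul_add, hx, hy]

/-- The transition matrix is homogeneous: its entries have the differences of the degrees as
degrees. -/
theorem comp_transition (B : CovBasis rU rE G γ) (B' : CovBasis rU rE P γ) (hPG : P ≤ G)
    (i : B.Idx) (j : B'.Idx) :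
    (transition B B' hPG i j : SymmetricAlgebra K U) =
      if B'.deg j ≤ B.deg i then
        comp (B.deg i - B'.deg j) (transition B B' hPG i j : SymmetricAlgebra K U) else 0 := by
  have h : invComb B'.vec (fun j => (⟨if B'.deg j ≤ B.deg i then
      comp (B.deg i - B'.deg j) (transition B B' hPG i j : SymmetricAlgebra K U) else 0, by
        split_ifs
        · exact comp_mem_invAlg rU (transition B B' hPG i j).2 _
        · exact zero_mem _⟩ : invAlg rU P)) = invComb B'.vec (transition B B' hPG i) := by
    rw [invComb_transition]
    conv_rhs => rw [← mem_covPower_iff.1 (B.homogeneous i), ← invComb_transition B B' hPG i]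
    rw [invComb_apply, invComb_apply, map_sum]
    refine Finset.sum_congr rfl fun j _ => ?_
    rw [covComp_smul_of_mem _ _ (B'.homogeneous j)]
    by_cases hd : B'.deg j ≤ B.deg i
    · simp only [if_pos hd]
    · simp only [if_neg hd]
      exact zero_smul (SymmetricAlgebra K U) _
  exact (congrArg Subtype.val (congrFun (B'.invComb_injective h) j)).symm

/-- The entries of the transition matrix are eigenvectors of `γ`, with the quotients of the
eigenvalues as eigenvalues. -/
theorem symRep_transition (B : CovBasis rU rE G γ) (B' : CovBasis rU rE P γ) (hPG : P ≤ G)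
    (hγ : γ ∈ Subgroup.normalizer (P : Set Γ)) (i : B.Idx) (j : B'.Idx) :
    B'.eig j • symRep rU γ (transition B B' hPG i j : SymmetricAlgebra K U) =
      B.eig i • (transition B B' hPG i j : SymmetricAlgebra K U) := by
  have h : invComb B'.vec (fun j => B'.eig j • (⟨symRep rU γ (transition B B' hPG i j),
      symRep_mem_invAlg hγ (transition B B' hPG i j).2⟩ : invAlg rU P)) =
        invComb B'.vec (B.eig i • transition B B' hPG i) := by
    rw [map_smul, invComb_transition, ← B.eigen i]
    conv_rhs => rw [← invComb_transition B B' hPG i]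
    rw [invComb_apply, invComb_apply, map_sum]
    refine Finset.sum_congr rfl fun j _ => ?_
    rw [covRep_smul, B'.eigen, Subalgebra.coe_smul]
    rw [smul_assoc, smul_comm]
  exact congrArg Subtype.val (congrFun (B'.invComb_injective h) j)

/-- The comparison of a reflection group with a parabolic subgroup `P`. The transition matrix at
the point `y` is invertible and intertwines the eigenvalues, corrected by powers of the scalar by
which `γ` acts on `y`. -/
theorem map_weighted_eq [CharZero K] [Finite G] [FiniteDimensional K U] [FiniteDimensional K E]
    (B : CovBasis rU rE G γ) (B' : CovBasis rU rE P γ) (hPG : P ≤ G)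
    (hfaith : ∀ g ∈ G, (∀ u, rU g u = u) → g = 1)
    (hγ : γ ∈ Subgroup.normalizer (P : Set Γ)) {y : Module.Dual K U}
    (hy : ∀ g ∈ G, y ∘ₗ rU g = y → g ∈ P) {ζ : K} (hζ : ∀ u, ζ * y (rU γ u) = y u) :
    (Finset.univ : Finset B.Idx).val.map (fun i => B.eig i * ζ ^ B.deg i) =
      (Finset.univ : Finset B'.Idx).val.map (fun i => B'.eig i * ζ ^ B'.deg i) := by
  classical
  have hfinP : Finite P := Finite.of_injective _ (Subgroup.inclusion_injective hPG)
  obtain ⟨C, hC⟩ := exists_mul_transitionAt_eq_one B B' hPG hy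
  refine map_eq_map_of_intertwine
    ((B.card_eq hfaith).trans (B'.card_eq fun g hg => hfaith g (hPG hg)).symm) hC fun i j => ?_
  have h1 := congrArg (evalAt y) (symRep_transition B B' hPG hγ i j)
  have h2 := comp_transition B B' hPG i j
  simp only [map_smul, smul_eq_mul] at h1
  change _ * evalAt y (transition B B' hPG i j : SymmetricAlgebra K U) =
    _ * evalAt y (transition B B' hPG i j : SymmetricAlgebra K U)
  by_cases hd : B'.deg j ≤ B.deg i
  · rw [if_pos hd] at h2
    have h3 := pow_mul_evalAt_symRep (rU := rU) hζ (d := B.deg i - B'.deg j)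
      (f := (transition B B' hPG i j : SymmetricAlgebra K U)) (h2 ▸ comp_mem _ _)
    rw [mul_right_comm, ← h1, ← Nat.sub_add_cancel hd, pow_add, ← h3]
    ring
  · rw [if_neg hd] at h2
    rw [h2, map_zero, mul_zero, mul_zero]

end Comparison

/-! ### Differential operators and the pairing of symmetric algebras -/

section DifferentialOperators

variable {K V Γ : Type*} [Field K] [AddCommGroup V] [Module K V] [Group Γ]

theorem dirDeriv_comm (v w : V) (f : Poly K V) :
    dirDeriv v (dirDeriv w f) = dirDeriv w (dirDeriv v f) := by
  induction f using SymmetricAlgebra.induction with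
  | algebraMap r => simp
  | ι φ => rw [dirDeriv_form, dirDeriv_form]; simp
  | mul a b ha hb =>
    simp only [Derivation.leibniz, map_add, smul_eq_mul, ha, hb]
    ring
  | add a b ha hb => simp only [map_add, ha, hb]

theorem dirDeriv_add_apply (v w : V) (f : Poly K V) :
    dirDeriv (v + w) f = dirDeriv v f + dirDeriv w f := by
  induction f using SymmetricAlgebra.induction with
  | algebraMap r => simp
  | ι φ => rw [dirDeriv_form, dirDeriv_form, dirDeriv_form, map_add, map_add]
  | mul a b ha hb =>
    simp only [Derivation.leibniz, smul_eq_mul, ha, hb]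
    ring
  | add a b ha hb => simp only [map_add, ha, hb]; ring

theorem dirDeriv_smul_apply (c : K) (v : V) (f : Poly K V) :
    dirDeriv (c • v) f = c • dirDeriv v f := by
  induction f using SymmetricAlgebra.induction with
  | algebraMap r => simp
  | ι φ => rw [dirDeriv_form, dirDeriv_form, map_smul, smul_eq_mul, map_mul, Algebra.smul_def]
  | mul a b ha hb =>
    simp only [Derivation.leibniz, smul_eq_mul, ha, hb, smul_add, mul_smul_comm]
  | add a b ha hb => simp only [map_add, ha, hb, smul_add]

variable (K V) in
instance isMulCommutative_diffOps : IsMulCommutative (diffOps K V) :=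
  Algebra.isMulCommutative_adjoin K (by
    rintro _ ⟨v, rfl⟩ _ ⟨w, rfl⟩
    ext f
    exact dirDeriv_comm v w f)

variable (K V) in
/-- The directional derivatives as a linear map to the commutative algebra `diffOps`. -/
def dirDerivHom : V →ₗ[K] diffOps K V where
  toFun v := ⟨(dirDeriv v).toLinearMap, Algebra.subset_adjoin ⟨v, rfl⟩⟩
  map_add' v w := Subtype.ext (LinearMap.ext fun f => dirDeriv_add_apply v w f)
  map_smul' c v := Subtype.ext (LinearMap.ext fun f => dirDeriv_smul_apply c v f)

open scoped IsMulCommutative in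
variable (K V) in
/-- The action of the symmetric algebra of `V` on polynomials by differential operators with
constant coefficients. -/
def polyDiff : SymmetricAlgebra K V →ₐ[K] Module.End K (Poly K V) :=
  (diffOps K V).val.comp (SymmetricAlgebra.lift (A := diffOps K V) (dirDerivHom K V))

open scoped IsMulCommutative in
theorem polyDiff_ι (v : V) (f : Poly K V) :
    polyDiff K V (SymmetricAlgebra.ι K V v) f = dirDeriv v f := by
  have : SymmetricAlgebra.lift (A := diffOps K V) (dirDerivHom K V) (SymmetricAlgebra.ι K V v) =
      dirDerivHom K V v := SymmetricAlgebra.lift_ι_apply _ _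
  change (SymmetricAlgebra.lift (A := diffOps K V) (dirDerivHom K V) (SymmetricAlgebra.ι K V v) :
    Module.End K (Poly K V)) f = _
  rw [this]
  rfl

theorem polyDiff_mul (a b : SymmetricAlgebra K V) (f : Poly K V) :
    polyDiff K V (a * b) f = polyDiff K V a (polyDiff K V b f) := by
  rw [map_mul, Module.End.mul_apply]

theorem polyDiff_algebraMap (c : K) (f : Poly K V) :
    polyDiff K V (algebraMap K _ c) f = c • f := by
  rw [AlgHom.commutes, Module.algebraMap_end_apply]

/-- Every operator with constant coefficients comes from the symmetric algebra of `V`. -/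
theorem exists_polyDiff_eq {D : Module.End K (Poly K V)} (hD : D ∈ diffOps K V) :
    ∃ a, polyDiff K V a = D := by
  have h : diffOps K V ≤ (polyDiff K V).range := by
    refine Algebra.adjoin_le ?_
    rintro _ ⟨v, rfl⟩
    exact ⟨SymmetricAlgebra.ι K V v, LinearMap.ext fun f => polyDiff_ι v f⟩
  exact h hD

theorem polyDiff_mem (a : SymmetricAlgebra K V) : polyDiff K V a ∈ diffOps K V := by
  rw [polyDiff, AlgHom.comp_apply]
  exact Subtype.property _

theorem dirDeriv_mem_symPower (v : V) {d : ℕ} {f : Poly K V}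
    (hf : f ∈ symPower K (Module.Dual K V) (d + 1)) :
    dirDeriv v f ∈ symPower K (Module.Dual K V) d := by
  induction d generalizing f with
  | zero =>
    rw [symPower, zero_add, pow_one] at hf
    obtain ⟨φ, rfl⟩ := hf
    rw [dirDeriv_form]
    exact algebraMap_mem_symPower _
  | succ d ih =>
    rw [symPower, pow_succ] at hf
    induction hf using Submodule.mul_induction_on' with
    | mem_mul_mem m hm n hn =>
      obtain ⟨φ, rfl⟩ := hn
      rw [Derivation.leibniz, smul_eq_mul, smul_eq_mul, dirDeriv_form, mul_comm m]
      refine add_mem ?_ ?_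
      · rw [← Algebra.smul_def]; exact Submodule.smul_mem _ _ hm
      · rw [mul_comm]; exact mul_mem_symPower (ih hm) (ι_mem_symPower φ)
    | add x _ y _ hx hy => rw [map_add]; exact add_mem hx hy

theorem dirDeriv_of_mem_zero (v : V) {f : Poly K V}
    (hf : f ∈ symPower K (Module.Dual K V) 0) : dirDeriv v f = 0 := by
  rw [exists_eq_algebraMap hf]; simp

theorem polyDiff_mem_symPower {d e : ℕ} {a : SymmetricAlgebra K V} (ha : a ∈ symPower K V d)
    {f : Poly K V} (hf : f ∈ symPower K (Module.Dual K V) (e + d)) :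
    polyDiff K V a f ∈ symPower K (Module.Dual K V) e := by
  induction d generalizing a f with
  | zero =>
    rw [exists_eq_algebraMap ha, polyDiff_algebraMap]
    exact Submodule.smul_mem _ _ hf
  | succ d ih =>
    rw [symPower, pow_succ] at ha
    induction ha using Submodule.mul_induction_on' with
    | mem_mul_mem m hm n hn =>
      obtain ⟨v, rfl⟩ := hn
      rw [polyDiff_mul, polyDiff_ι]
      exact ih hm (dirDeriv_mem_symPower v hf)
    | add x _ y _ hx hy => rw [map_add, LinearMap.add_apply]; exact add_mem hx hy

theorem polyDiff_eq_zero_of_lt {d e : ℕ} (hed : e < d) {a : SymmetricAlgebra K V}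
    (ha : a ∈ symPower K V d) {f : Poly K V} (hf : f ∈ symPower K (Module.Dual K V) e) :
    polyDiff K V a f = 0 := by
  induction d generalizing a f e with
  | zero => omega
  | succ d ih =>
    rw [symPower, pow_succ] at ha
    induction ha using Submodule.mul_induction_on' with
    | mem_mul_mem m hm n hn =>
      obtain ⟨v, rfl⟩ := hn
      rw [polyDiff_mul, polyDiff_ι]
      rcases e with _ | e
      · rw [dirDeriv_of_mem_zero v hf, map_zero]
      · exact ih (by omega) hm (dirDeriv_mem_symPower v hf)
    | add x _ y _ hx hy => rw [map_add, LinearMap.add_apply, hx, hy, add_zero]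

variable (K V) in
/-- The pairing between the symmetric algebras of `V` and of its dual: apply a differential operator
to a polynomial and take the constant term. -/
def pairing : SymmetricAlgebra K V →ₗ[K] Poly K V →ₗ[K] K :=
  (LinearMap.compRight K (constTerm (K := K) (U := Module.Dual K V)).toLinearMap) ∘ₗ
    (polyDiff K V).toLinearMap

theorem pairing_apply (a : SymmetricAlgebra K V) (f : Poly K V) :
    pairing K V a f = constTerm (polyDiff K V a f) := rfl

theorem pairing_mul (a b : SymmetricAlgebra K V) (f : Poly K V) :
    pairing K V (a * b) f = pairing K V a (polyDiff K V b f) := by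
  rw [pairing_apply, polyDiff_mul, pairing_apply]

theorem pairing_eq_zero_of_ne {d e : ℕ} (hde : d ≠ e) {a : SymmetricAlgebra K V}
    (ha : a ∈ symPower K V d) {f : Poly K V} (hf : f ∈ symPower K (Module.Dual K V) e) :
    pairing K V a f = 0 := by
  rw [pairing_apply]
  rcases lt_or_gt_of_ne hde with h | h
  · refine constTerm_of_mem (d := e - d) (by omega) (polyDiff_mem_symPower ha ?_)
    rwa [Nat.sub_add_cancel h.le]
  · rw [polyDiff_eq_zero_of_lt h ha hf, map_zero]

/-- Euler's identity. -/
theorem sum_mul_dirDeriv {ι : Type*} [Fintype ι] [DecidableEq ι] (b : Module.Basis ι K V) {d : ℕ}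
    {f : Poly K V} (hf : f ∈ symPower K (Module.Dual K V) d) :
    ∑ i, form K V (b.coord i) * dirDeriv (b i) f = (d : K) • f := by
  induction d generalizing f with
  | zero =>
    simp [dirDeriv_of_mem_zero _ hf]
  | succ d ih =>
    rw [symPower, pow_succ] at hf
    induction hf using Submodule.mul_induction_on' with
    | mem_mul_mem m hm n hn =>
      obtain ⟨φ, rfl⟩ := hn
      have h1 : ∑ i, form K V (b.coord i) * algebraMap K _ (φ (b i)) = form K V φ := by
        have : φ = ∑ i, φ (b i) • b.coord i := by
          refine b.ext fun j => ?_
          simp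
        conv_rhs => rw [this, map_sum]
        refine Finset.sum_congr rfl fun i _ => ?_
        rw [map_smul, Algebra.smul_def, mul_comm]
      have h2 := ih hm
      have h3 : ∀ i, form K V (b.coord i) * dirDeriv (b i) (m * form K V φ) =
          m * (form K V (b.coord i) * algebraMap K _ (φ (b i))) +
            form K V φ * (form K V (b.coord i) * dirDeriv (b i) m) := by
        intro i
        rw [Derivation.leibniz, smul_eq_mul, smul_eq_mul, dirDeriv_form]
        ring
      rw [Finset.sum_congr rfl fun i _ => h3 i, Finset.sum_add_distrib, ← Finset.mul_sum,
        ← Finset.mul_sum, h1, h2, Nat.cast_succ, add_smul, one_smul, mul_smul_comm, mul_comm m]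
      exact add_comm _ _
    | add x _ y _ hx hy =>
      rw [smul_add, ← hx, ← hy, ← Finset.sum_add_distrib]
      exact Finset.sum_congr rfl fun i _ => by rw [map_add, mul_add]

/-- The pairing is nondegenerate in the second variable, by Euler's identity. -/
theorem eq_zero_of_pairing [CharZero K] [FiniteDimensional K V] {d : ℕ} {f : Poly K V}
    (hf : f ∈ symPower K (Module.Dual K V) d)
    (h : ∀ a ∈ symPower K V d, pairing K V a f = 0) : f = 0 := by
  classical
  induction d generalizing f with
  | zero =>
    have h1 := h 1 (by simpa using algebraMap_mem_symPower (U := V) (1 : K))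
    rw [pairing_apply, map_one, Module.End.one_apply] at h1
    rw [exists_eq_algebraMap hf, h1, map_zero]
  | succ d ih =>
    have hd : ∀ v, dirDeriv v f = 0 := by
      intro v
      refine ih (dirDeriv_mem_symPower v hf) fun a ha => ?_
      rw [← polyDiff_ι, ← pairing_mul]
      exact h _ (mul_mem_symPower ha (ι_mem_symPower v))
    have h1 := sum_mul_dirDeriv (Module.finBasis K V) hf
    simp only [hd, mul_zero, Finset.sum_const_zero] at h1
    exact (smul_eq_zero.1 h1.symm).resolve_left (Nat.cast_ne_zero.2 (Nat.succ_ne_zero d))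

theorem finrank_symPower_le {U U' : Type*} [AddCommGroup U] [Module K U] [AddCommGroup U']
    [Module K U'] [FiniteDimensional K U] (e : U ≃ₗ[K] U') (d : ℕ) :
    Module.finrank K (symPower K U' d) ≤ Module.finrank K (symPower K U d) := by
  let F : SymmetricAlgebra K U →ₐ[K] SymmetricAlgebra K U' :=
    SymmetricAlgebra.lift (SymmetricAlgebra.ι K U' ∘ₗ e.toLinearMap)
  have hmap : (symPower K U d).map F.toLinearMap = symPower K U' d := by
    rw [symPower, Submodule.map_pow, ← LinearMap.range_comp]
    have : F.toLinearMap ∘ₗ SymmetricAlgebra.ι K U = SymmetricAlgebra.ι K U' ∘ₗ e.toLinearMap :=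
      SymmetricAlgebra.lift_comp_ι _
    rw [this, LinearMap.range_comp_of_range_eq_top _ e.range, symPower]
  rw [← hmap]
  exact Submodule.finrank_map_le _ _

theorem finrank_symPower_dual [FiniteDimensional K V] (d : ℕ) :
    Module.finrank K (symPower K (Module.Dual K V) d) = Module.finrank K (symPower K V d) := by
  let e := (Module.finBasis K V).toDualEquiv
  exact le_antisymm (finrank_symPower_le e d) (finrank_symPower_le e.symm d)

/-- The pairing is nondegenerate in the first variable, because homogeneous components of equal
degree have equal dimensions. -/
theorem eq_zero_of_pairing' [CharZero K] [FiniteDimensional K V] {d : ℕ} {a : SymmetricAlgebra K V}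
    (ha : a ∈ symPower K V d)
    (h : ∀ f ∈ symPower K (Module.Dual K V) d, pairing K V a f = 0) : a = 0 := by
  let T : symPower K (Module.Dual K V) d →ₗ[K] Module.Dual K (symPower K V d) :=
    ((pairing K V).domRestrict (symPower K V d)).flip ∘ₗ (symPower K (Module.Dual K V) d).subtype
  have hT : Function.Injective T := by
    refine (injective_iff_map_eq_zero _).2 fun f hf => Subtype.ext ?_
    exact eq_zero_of_pairing f.2 fun a ha => LinearMap.congr_fun hf ⟨a, ha⟩
  have hT' : Function.Surjective T :=
    (LinearMap.injective_iff_surjective_of_finrank_eq_finrank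
      ((finrank_symPower_dual d).trans Subspace.dual_finrank_eq.symm)).1 hT
  have h0 : (⟨a, ha⟩ : symPower K V d) = 0 := by
    refine (Module.forall_dual_apply_eq_zero_iff K _).1 fun φ => ?_
    obtain ⟨f, rfl⟩ := hT' φ
    exact h f f.2
  exact congrArg Subtype.val h0

theorem pairing_comp (a : SymmetricAlgebra K V) {d : ℕ} {f : Poly K V}
    (hf : f ∈ symPower K (Module.Dual K V) d) :
    pairing K V (comp d a) f = pairing K V a f := by
  obtain ⟨n, hn⟩ := exists_sum_comp a
  conv_rhs => rw [← hn (max n (d + 1)) (le_max_left _ _), map_sum, LinearMap.sum_apply]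
  rw [Finset.sum_eq_single_of_mem d (Finset.mem_range.2 (by omega))]
  exact fun e _ he => pairing_eq_zero_of_ne he (comp_mem _ _) hf

/-- An element of the symmetric algebra of `V` is determined by its differential operator. -/
theorem polyDiff_injective [CharZero K] [FiniteDimensional K V] :
    Function.Injective (polyDiff K V) := by
  refine (injective_iff_map_eq_zero _).2 fun a ha => eq_zero_of_comp fun d => ?_
  refine eq_zero_of_pairing' (comp_mem _ _) fun f hf => ?_
  rw [pairing_comp a hf, pairing_apply, ha]
  simp

variable (rV : Representation K Γ V)

theorem symRep_dirDeriv (g : Γ) (v : V) (f : Poly K V) :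
    symRep rV.dual g (dirDeriv v f) = dirDeriv (rV g v) (symRep rV.dual g f) := by
  induction f using SymmetricAlgebra.induction with
  | algebraMap r => simp [symRep_algebraMap]
  | ι φ =>
    rw [symRep_ι, dirDeriv_form, dirDeriv_form, symRep_algebraMap, Representation.dual_apply,
      Module.Dual.transpose_apply, LinearMap.comp_apply, ← Module.End.mul_apply, ← map_mul]
    simp
  | mul a b ha hb =>
    simp only [Derivation.leibniz, map_add, smul_eq_mul, symRep_mul, ha, hb]
  | add a b ha hb => simp only [map_add, ha, hb]

theorem symRep_polyDiff (g : Γ) (a : SymmetricAlgebra K V) (f : Poly K V) :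
    symRep rV.dual g (polyDiff K V a f) =
      polyDiff K V (symRep rV g a) (symRep rV.dual g f) := by
  induction a using SymmetricAlgebra.induction generalizing f with
  | algebraMap r => rw [symRep_algebraMap, polyDiff_algebraMap, polyDiff_algebraMap, map_smul]
  | ι v => rw [symRep_ι, polyDiff_ι, polyDiff_ι, symRep_dirDeriv]
  | mul a b ha hb => rw [symRep_mul, polyDiff_mul, polyDiff_mul, ha, hb]
  | add a b ha hb => simp only [map_add, LinearMap.add_apply, ha, hb]

theorem pairing_symRep (g : Γ) (a : SymmetricAlgebra K V) (f : Poly K V) :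
    pairing K V (symRep rV g a) (symRep rV.dual g f) = pairing K V a f := by
  rw [pairing_apply, ← symRep_polyDiff, constTerm_symRep, pairing_apply]

end DifferentialOperators

/-! ### The pairing of covariants -/

section CovariantPairing

variable {K V M Γ : Type*} [Field K] [AddCommGroup V] [Module K V] [AddCommGroup M] [Module K M]
  [Group Γ]

variable (K V M) in
/-- The pairing between `Sym V ⊗ M` and `Sym V^* ⊗ M^*`: the tensor product of the pairing of the
symmetric algebras with the evaluation pairing of `M` and `M^*`. -/
def covPairing : SymmetricAlgebra K V ⊗[K] M →ₗ[K] Poly K V ⊗[K] Module.Dual K M →ₗ[K] K :=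
  TensorProduct.dualDistrib K (Poly K V) (Module.Dual K M) ∘ₗ
    TensorProduct.map (pairing K V) (Module.Dual.eval K M)

theorem covPairing_tmul (a : SymmetricAlgebra K V) (m : M) (f : Poly K V) (ξ : Module.Dual K M) :
    covPairing K V M (a ⊗ₜ m) (f ⊗ₜ ξ) = pairing K V a f * ξ m := by
  simp [covPairing]

theorem covPairing_tmul_left (a : SymmetricAlgebra K V) (m : M)
    (x : Poly K V ⊗[K] Module.Dual K M) :
    covPairing K V M (a ⊗ₜ m) x = pairing K V a (coord (Module.Dual.eval K M m) x) := by
  induction x using TensorProduct.induction_on with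
  | zero => simp
  | tmul f ξ => rw [covPairing_tmul, coord_tmul, map_smul, smul_eq_mul, mul_comm]; rfl
  | add x y hx hy => simp only [map_add, hx, hy]

theorem covPairing_tmul_right (x : SymmetricAlgebra K V ⊗[K] M) (f : Poly K V)
    (ξ : Module.Dual K M) :
    covPairing K V M x (f ⊗ₜ ξ) = pairing K V (coord ξ x) f := by
  induction x using TensorProduct.induction_on with
  | zero => simp
  | tmul a m => rw [covPairing_tmul, coord_tmul, map_smul, LinearMap.smul_apply, smul_eq_mul,
      mul_comm]
  | add x y hx hy => simp only [map_add, LinearMap.add_apply, hx, hy]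

variable (M) in
/-- A differential operator applied to the first factor of `Sym V^* ⊗ M^*`. -/
def covDiff (a : SymmetricAlgebra K V) :
    Poly K V ⊗[K] Module.Dual K M →ₗ[K] Poly K V ⊗[K] Module.Dual K M :=
  LinearMap.rTensor (Module.Dual K M) (polyDiff K V a)

/-- Multiplication by `a` is adjoint to the differential operator given by `a`. -/
theorem covPairing_smul (a : SymmetricAlgebra K V) (x : SymmetricAlgebra K V ⊗[K] M)
    (y : Poly K V ⊗[K] Module.Dual K M) :
    covPairing K V M (a • x) y = covPairing K V M x (covDiff M a y) := by
  induction x using TensorProduct.induction_on with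
  | zero => simp
  | tmul b m =>
    induction y using TensorProduct.induction_on with
    | zero => simp
    | tmul f ξ =>
      rw [TensorProduct.smul_tmul', smul_eq_mul, mul_comm, covDiff, LinearMap.rTensor_tmul,
        covPairing_tmul, covPairing_tmul, pairing_mul]
    | add x y hx hy => simp only [map_add, hx, hy]
  | add x y hx hy => simp only [smul_add, map_add, LinearMap.add_apply, hx, hy]

theorem coord_covDiff (ξ : Module.Dual K (Module.Dual K M)) (a : SymmetricAlgebra K V)
    (x : Poly K V ⊗[K] Module.Dual K M) :
    coord ξ (covDiff M a x) = polyDiff K V a (coord ξ x) := by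
  induction x using TensorProduct.induction_on with
  | zero => simp
  | tmul f η => rw [covDiff, LinearMap.rTensor_tmul, coord_tmul, coord_tmul, map_smul]
  | add x y hx hy => simp only [map_add, hx, hy]

theorem eq_zero_of_coord {U E : Type*} [AddCommGroup U] [Module K U] [AddCommGroup E] [Module K E]
    [FiniteDimensional K E] {x : SymmetricAlgebra K U ⊗[K] E}
    (h : ∀ ξ : Module.Dual K E, coord ξ x = 0) : x = 0 := by
  rw [eq_sum_coord (Module.finBasis K E) x]
  exact Finset.sum_eq_zero fun i _ => by rw [h]; exact zero_smul (SymmetricAlgebra K U) _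

theorem coord_mem_symPower {U E : Type*} [AddCommGroup U] [Module K U] [AddCommGroup E] [Module K E]
    {d : ℕ} {x : SymmetricAlgebra K U ⊗[K] E} (hx : x ∈ covPower K U E d) (ξ : Module.Dual K E) :
    coord ξ x ∈ symPower K U d := by
  rw [← mem_covPower_iff.1 hx, coord_covComp]
  exact comp_mem _ _

variable [CharZero K] [FiniteDimensional K V] [FiniteDimensional K M]

theorem eq_zero_of_covPairing {d : ℕ} {x : Poly K V ⊗[K] Module.Dual K M}
    (hx : x ∈ covPower K (Module.Dual K V) (Module.Dual K M) d)
    (h : ∀ x' ∈ covPower K V M d, covPairing K V M x' x = 0) : x = 0 := by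
  refine eq_zero_of_coord fun ξ => ?_
  obtain ⟨m, rfl⟩ := (Module.bijective_dual_eval K M).2 ξ
  refine eq_zero_of_pairing (coord_mem_symPower hx _) fun a ha => ?_
  rw [← covPairing_tmul_left]
  exact h _ ⟨(⟨a, ha⟩ : symPower K V d) ⊗ₜ m, rfl⟩

theorem eq_zero_of_covPairing' {d : ℕ} {x : SymmetricAlgebra K V ⊗[K] M}
    (hx : x ∈ covPower K V M d)
    (h : ∀ y ∈ covPower K (Module.Dual K V) (Module.Dual K M) d, covPairing K V M x y = 0) :
    x = 0 := by
  refine eq_zero_of_coord fun ξ => ?_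
  refine eq_zero_of_pairing' (coord_mem_symPower hx _) fun f hf => ?_
  rw [← covPairing_tmul_right]
  exact h _ ⟨(⟨f, hf⟩ : symPower K (Module.Dual K V) d) ⊗ₜ ξ, rfl⟩

omit [CharZero K] [FiniteDimensional K V] [FiniteDimensional K M]

theorem covPairing_eq_zero_of_ne {d e : ℕ} (hde : d ≠ e) {x : SymmetricAlgebra K V ⊗[K] M}
    (hx : x ∈ covPower K V M d) {y : Poly K V ⊗[K] Module.Dual K M}
    (hy : y ∈ covPower K (Module.Dual K V) (Module.Dual K M) e) : covPairing K V M x y = 0 := by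
  obtain ⟨x, rfl⟩ := hx
  obtain ⟨y, rfl⟩ := hy
  induction x using TensorProduct.induction_on with
  | zero => simp
  | tmul a m =>
    induction y using TensorProduct.induction_on with
    | zero => simp
    | tmul f ξ =>
      rw [LinearMap.rTensor_tmul, LinearMap.rTensor_tmul, covPairing_tmul]
      rw [Submodule.subtype_apply, Submodule.subtype_apply, pairing_eq_zero_of_ne hde a.2 f.2,
        zero_mul]
    | add x y hx hy => simp only [map_add, hx, hy, add_zero]
  | add x y hx hy => simp only [map_add, LinearMap.add_apply, hx, hy, add_zero]

theorem covPairing_covComp (x : SymmetricAlgebra K V ⊗[K] M) {d : ℕ}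
    {y : Poly K V ⊗[K] Module.Dual K M}
    (hy : y ∈ covPower K (Module.Dual K V) (Module.Dual K M) d) :
    covPairing K V M (covComp d x) y = covPairing K V M x y := by
  obtain ⟨n, hn⟩ := exists_sum_covComp x
  conv_rhs => rw [← hn (max n (d + 1)) (le_max_left _ _), map_sum, LinearMap.sum_apply]
  rw [Finset.sum_eq_single_of_mem d (Finset.mem_range.2 (by omega))]
  exact fun e _ he => covPairing_eq_zero_of_ne he (covComp_mem _ _) hy

theorem covPairing_covComp_right {x : SymmetricAlgebra K V ⊗[K] M} {d : ℕ}
    (hx : x ∈ covPower K V M d) (y : Poly K V ⊗[K] Module.Dual K M) :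
    covPairing K V M x (covComp d y) = covPairing K V M x y := by
  obtain ⟨n, hn⟩ := exists_sum_covComp y
  conv_rhs => rw [← hn (max n (d + 1)) (le_max_left _ _), map_sum]
  rw [Finset.sum_eq_single_of_mem d (Finset.mem_range.2 (by omega))]
  exact fun e _ he => covPairing_eq_zero_of_ne he.symm hx (covComp_mem _ _)

variable (rV : Representation K Γ V) (rM : Representation K Γ M)

theorem covPairing_covRep (g : Γ) (x : SymmetricAlgebra K V ⊗[K] M)
    (y : Poly K V ⊗[K] Module.Dual K M) :
    covPairing K V M (covRep rV rM g x) (covRep rV.dual rM.dual g y) = covPairing K V M x y := by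
  induction x using TensorProduct.induction_on with
  | zero => simp
  | tmul a m =>
    induction y using TensorProduct.induction_on with
    | zero => simp
    | tmul f ξ =>
      rw [covRep_tmul, covRep_tmul, covPairing_tmul, covPairing_tmul, pairing_symRep,
        Representation.dual_apply, Module.Dual.transpose_apply, LinearMap.comp_apply,
        ← Module.End.mul_apply, ← map_mul, inv_mul_cancel, map_one, Module.End.one_apply]
    | add x y hx hy => simp only [map_add, hx, hy]
  | add x y hx hy => simp only [map_add, LinearMap.add_apply, hx, hy]

theorem covRep_covDiff (g : Γ) (a : SymmetricAlgebra K V) (y : Poly K V ⊗[K] Module.Dual K M) :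
    covRep rV.dual rM.dual g (covDiff M a y) =
      covDiff M (symRep rV g a) (covRep rV.dual rM.dual g y) := by
  induction y using TensorProduct.induction_on with
  | zero => simp
  | tmul f ξ =>
    rw [covDiff, covDiff, LinearMap.rTensor_tmul, covRep_tmul, covRep_tmul, LinearMap.rTensor_tmul,
      symRep_polyDiff]
  | add x y hx hy => simp only [map_add, hx, hy]

end CovariantPairing

/-! ### Traces and perfect pairings -/

section TraceDuality

variable {K Γ W W' : Type*} [Field K] [AddCommGroup W] [Module K W] [AddCommGroup W'] [Module K W']
  [Group Γ]

/-- The identification of a space with the dual of another one by a perfect pairing. -/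
def pairingEquiv [FiniteDimensional K W] [FiniteDimensional K W']
    (β : W' →ₗ[K] W →ₗ[K] K) (h1 : ∀ w, (∀ w', β w' w = 0) → w = 0)
    (h2 : ∀ w', (∀ w, β w' w = 0) → w' = 0) : W ≃ₗ[K] Module.Dual K W' :=
  have hi : Function.Injective β.flip := (injective_iff_map_eq_zero _).2 fun w hw =>
    h1 w fun w' => LinearMap.congr_fun hw w'
  have hi' : Function.Injective β := (injective_iff_map_eq_zero _).2 fun w' hw =>
    h2 w' fun w => LinearMap.congr_fun hw w
  LinearEquiv.ofInjectiveOfFinrankEq β.flip hi <| by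
    refine le_antisymm (LinearMap.finrank_le_finrank_of_injective hi) ?_
    rw [Subspace.dual_finrank_eq, ← Subspace.dual_finrank_eq (V := W)]
    exact LinearMap.finrank_le_finrank_of_injective hi'

theorem pairingEquiv_apply [FiniteDimensional K W] [FiniteDimensional K W']
    (β : W' →ₗ[K] W →ₗ[K] K) (h1 : ∀ w, (∀ w', β w' w = 0) → w = 0)
    (h2 : ∀ w', (∀ w, β w' w = 0) → w' = 0) (w : W) (w' : W') :
    pairingEquiv β h1 h2 w w' = β w' w := rfl

/-- Adjoint operators with respect to a perfect pairing have the same trace. -/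
theorem trace_eq_of_adjoint [FiniteDimensional K W] [FiniteDimensional K W']
    (β : W' →ₗ[K] W →ₗ[K] K) (h1 : ∀ w, (∀ w', β w' w = 0) → w = 0)
    (h2 : ∀ w', (∀ w, β w' w = 0) → w' = 0) {f : Module.End K W} {f' : Module.End K W'}
    (h : ∀ w' w, β (f' w') w = β w' (f w)) : LinearMap.trace K W f = LinearMap.trace K W' f' := by
  have he : (pairingEquiv β h1 h2).conj f = Module.Dual.transpose (R := K) f' := by
    ext φ w'
    obtain ⟨w, rfl⟩ := (pairingEquiv β h1 h2).surjective φ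
    rw [LinearEquiv.conj_apply_apply, LinearEquiv.symm_apply_apply, pairingEquiv_apply]
    exact (h w' w).symm
  rw [← LinearMap.trace_conj' f (pairingEquiv β h1 h2), he, LinearMap.trace_transpose']

theorem restrict_fixedBy_mem {r : Representation K Γ W} {G : Subgroup Γ} {x : Γ}
    (hx : x ∈ Subgroup.normalizer (G : Set Γ)) {Z : Submodule K W} (hZ : ∀ g, ∀ z ∈ Z, r g z ∈ Z) :
    ∀ z ∈ Z ⊓ fixedBy r G, r x z ∈ Z ⊓ fixedBy r G :=
  fun z hz => ⟨hZ x z hz.1, normalizer_apply_mem hx hz.2⟩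

/-- An invariant pairing stays nondegenerate when it is restricted to vectors fixed by a finite
group. -/
theorem eq_zero_of_pairing_fixedBy [CharZero K] {r : Representation K Γ W}
    {r' : Representation K Γ W'} {G : Subgroup Γ} [Finite G] {β : W' →ₗ[K] W →ₗ[K] K}
    (hβ : ∀ g w' w, β (r' g w') (r g w) = β w' w) {Z' : Submodule K W'}
    (hZ' : ∀ g, ∀ z ∈ Z', r' g z ∈ Z') {w : W} (hw : w ∈ fixedBy r G)
    (h1 : (∀ z' ∈ Z', β z' w = 0) → w = 0) (h : ∀ z' ∈ Z' ⊓ fixedBy r' G, β z' w = 0) :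
    w = 0 := by
  have := Fintype.ofFinite G
  refine h1 fun z' hz' => ?_
  have h2 := h (average r' G z')
    ⟨average_mem_of_mem r' G fun g _ => hZ' g z' hz', average_mem r' G z'⟩
  rw [average_apply, map_smul, map_sum, LinearMap.smul_apply, LinearMap.sum_apply] at h2
  have h3 : ∀ g : G, β (r' g z') w = β z' w := fun g => by
    conv_lhs => rw [← hw g g.2, hβ]
  rw [Finset.sum_congr rfl fun g _ => h3 g, Finset.sum_const, Finset.card_univ,
    ← Nat.card_eq_fintype_card, ← Nat.cast_smul_eq_nsmul K, smul_smul,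
    inv_mul_cancel₀ (Nat.cast_ne_zero.2 Nat.card_pos.ne'), one_smul] at h2
  exact h2

/-- For two modules in duality, the trace of an element that normalises `G` on the invariants of `G`
in one module is the trace of its inverse on the invariants in the other. -/
theorem trace_fixedBy_eq [CharZero K] {r : Representation K Γ W} {r' : Representation K Γ W'}
    {G : Subgroup Γ} [Finite G] {β : W' →ₗ[K] W →ₗ[K] K}
    (hβ : ∀ g w' w, β (r' g w') (r g w) = β w' w) {Z : Submodule K W} {Z' : Submodule K W'}
    [FiniteDimensional K Z] [FiniteDimensional K Z']
    (hZ : ∀ g, ∀ z ∈ Z, r g z ∈ Z) (hZ' : ∀ g, ∀ z ∈ Z', r' g z ∈ Z')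
    (h1 : ∀ z ∈ Z, (∀ z' ∈ Z', β z' z = 0) → z = 0)
    (h2 : ∀ z' ∈ Z', (∀ z ∈ Z, β z' z = 0) → z' = 0)
    {x : Γ} (hx : x ∈ Subgroup.normalizer (G : Set Γ))
    (hx' : x⁻¹ ∈ Subgroup.normalizer (G : Set Γ)) :
    LinearMap.trace K _ ((r x).restrict (restrict_fixedBy_mem hx hZ)) =
      LinearMap.trace K _ ((r' x⁻¹).restrict (restrict_fixedBy_mem hx' hZ')) := by
  have hβ' : ∀ g w w', β.flip (r g w) (r' g w') = β.flip w w' := fun g w w' => hβ g w' w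
  refine trace_eq_of_adjoint
    ((β.domRestrict (Z' ⊓ fixedBy r' G)).compl₂ (Z ⊓ fixedBy r G).subtype) ?_ ?_ ?_
  · intro w hw
    exact Subtype.ext (eq_zero_of_pairing_fixedBy hβ hZ' w.2.2 (h1 w w.2.1)
      fun z' hz' => hw ⟨z', hz'⟩)
  · intro w hw
    exact Subtype.ext (eq_zero_of_pairing_fixedBy hβ' hZ w.2.2 (h2 w w.2.1)
      fun z hz => hw ⟨z, hz⟩)
  · intro w' w
    change β (r' x⁻¹ w') w = β w' (r x w)
    rw [← hβ x, ← Module.End.mul_apply, ← map_mul, mul_inv_cancel, map_one, Module.End.one_apply]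

end TraceDuality

/-! ### Traces on covariants -/

section TraceFormula

variable {K U E Γ : Type*} [Field K] [AddCommGroup U] [Module K U] [AddCommGroup E] [Module K E]
  [Group Γ] {rU : Representation K Γ U} {rE : Representation K Γ E} {G : Subgroup Γ} {γ : Γ}

theorem CovBasis.coeff_eq (B : CovBasis rU rE G γ) {n : SymmetricAlgebra K U ⊗[K] E}
    (hn : n ∈ fixedBy (covRep rU rE) G) {u : B.Idx → invAlg rU G} (h : invComb B.vec u = n) :
    B.coeff hn = u :=
  B.invComb_injective ((B.invComb_coeff hn).trans h.symm)

theorem CovBasis.coeff_add (B : CovBasis rU rE G γ) {m n : SymmetricAlgebra K U ⊗[K] E}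
    (hm : m ∈ fixedBy (covRep rU rE) G) (hn : n ∈ fixedBy (covRep rU rE) G) :
    B.coeff (add_mem hm hn) = B.coeff hm + B.coeff hn :=
  B.coeff_eq _ (by rw [map_add, B.invComb_coeff, B.invComb_coeff])

theorem CovBasis.coeff_smul (B : CovBasis rU rE G γ) (c : K) {n : SymmetricAlgebra K U ⊗[K] E}
    (hn : n ∈ fixedBy (covRep rU rE) G) :
    B.coeff (Submodule.smul_mem _ c hn) = c • B.coeff hn :=
  B.coeff_eq _ (by rw [map_smul, B.invComb_coeff])

theorem CovBasis.vec_ne_zero (B : CovBasis rU rE G γ) (i : B.Idx) : B.vec i ≠ 0 := by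
  classical
  intro h
  have h1 := B.indep (Pi.single i 1) (by rw [invComb_single, h])
  have h2 := congrArg Subtype.val (congrFun h1 i)
  rw [Pi.single_eq_same] at h2
  have h3 := congrArg (constTerm (K := K) (U := U)) h2
  simp at h3

theorem CovBasis.covRep_inv (B : CovBasis rU rE G γ) (i : B.Idx) :
    covRep rU rE γ⁻¹ (B.vec i) = (B.eig i)⁻¹ • B.vec i := by
  have h := congrArg (covRep rU rE γ⁻¹) (B.eigen i)
  rw [← Module.End.mul_apply, ← map_mul, inv_mul_cancel, map_one, Module.End.one_apply,
    map_smul] at h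
  have h0 : B.eig i ≠ 0 := fun h0 => B.vec_ne_zero i (by rw [h, h0, zero_smul])
  conv_rhs => rw [h, smul_smul, inv_mul_cancel₀ h0, one_smul]

theorem pow_apply_of_eigen {W : Type*} [AddCommGroup W] [Module K W] (r : Representation K Γ W)
    {x : Γ} {w : W} {μ : K} (h : r x w = μ • w) (k : ℕ) : r (x ^ k) w = μ ^ k • w := by
  induction k with
  | zero => simp
  | succ k ih => rw [pow_succ, map_mul, Module.End.mul_apply, h, map_smul, ih, smul_smul, pow_succ,
      mul_comm]

/-- The trace of an operator on a space that is covered by pieces `A i`, with the coordinates `π i`,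
is the sum of the traces of its diagonal blocks. -/
theorem trace_eq_sum_trace {ι Y : Type*} [Fintype ι] [AddCommGroup Y] [Module K Y]
    [FiniteDimensional K Y] {A : ι → Type*} [∀ i, AddCommGroup (A i)] [∀ i, Module K (A i)]
    [∀ i, FiniteDimensional K (A i)] (ψ : ∀ i, A i →ₗ[K] Y) (π : ∀ i, Y →ₗ[K] A i)
    (h1 : ∀ y, ∑ i, ψ i (π i y) = y) {F : Module.End K Y} {f : ∀ i, Module.End K (A i)}
    (h2 : ∀ i a, π i (F (ψ i a)) = f i a) :
    LinearMap.trace K Y F = ∑ i, LinearMap.trace K (A i) (f i) := by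
  have h3 : F = ∑ i, ψ i ∘ₗ π i ∘ₗ F := by
    refine LinearMap.ext fun y => ?_
    rw [LinearMap.sum_apply]
    exact (h1 (F y)).symm
  conv_lhs => rw [h3, map_sum]
  refine Finset.sum_congr rfl fun i _ => ?_
  rw [LinearMap.trace_comp_comm' (π i ∘ₗ F) (ψ i)]
  congr 1
  exact LinearMap.ext (h2 i)

variable [FiniteDimensional K U] [FiniteDimensional K E]

/-- The trace on the covariants of degree `d`: a basis of the covariants over the invariants that
consists of eigenvectors reduces it to traces on the invariants. -/
theorem CovBasis.trace_eq (B : CovBasis rU rE G γ) {x : Γ}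
    (hx : x ∈ Subgroup.normalizer (G : Set Γ)) {μ : B.Idx → K}
    (hμ : ∀ i, covRep rU rE x (B.vec i) = μ i • B.vec i) (d : ℕ) :
    LinearMap.trace K _ ((covRep rU rE x).restrict (restrict_fixedBy_mem hx
      (Z := covPower K U E d) fun g _ hz => covRep_mem_covPower rU rE g hz)) =
    ∑ i : {i // B.deg i ≤ d}, μ i * LinearMap.trace K _ ((symRep rU x).restrict
      (restrict_fixedBy_mem hx (Z := symPower K U (d - B.deg i))
        fun g _ hz => symRep_mem_symPower rU g hz)) := by
  classical
  -- Multiplication by the `i`-th basis vector, and the homogeneous component of the `i`-th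
  -- coefficient.
  let ψ : ∀ i : {i // B.deg i ≤ d},
      ↥(symPower K U (d - B.deg i) ⊓ fixedBy (symRep rU) G) →ₗ[K]
        ↥(covPower K U E d ⊓ fixedBy (covRep rU rE) G) := fun i =>
    { toFun := fun a => ⟨(a : SymmetricAlgebra K U) • B.vec i, by
        have := smul_mem_covPower a.2.1 (B.homogeneous i)
        rwa [Nat.sub_add_cancel i.2] at this,
        smul_mem_fixedBy (Submodule.mem_inf.1 a.2).2 (B.mem i)⟩
      map_add' := fun a b => Subtype.ext (add_smul (a : SymmetricAlgebra K U) _ _)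
      map_smul' := fun c a => Subtype.ext (smul_assoc c (a : SymmetricAlgebra K U) _) }
  let π : ∀ i : {i // B.deg i ≤ d},
      ↥(covPower K U E d ⊓ fixedBy (covRep rU rE) G) →ₗ[K]
        ↥(symPower K U (d - B.deg i) ⊓ fixedBy (symRep rU) G) := fun i =>
    { toFun := fun y => ⟨comp (d - B.deg i)
          (B.coeff (Submodule.mem_inf.1 y.2).2 i : SymmetricAlgebra K U),
        comp_mem _ _, comp_mem_invAlg rU (B.coeff (Submodule.mem_inf.1 y.2).2 i).2 _⟩
      map_add' := fun y z => Subtype.ext (by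
        refine (congrArg (fun u : B.Idx → invAlg rU G => comp (d - B.deg i)
          (u i : SymmetricAlgebra K U)) (B.coeff_add (Submodule.mem_inf.1 y.2).2
            (Submodule.mem_inf.1 z.2).2)).trans ?_
        exact map_add _ _ _)
      map_smul' := fun c y => Subtype.ext (by
        refine (congrArg (fun u : B.Idx → invAlg rU G => comp (d - B.deg i)
          (u i : SymmetricAlgebra K U)) (B.coeff_smul c (Submodule.mem_inf.1 y.2).2)).trans ?_
        exact map_smul _ _ _) }
  have h1 : ∀ y, ∑ i, ψ i (π i y) = y := by
    refine fun y => Subtype.ext ?_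
    rw [AddSubmonoidClass.coe_finsetSum]
    conv_rhs => rw [← mem_covPower_iff.1 y.2.1, ← B.invComb_coeff (Submodule.mem_inf.1 y.2).2,
      invComb_apply, map_sum]
    simp only [covComp_smul_of_mem _ _ (B.homogeneous _)]
    rw [← Finset.sum_filter, Finset.sum_subtype _ (p := fun i => B.deg i ≤ d) (by simp)]
    rfl
  simp only [← smul_eq_mul, ← map_smul]
  refine trace_eq_sum_trace (ι := {i // B.deg i ≤ d})
    (Y := ↥(covPower K U E d ⊓ fixedBy (covRep rU rE) G))
    (A := fun i => ↥(symPower K U (d - B.deg i) ⊓ fixedBy (symRep rU) G))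
    (f := fun i => μ i • (symRep rU x).restrict (restrict_fixedBy_mem hx
      (Z := symPower K U (d - B.deg i)) fun g _ hz => symRep_mem_symPower rU g hz))
    ψ π h1 fun i a => Subtype.ext ?_
  have hxa : symRep rU x a ∈ invAlg rU G := symRep_mem_invAlg hx (Submodule.mem_inf.1 a.2).2
  have h3 : invComb B.vec (Pi.single (i : B.Idx) (μ i • (⟨_, hxa⟩ : invAlg rU G))) =
      covRep rU rE x ((a : SymmetricAlgebra K U) • B.vec i) := by
    have : (Pi.single (i : B.Idx) (μ i • (⟨_, hxa⟩ : invAlg rU G)) : B.Idx → invAlg rU G) =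
        fun j => (μ i • (⟨_, hxa⟩ : invAlg rU G)) * (Pi.single (i : B.Idx) 1 :
          B.Idx → invAlg rU G) j := by
      funext j
      by_cases hj : j = i
      · subst hj; simp
      · simp [Pi.single_eq_of_ne hj]
    rw [this, invComb_mul, invComb_single, covRep_smul, hμ, Subalgebra.coe_smul, smul_assoc,
      smul_comm]
  refine (congrArg (fun u : B.Idx → invAlg rU G =>
    comp (d - B.deg i) (u i : SymmetricAlgebra K U)) (B.coeff_eq _ h3)).trans ?_
  change comp _ ((Pi.single (i : B.Idx) (μ i • (⟨_, hxa⟩ : invAlg rU G)) :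
    B.Idx → invAlg rU G) i : SymmetricAlgebra K U) = μ i • symRep rU x a
  rw [Pi.single_eq_same, Subalgebra.coe_smul, map_smul,
    comp_self (symRep_mem_symPower rU x a.2.1)]

theorem trace_symPower_zero {x : Γ} (hx : x ∈ Subgroup.normalizer (G : Set Γ)) :
    LinearMap.trace K _ ((symRep rU x).restrict (restrict_fixedBy_mem hx
      (Z := symPower K U 0) fun g _ hz => symRep_mem_symPower rU g hz)) = 1 := by
  have h1 : (symRep rU x).restrict (restrict_fixedBy_mem hx
      (Z := symPower K U 0) fun g _ hz => symRep_mem_symPower rU g hz) = LinearMap.id := by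
    refine LinearMap.ext fun a => Subtype.ext ?_
    change symRep rU x a = a
    rw [exists_eq_algebraMap (Submodule.mem_inf.1 a.2).1, symRep_algebraMap]
  let one : ↥(symPower K U 0 ⊓ fixedBy (symRep rU) G) :=
    ⟨algebraMap K _ 1, algebraMap_mem_symPower _, fun g _ => symRep_algebraMap rU g 1⟩
  have h2 : Module.finrank K ↥(symPower K U 0 ⊓ fixedBy (symRep rU) G) = 1 := by
    refine finrank_eq_one one (fun h => ?_) fun a => ⟨constTerm (a : SymmetricAlgebra K U), ?_⟩
    · have := congrArg (constTerm (K := K) (U := U)) (congrArg Subtype.val h)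
      rw [AlgHom.commutes] at this
      simp at this
    · refine Subtype.ext ?_
      conv_rhs => rw [exists_eq_algebraMap (Submodule.mem_inf.1 a.2).1]
      change _ • algebraMap K _ 1 = _
      rw [map_one, Algebra.algebraMap_eq_smul_one]
  rw [h1, LinearMap.trace_id, h2, Nat.cast_one]

end TraceFormula

/-! ### Graded traces of dual modules -/

section GradedTraces

variable {K V M Γ : Type*} [Field K] [CharZero K] [AddCommGroup V] [Module K V] [AddCommGroup M]
  [Module K M] [Group Γ] [FiniteDimensional K V] [FiniteDimensional K M]
  {rV : Representation K Γ V} {rM : Representation K Γ M} {G : Subgroup Γ} [Finite G] {γ : Γ}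

/-- The covariants of `G` in `Sym V^* ⊗ M^*` and those in `Sym V ⊗ M` are generated in the same
degrees, with inverse eigenvalues. -/
theorem sum_monomial_eq (B : CovBasis rV.dual rM.dual G γ) (B' : CovBasis rV rM G γ) {x : Γ}
    (hx : x ∈ Subgroup.normalizer (G : Set Γ)) {μ : B.Idx → K} {μ' : B'.Idx → K}
    (hμ : ∀ i, covRep rV.dual rM.dual x (B.vec i) = μ i • B.vec i)
    (hμ' : ∀ i, covRep rV rM x⁻¹ (B'.vec i) = μ' i • B'.vec i) :
    ∑ i, Polynomial.monomial (B.deg i) (μ i) = ∑ i, Polynomial.monomial (B'.deg i) (μ' i) := by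
  have hx' := inv_mem hx
  -- The graded traces of `x` on the invariants in `Sym V^*` and of its inverse on those in
  -- `Sym V`.
  let t : PowerSeries K := PowerSeries.mk fun d =>
    LinearMap.trace K _ ((symRep rV.dual x).restrict (restrict_fixedBy_mem hx
      (Z := symPower K (Module.Dual K V) d) fun g _ hz => symRep_mem_symPower rV.dual g hz))
  let t' : PowerSeries K := PowerSeries.mk fun d =>
    LinearMap.trace K _ ((symRep rV x⁻¹).restrict (restrict_fixedBy_mem hx'
      (Z := symPower K V d) fun g _ hz => symRep_mem_symPower rV g hz))
  have ht : t = t' := by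
    ext d
    rw [PowerSeries.coeff_mk, PowerSeries.coeff_mk]
    exact trace_fixedBy_eq (β := pairing K V) (fun g a f => pairing_symRep rV g a f)
      (fun g _ hz => symRep_mem_symPower rV.dual g hz) (fun g _ hz => symRep_mem_symPower rV g hz)
      (fun _ hf h => eq_zero_of_pairing hf h) (fun _ ha h => eq_zero_of_pairing' ha h) hx hx'
  have ht0 : t ≠ 0 := fun h => by
    have := congrArg (PowerSeries.coeff 0) h
    rw [PowerSeries.coeff_mk, trace_symPower_zero hx, map_zero] at this
    exact one_ne_zero this
  have key : ∀ {ι : Type} [Fintype ι] (deg : ι → ℕ) (c : ι → K) (t : ℕ → K) (d : ℕ),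
      PowerSeries.coeff d (((∑ i, Polynomial.monomial (deg i) (c i) : Polynomial K) :
        PowerSeries K) * PowerSeries.mk t) = ∑ i : {i // deg i ≤ d}, c i * t (d - deg i) := by
    intro ι _ deg c t d
    rw [← Polynomial.coeToPowerSeries.ringHom_apply, map_sum, Finset.sum_mul, map_sum]
    simp only [Polynomial.coeToPowerSeries.ringHom_apply, ← Polynomial.C_mul_X_pow_eq_monomial,
      Polynomial.coe_mul, Polynomial.coe_C, Polynomial.coe_pow, Polynomial.coe_X, mul_assoc,
      PowerSeries.coeff_C_mul, PowerSeries.coeff_X_pow_mul', PowerSeries.coeff_mk]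
    rw [← Finset.sum_subtype (Finset.univ.filter fun i => deg i ≤ d) (by simp)
      (fun i => c i * t (d - deg i)), Finset.sum_filter]
    exact Finset.sum_congr rfl fun i _ => by split_ifs <;> simp
  -- Both products are graded traces on covariants, which agree by duality; the common factor is
  -- not zero and can be cancelled.
  have h1 : ((∑ i, Polynomial.monomial (B.deg i) (μ i) : Polynomial K) : PowerSeries K) * t =
      ((∑ i, Polynomial.monomial (B'.deg i) (μ' i) : Polynomial K) : PowerSeries K) * t' := by
    ext d
    rw [key, key]
    rw [← B.trace_eq hx hμ d, ← B'.trace_eq hx' hμ' d]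
    exact trace_fixedBy_eq (β := covPairing K V M) (fun g a f => covPairing_covRep rV rM g a f)
      (fun g _ hz => covRep_mem_covPower rV.dual rM.dual g hz)
      (fun g _ hz => covRep_mem_covPower rV rM g hz)
      (fun _ hf h => eq_zero_of_covPairing hf h) (fun _ ha h => eq_zero_of_covPairing' ha h) hx hx'
  rw [← ht] at h1
  exact Polynomial.coe_injective K (mul_right_cancel₀ ht0 h1)

/-- The comparison of the covariants in `Sym V^* ⊗ M^*` with those in `Sym V ⊗ M`, as an equality of
multisets. The equality of graded traces for all powers of `γ` gives the equality of all power sums.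
-/
theorem weighted_eq_of_dual (hγ : γ ∈ Subgroup.normalizer (G : Set Γ))
    (B : CovBasis rV.dual rM.dual G γ) (B' : CovBasis rV rM G γ) (ζ : K) :
    (Finset.univ : Finset B.Idx).val.map (fun i => B.eig i * ζ ^ B.deg i) =
      (Finset.univ : Finset B'.Idx).val.map (fun i => (B'.eig i)⁻¹ * ζ ^ B'.deg i) := by
  refine map_eq_map_of_sum_pow fun k => ?_
  have h := congrArg (Polynomial.eval (ζ ^ k)) (sum_monomial_eq B B' (x := γ ^ k) (pow_mem hγ k)
    (fun i => pow_apply_of_eigen _ (B.eigen i) k)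
    (fun i => by rw [← inv_pow]; exact pow_apply_of_eigen _ (B'.covRep_inv i) k))
  simp only [Polynomial.eval_finsetSum, Polynomial.eval_monomial] at h
  simp only [mul_pow]
  convert h using 3 <;> ring

end GradedTraces

/-! ### Bases of eigenvectors -/

section Bases

variable {K W : Type*} [Field K] [AddCommGroup W] [Module K W] {Z : Submodule K W}

/-- A family in `Z` with a dual family of functionals that separate the points of `Z` is a basis. -/
theorem exists_basis_of_dual {ι : Type*} [Fintype ι] [DecidableEq ι] {h : ι → W}
    (hh : ∀ i, h i ∈ Z) (φ : ι → Module.Dual K W) (hδ : ∀ i j, φ i (h j) = if i = j then 1 else 0)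
    (hZ : ∀ z ∈ Z, (∀ i, φ i z = 0) → z = 0) :
    ∃ b : Module.Basis ι K Z, ∀ i, (b i : W) = h i := by
  have hli : LinearIndependent K fun j => (⟨h j, hh j⟩ : Z) := by
    refine Fintype.linearIndependent_iff.2 fun c hc i => ?_
    have h1 := congrArg (fun z : Z => φ i z) hc
    simpa [hδ] using h1
  have hspan : ⊤ ≤ Submodule.span K (Set.range fun j => (⟨h j, hh j⟩ : Z)) := by
    intro z _
    have h1 : z = ∑ j, φ j z • (⟨h j, hh j⟩ : Z) := by
      rw [← sub_eq_zero]
      refine Subtype.ext (hZ _ (Subtype.property _) fun i => ?_)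
      simp [hδ]
    rw [h1]
    exact Submodule.sum_mem _ fun j _ => Submodule.smul_mem _ _ (Submodule.subset_span ⟨j, rfl⟩)
  exact ⟨Module.Basis.mk hli hspan, fun i => by rw [Module.Basis.mk_apply]⟩

/-- An eigenvector only involves the members of an eigenbasis that have its eigenvalue. -/
theorem mul_repr_eq_of_eigen {κ : Type*} [Fintype κ] (b : Module.Basis κ K Z) {F : Module.End K W}
    {l : κ → K} (h : ∀ j, F (b j) = l j • (b j : W)) {z : Z} {μ : K} (hz : F z = μ • (z : W))
    (j : κ) : μ * b.repr z j = l j * b.repr z j := by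
  have h1 : ∑ j, (l j * b.repr z j) • b j = μ • z := by
    refine Subtype.ext ?_
    rw [Submodule.coe_smul, ← hz]
    conv_rhs => rw [← b.sum_repr z]
    rw [AddSubmonoidClass.coe_finsetSum, AddSubmonoidClass.coe_finsetSum, map_sum]
    refine Finset.sum_congr rfl fun j _ => ?_
    rw [Submodule.coe_smul, Submodule.coe_smul, map_smul, h, smul_smul, mul_comm]
  have h2 := congrFun (b.repr_sum_self fun j => l j * b.repr z j) j
  rw [h1, map_smul] at h2
  exact h2

end Bases

/-! ### Harmonic covariants -/

section HarmonicCovariants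

variable {K V M Γ : Type*} [Field K] [AddCommGroup V] [Module K V] [AddCommGroup M]
  [Module K M] [Group Γ] (rV : Representation K Γ V) (rM : Representation K Γ M) (G : Subgroup Γ)

/-- The covariants in `Sym V^* ⊗ M^*` that are orthogonal to all products of an invariant in `Sym V`
without constant term and a covariant in `Sym V ⊗ M`. -/
def harmonicCov : Submodule K (Poly K V ⊗[K] Module.Dual K M) where
  carrier := {h | h ∈ fixedBy (covRep rV.dual rM.dual) G ∧ ∀ a ∈ invAlg rV G, constTerm a = 0 →
    ∀ n ∈ fixedBy (covRep rV rM) G, covPairing K V M (a • n) h = 0}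
  add_mem' hx hy := ⟨add_mem hx.1 hy.1, fun a ha h0 n hn => by
    rw [map_add, hx.2 a ha h0 n hn, hy.2 a ha h0 n hn, add_zero]⟩
  zero_mem' := ⟨zero_mem _, fun _ _ _ _ _ => map_zero _⟩
  smul_mem' c _ hx := ⟨Submodule.smul_mem _ c hx.1, fun a ha h0 n hn => by
    rw [map_smul, hx.2 a ha h0 n hn, smul_zero]⟩

variable {rV rM G}

theorem covRep_mem_harmonicCov {x : Γ} (hx : x ∈ Subgroup.normalizer (G : Set Γ))
    {h : Poly K V ⊗[K] Module.Dual K M} (hh : h ∈ harmonicCov rV rM G) :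
    covRep rV.dual rM.dual x h ∈ harmonicCov rV rM G := by
  refine ⟨normalizer_apply_mem hx hh.1, fun a ha h0 n hn => ?_⟩
  rw [← covPairing_covRep rV rM x⁻¹, ← Module.End.mul_apply (covRep rV.dual rM.dual x⁻¹), ← map_mul,
    inv_mul_cancel, map_one, Module.End.one_apply, covRep_smul]
  exact hh.2 _ (symRep_mem_invAlg (inv_mem hx) ha) (by rw [constTerm_symRep, h0]) _
    (normalizer_apply_mem (inv_mem hx) hn)

variable [CharZero K] [FiniteDimensional K V] [FiniteDimensional K M] [Finite G]

theorem eq_zero_of_covPairing_fixedBy {x : Poly K V ⊗[K] Module.Dual K M}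
    (hx : x ∈ fixedBy (covRep rV.dual rM.dual) G)
    (h : ∀ n ∈ fixedBy (covRep rV rM) G, covPairing K V M n x = 0) : x = 0 := by
  refine (Submodule.mem_bot K).1 (mem_of_covComp_mem fun d => (Submodule.mem_bot K).2 ?_)
  refine eq_zero_of_pairing_fixedBy (β := covPairing K V M)
    (fun g a f => covPairing_covRep rV rM g a f) (fun g _ hz => covRep_mem_covPower rV rM g hz)
    (covComp_mem_fixedBy _ _ hx d) (eq_zero_of_covPairing (covComp_mem _ _)) fun z hz => ?_
  rw [covPairing_covComp_right hz.1]
  exact h z hz.2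

variable {γ : Γ}

omit [CharZero K] [FiniteDimensional K V] [FiniteDimensional K M] [Finite G] in
/-- Pairing a covariant with a harmonic covariant only involves the constant terms of its
coefficients in a basis. -/
theorem covPairing_eq_of_mem_harmonicCov (B : CovBasis rV rM G γ)
    {h : Poly K V ⊗[K] Module.Dual K M} (hh : h ∈ harmonicCov rV rM G)
    {n : SymmetricAlgebra K V ⊗[K] M} (hn : n ∈ fixedBy (covRep rV rM) G) :
    covPairing K V M n h = ∑ i, constTerm (B.coeff hn i : SymmetricAlgebra K V) *
      covPairing K V M (B.vec i) h := by
  conv_lhs => rw [← B.invComb_coeff hn, invComb_apply, map_sum, LinearMap.sum_apply]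
  refine Finset.sum_congr rfl fun i _ => ?_
  have h1 := hh.2 ((B.coeff hn i : SymmetricAlgebra K V) -
    algebraMap K _ (constTerm (B.coeff hn i : SymmetricAlgebra K V)))
    (sub_mem (B.coeff hn i).2 (Subalgebra.algebraMap_mem _ _))
    (by rw [map_sub, AlgHom.commutes]; exact sub_self _) (B.vec i) (B.mem i)
  have h2 : ((B.coeff hn i : SymmetricAlgebra K V) -
      algebraMap K _ (constTerm (B.coeff hn i : SymmetricAlgebra K V))) • B.vec i =
      (B.coeff hn i : SymmetricAlgebra K V) • B.vec i -
        constTerm (B.coeff hn i : SymmetricAlgebra K V) • B.vec i := by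
    refine (sub_smul (B.coeff hn i : SymmetricAlgebra K V) (algebraMap K
      (SymmetricAlgebra K V) (constTerm (B.coeff hn i : SymmetricAlgebra K V))) (B.vec i)).trans ?_
    rw [algebraMap_smul]
  rw [h2, map_sub, LinearMap.sub_apply,
    map_smul (covPairing K V M) (constTerm (B.coeff hn i : SymmetricAlgebra K V)),
    LinearMap.smul_apply, sub_eq_zero] at h1
  exact h1

theorem eq_zero_of_mem_harmonicCov (B : CovBasis rV rM G γ)
    {h : Poly K V ⊗[K] Module.Dual K M} (hh : h ∈ harmonicCov rV rM G)
    (h0 : ∀ i, covPairing K V M (B.vec i) h = 0) : h = 0 := by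
  refine eq_zero_of_covPairing_fixedBy hh.1 fun n hn => ?_
  rw [covPairing_eq_of_mem_harmonicCov B hh hn]
  exact Finset.sum_eq_zero fun i _ => by rw [h0, mul_zero]

omit [CharZero K] [FiniteDimensional K V] [FiniteDimensional K M] [Finite G] in
theorem CovBasis.constTerm_coeff_covComp (B : CovBasis rV rM G γ)
    {n : SymmetricAlgebra K V ⊗[K] M} (hn : n ∈ fixedBy (covRep rV rM) G) (j : B.Idx) :
    constTerm (B.coeff (covComp_mem_fixedBy _ _ hn (B.deg j)) j : SymmetricAlgebra K V) =
      constTerm (B.coeff hn j : SymmetricAlgebra K V) := by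
  have h : B.coeff (covComp_mem_fixedBy _ _ hn (B.deg j)) = fun i =>
      (⟨if B.deg i ≤ B.deg j then comp (B.deg j - B.deg i) (B.coeff hn i : SymmetricAlgebra K V)
        else 0, by
          split_ifs
          · exact comp_mem_invAlg rV (B.coeff hn i).2 _
          · exact zero_mem _⟩ : invAlg rV G) := by
    refine B.coeff_eq _ ?_
    conv_rhs => rw [← B.invComb_coeff hn]
    rw [invComb_apply, invComb_apply, map_sum]
    refine Finset.sum_congr rfl fun i _ => ?_
    rw [covComp_smul_of_mem _ _ (B.homogeneous i)]
    split_ifs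
    · rfl
    · exact zero_smul (SymmetricAlgebra K V) _
  rw [h]
  simp [constTerm_comp]

/-- The dual basis of a basis of the covariants in `Sym V ⊗ M`. -/
theorem exists_dual_vec (B : CovBasis rV rM G γ) (j : B.Idx) :
    ∃ h ∈ covPower K (Module.Dual K V) (Module.Dual K M) (B.deg j) ⊓
        fixedBy (covRep rV.dual rM.dual) G,
      ∀ n (hn : n ∈ fixedBy (covRep rV rM) G),
        covPairing K V M n h = constTerm (B.coeff hn j : SymmetricAlgebra K V) := by
  -- The functional to be represented: the constant term of the `j`-th coefficient.
  let θ : Module.Dual K ↥(covPower K V M (B.deg j) ⊓ fixedBy (covRep rV rM) G) :=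
    { toFun := fun n => constTerm (B.coeff (Submodule.mem_inf.1 n.2).2 j : SymmetricAlgebra K V)
      map_add' := fun m n => by
        refine (congrArg (fun u : B.Idx → invAlg rV G => constTerm (u j : SymmetricAlgebra K V))
          (B.coeff_add (Submodule.mem_inf.1 m.2).2 (Submodule.mem_inf.1 n.2).2)).trans ?_
        exact map_add _ _ _
      map_smul' := fun c n => by
        refine (congrArg (fun u : B.Idx → invAlg rV G => constTerm (u j : SymmetricAlgebra K V))
          (B.coeff_smul c (Submodule.mem_inf.1 n.2).2)).trans ?_
        exact map_smul _ _ _ }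
  obtain ⟨h, hh⟩ := (pairingEquiv (((covPairing K V M).domRestrict
      (covPower K V M (B.deg j) ⊓ fixedBy (covRep rV rM) G)).compl₂
      (covPower K (Module.Dual K V) (Module.Dual K M) (B.deg j) ⊓
        fixedBy (covRep rV.dual rM.dual) G).subtype)
      (fun w hw => Subtype.ext (eq_zero_of_pairing_fixedBy (β := covPairing K V M)
        (fun g a f => covPairing_covRep rV rM g a f)
        (fun g _ hz => covRep_mem_covPower rV rM g hz) (Submodule.mem_inf.1 w.2).2
        (eq_zero_of_covPairing (Submodule.mem_inf.1 w.2).1) fun z hz => hw ⟨z, hz⟩))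
      (fun w hw => Subtype.ext (eq_zero_of_pairing_fixedBy (β := (covPairing K V M).flip)
        (fun g a f => covPairing_covRep rV rM g f a)
        (fun g _ hz => covRep_mem_covPower rV.dual rM.dual g hz) (Submodule.mem_inf.1 w.2).2
        (eq_zero_of_covPairing' (Submodule.mem_inf.1 w.2).1) fun z hz =>
          hw ⟨z, hz⟩))).surjective θ
  refine ⟨h, h.2, fun n hn => ?_⟩
  rw [← covPairing_covComp n (Submodule.mem_inf.1 h.2).1, ← B.constTerm_coeff_covComp hn j]
  exact LinearMap.congr_fun hh ⟨covComp (B.deg j) n, covComp_mem _ _, covComp_mem_fixedBy _ _ hn _⟩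

/-- The harmonic covariants have a basis with the degrees of a basis of the covariants in
`Sym V ⊗ M` and with inverse eigenvalues. -/
theorem exists_basis_harmonicCov (hγ : γ ∈ Subgroup.normalizer (G : Set Γ))
    (B : CovBasis rV rM G γ) :
    ∃ b : Module.Basis B.Idx K (harmonicCov rV rM G),
      (∀ i, (b i : Poly K V ⊗[K] Module.Dual K M) ∈
        covPower K (Module.Dual K V) (Module.Dual K M) (B.deg i)) ∧
      ∀ i, covRep rV.dual rM.dual γ (b i) =
        (B.eig i)⁻¹ • (b i : Poly K V ⊗[K] Module.Dual K M) := by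
  classical
  choose h hmem hpair using fun j => exists_dual_vec B j
  have hδ : ∀ i j, covPairing K V M (B.vec i) (h j) = if i = j then 1 else 0 := by
    intro i j
    rw [hpair j _ (B.mem i), B.coeff_eq _ (invComb_single B.vec i), Pi.single_apply]
    by_cases hij : j = i
    · rw [if_pos hij, if_pos hij.symm, OneMemClass.coe_one, map_one]
    · rw [if_neg hij, if_neg (Ne.symm hij), ZeroMemClass.coe_zero, map_zero]
  have hharm : ∀ j, h j ∈ harmonicCov rV rM G := by
    refine fun j => ⟨(hmem j).2, fun a ha h0 n hn => ?_⟩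
    have h1 : B.coeff (smul_mem_fixedBy ha hn) =
        fun i => (⟨a, ha⟩ : invAlg rV G) * B.coeff hn i := by
      refine B.coeff_eq _ ?_
      rw [invComb_mul, B.invComb_coeff]
    rw [hpair j _ (smul_mem_fixedBy ha hn), h1, MulMemClass.coe_mul, map_mul, h0, zero_mul]
  obtain ⟨b, hb⟩ := exists_basis_of_dual hharm (fun i => covPairing K V M (B.vec i)) hδ
    fun z hz h0 => eq_zero_of_mem_harmonicCov B hz h0
  refine ⟨b, fun i => ?_, fun i => ?_⟩
  · rw [hb]
    exact (hmem i).1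
  · rw [hb, ← sub_eq_zero]
    refine eq_zero_of_mem_harmonicCov B (sub_mem (covRep_mem_harmonicCov hγ (hharm i))
      (Submodule.smul_mem _ _ (hharm i))) fun j => ?_
    -- The adjoint of `γ` is `γ⁻¹`, which acts on the basis by the inverse eigenvalues.
    have h1 : covPairing K V M (B.vec j) (covRep rV.dual rM.dual γ (h i)) =
        covPairing K V M (covRep rV rM γ⁻¹ (B.vec j)) (h i) := by
      have h2 := covPairing_covRep rV rM γ (covRep rV rM γ⁻¹ (B.vec j)) (h i)
      rwa [← Module.End.mul_apply, ← map_mul, mul_inv_cancel, map_one, Module.End.one_apply] at h2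
    rw [map_sub, h1, B.covRep_inv, map_smul, map_smul, LinearMap.smul_apply, hδ, smul_eq_mul,
      smul_eq_mul]
    split_ifs with hij
    · rw [hij, sub_self]
    · rw [mul_zero, mul_zero, sub_self]

omit [CharZero K] [FiniteDimensional K V] [FiniteDimensional K M] [Finite G] in
/-- The degrees and eigenvalues of a basis of homogeneous eigenvectors are independent of it. -/
theorem map_weighted_eq_of_bases {U E : Type*} [AddCommGroup U] [Module K U] [AddCommGroup E]
    [Module K E] {rU : Representation K Γ U} {rE : Representation K Γ E}
    {Z : Submodule K (SymmetricAlgebra K U ⊗[K] E)} {ι κ : Type*} [Fintype ι] [Fintype κ]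
    (b : Module.Basis ι K Z) (b' : Module.Basis κ K Z) {deg : ι → ℕ} {deg' : κ → ℕ}
    {eig : ι → K} {eig' : κ → K}
    (hd : ∀ i, (b i : SymmetricAlgebra K U ⊗[K] E) ∈ covPower K U E (deg i))
    (hd' : ∀ i, (b' i : SymmetricAlgebra K U ⊗[K] E) ∈ covPower K U E (deg' i))
    (he : ∀ i, covRep rU rE γ (b i) = eig i • (b i : SymmetricAlgebra K U ⊗[K] E))
    (he' : ∀ i, covRep rU rE γ (b' i) = eig' i • (b' i : SymmetricAlgebra K U ⊗[K] E)) (ζ : K) :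
    (Finset.univ : Finset ι).val.map (fun i => eig i * ζ ^ deg i) =
      (Finset.univ : Finset κ).val.map (fun i => eig' i * ζ ^ deg' i) := by
  classical
  have hT : (b.toMatrix b').transpose * (b'.toMatrix b).transpose = 1 := by
    rw [← Matrix.transpose_mul, b'.toMatrix_mul_toMatrix_flip, Matrix.transpose_one]
  refine map_eq_map_of_intertwine (Fintype.card_congr (b.indexEquiv b')) hT fun i j => ?_
  rw [Matrix.transpose_apply, Module.Basis.toMatrix_apply]
  by_cases h0 : b'.repr (b i) j = 0
  · rw [h0, mul_zero, mul_zero]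
  congr 1
  have h1 : eig i = eig' j :=
    mul_right_cancel₀ h0 (mul_repr_eq_of_eigen b' (F := covRep rU rE γ) he' (he i) j)
  have h2 : deg i = deg' j := by
    have h := mul_repr_eq_of_eigen b' (F := covComp (deg i)) (z := b i) (μ := 1)
      (l := fun j => if deg' j = deg i then 1 else 0)
      (fun j => by rw [covComp_of_mem (hd' j)]; split_ifs <;> simp)
      (by rw [mem_covPower_iff.1 (hd i), one_smul]) j
    by_contra hne
    rw [if_neg (Ne.symm hne), zero_mul, one_mul] at h
    exact h0 h
  rw [h1, h2]

end HarmonicCovariants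

/-! ### Harmonic polynomials -/

section HarmonicPolynomials

variable {K V M : Type*} [Field K] [AddCommGroup V] [Module K V] [AddCommGroup M] [Module K M]

/-- The constant term of an operator is its value at `1`. -/
theorem polyDiff_one (a : SymmetricAlgebra K V) :
    polyDiff K V a 1 = algebraMap K _ (constTerm a) := by
  induction a using SymmetricAlgebra.induction with
  | algebraMap c => rw [polyDiff_algebraMap, AlgHom.commutes, Algebra.algebraMap_eq_smul_one]; rfl
  | ι v => rw [polyDiff_ι, constTerm_ι, map_zero, Derivation.map_one_eq_zero]
  | mul a b ha hb =>
    rw [polyDiff_mul, hb, ← mul_one (algebraMap K (Poly K V) _), ← Algebra.smul_def, map_smul, ha,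
      map_mul, map_mul, Algebra.smul_def, mul_comm]
  | add a b ha hb => rw [map_add, LinearMap.add_apply, ha, hb, map_add, map_add]

/-- An element of `S ⊗ E` belongs to `H ⊗ E` if and only if its coordinates belong to `H`. -/
theorem mem_range_rTensor_iff {U E : Type*} [AddCommGroup U] [Module K U] [AddCommGroup E]
    [Module K E] [FiniteDimensional K E] {H : Submodule K (SymmetricAlgebra K U)}
    {x : SymmetricAlgebra K U ⊗[K] E} :
    x ∈ LinearMap.range (LinearMap.rTensor E H.subtype) ↔
      ∀ ξ : Module.Dual K E, coord ξ x ∈ H := by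
  constructor
  · rintro ⟨x, rfl⟩ ξ
    induction x using TensorProduct.induction_on with
    | zero => rw [map_zero, map_zero]; exact zero_mem _
    | tmul f e =>
      rw [LinearMap.rTensor_tmul, coord_tmul]
      exact H.smul_mem _ f.2
    | add x y hx hy => rw [map_add, map_add]; exact add_mem hx hy
  · intro h
    rw [eq_sum_coord (Module.finBasis K E) x]
    refine Submodule.sum_mem _ fun i _ => ?_
    refine ⟨(⟨_, h ((Module.finBasis K E).coord i)⟩ : H) ⊗ₜ Module.finBasis K E i, ?_⟩
    rw [LinearMap.rTensor_tmul, TensorProduct.smul_tmul', smul_eq_mul, mul_one]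
    rfl

variable [CharZero K] [FiniteDimensional K V] [FiniteDimensional K M]

/-- A covariant is harmonic in the sense of `harmonicCov` if and only if its coordinates are killed
by all invariant operators without constant term. For a covariant `h` and an invariant operator `a`,
the covariant `a h` is zero as soon as it is orthogonal to all covariants. -/
theorem mem_harmonicCov_iff {Γ : Type*} [Group Γ] {rV : Representation K Γ V}
    {rM : Representation K Γ M} {G : Subgroup Γ} [Finite G] {h : Poly K V ⊗[K] Module.Dual K M}
    (hh : h ∈ fixedBy (covRep rV.dual rM.dual) G) :
    h ∈ harmonicCov rV rM G ↔ ∀ ξ, ∀ a ∈ invAlg rV G, constTerm a = 0 →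
      polyDiff K V a (coord ξ h) = 0 := by
  constructor
  · intro hm ξ a ha h0
    rw [← coord_covDiff, eq_zero_of_covPairing_fixedBy (rV := rV) (rM := rM) (G := G)
      (x := covDiff M a h), map_zero]
    · intro g hg
      rw [covRep_covDiff, ha g hg, hh g hg]
    · intro n hn
      rw [← covPairing_smul]
      exact hm.2 a ha h0 n hn
  · intro hm
    refine ⟨hh, fun a ha h0 n hn => ?_⟩
    rw [covPairing_smul, eq_zero_of_coord (x := covDiff M a h), map_zero]
    intro ξ
    rw [coord_covDiff, hm ξ a ha h0]

variable {Γ W : Subgroup (V ≃ₗ[K] V)}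

/-- The natural representation of a subgroup of `GL(V)`. -/
def natRep (Γ : Subgroup (V ≃ₗ[K] V)) : Representation K Γ V := stdRep.comp Γ.subtype

omit [CharZero K] [FiniteDimensional K V] in
theorem symRep_natRep_dual (g : Γ) : symRep (natRep Γ).dual g = polyRep (g : V ≃ₗ[K] V) := rfl

omit [CharZero K] [FiniteDimensional K V] in
theorem conj_polyDiff (g : Γ) (a : SymmetricAlgebra K V) :
    polyRep (g : V ≃ₗ[K] V) * polyDiff K V a * polyRep (g : V ≃ₗ[K] V)⁻¹ =
      polyDiff K V (symRep (natRep Γ) g a) := by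
  refine LinearMap.ext fun f => ?_
  have h := symRep_polyDiff (natRep Γ) g a (polyRep (g : V ≃ₗ[K] V)⁻¹ f)
  rwa [symRep_natRep_dual, ← Module.End.mul_apply (polyRep (g : V ≃ₗ[K] V)) (polyRep _), ← map_mul,
    mul_inv_cancel, map_one, Module.End.one_apply] at h

/-- Harmonic polynomials in terms of invariants in the symmetric algebra of `V`. -/
theorem mem_harmonic_iff (hW : W ≤ Γ) {h : Poly K V} :
    h ∈ harmonic W ↔ ∀ a ∈ invAlg (natRep Γ) (W.subgroupOf Γ), constTerm a = 0 →
      polyDiff K V a h = 0 := by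
  constructor
  · intro hh a ha h0
    refine hh _ (polyDiff_mem a) (fun g hg => ?_) (by rw [polyDiff_one, h0, map_zero])
    have h1 := conj_polyDiff (⟨g, hW hg⟩ : Γ) a
    rw [ha ⟨g, hW hg⟩ hg] at h1
    exact h1
  · intro hh D hD hinv h1
    obtain ⟨a, rfl⟩ := exists_polyDiff_eq hD
    refine hh a (fun g hg => polyDiff_injective ?_) ?_
    · rw [← conj_polyDiff]
      exact hinv g hg
    · rw [polyDiff_one] at h1
      exact (algebraMap K (Poly K V)).injective (h1.trans (map_zero _).symm)

/-- The space `(H ⊗ M^*) ^ W`, for the space `H` of harmonic polynomials of `W`, consists of the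
harmonic covariants of `W`. -/
theorem covariants_eq_harmonicCov {γ : V ≃ₗ[K] V} (ρ : Representation K Γ M)
    (hW : adjoinElem W γ ≤ Γ) [Finite (W.subgroupOf Γ)] :
    covariants W γ (ρ.comp (Subgroup.inclusion hW)) =
      harmonicCov (natRep Γ) ρ (W.subgroupOf Γ) := by
  have hW' : W ≤ Γ := (le_adjoinElem W γ).trans hW
  have hfix : ∀ h : Poly K V ⊗[K] Module.Dual K M,
      h ∈ Representation.invariants ((tensorRep (ρ.comp (Subgroup.inclusion hW))).comp
        (Subgroup.inclusion (le_adjoinElem W γ))) ↔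
      h ∈ fixedBy (covRep (natRep Γ).dual ρ.dual) (W.subgroupOf Γ) := fun h =>
    ⟨fun hh g hg => hh ⟨g, hg⟩, fun hh g => hh ⟨g, hW' g.2⟩ g.2⟩
  ext h
  rw [covariants, Submodule.mem_inf, hfix, mem_range_rTensor_iff]
  simp only [mem_harmonic_iff hW']
  constructor
  · exact fun hh => (mem_harmonicCov_iff hh.2).2 hh.1
  · exact fun hh => ⟨(mem_harmonicCov_iff hh.1).1 hh, hh.1⟩

end HarmonicPolynomials

/-! ### Weighted factors from covariants -/

section FactorBases

variable {K V M : Type*} [Field K] [CharZero K] [AddCommGroup V] [Module K V] [AddCommGroup M]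
  [Module K M] [FiniteDimensional K V] [FiniteDimensional K M] {Γ W : Subgroup (V ≃ₗ[K] V)}
  {γ : V ≃ₗ[K] V} {ρ : Representation K Γ M} {hW : adjoinElem W γ ≤ Γ} [Finite (W.subgroupOf Γ)]

theorem exists_basis_covariants
    (hγ : Subgroup.inclusion hW (adjoined W γ) ∈ Subgroup.normalizer (W.subgroupOf Γ : Set Γ))
    (B : CovBasis (natRep Γ) ρ (W.subgroupOf Γ) (Subgroup.inclusion hW (adjoined W γ))) :
    ∃ b : Module.Basis B.Idx K (covariants W γ (ρ.comp (Subgroup.inclusion hW))),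
      (∀ i, (b i : Poly K V ⊗[K] Module.Dual K M) ∈ homogeneousTensor V M (B.deg i)) ∧
      ∀ i, tensorRep (ρ.comp (Subgroup.inclusion hW)) (adjoined W γ) (b i) =
        (B.eig i)⁻¹ • (b i : Poly K V ⊗[K] Module.Dual K M) := by
  rw [covariants_eq_harmonicCov ρ hW]
  exact exists_basis_harmonicCov hγ B

theorem nonempty_factorBasis
    (hγ : Subgroup.inclusion hW (adjoined W γ) ∈ Subgroup.normalizer (W.subgroupOf Γ : Set Γ))
    (B : CovBasis (natRep Γ) ρ (W.subgroupOf Γ) (Subgroup.inclusion hW (adjoined W γ))) :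
    Nonempty (FactorBasis W γ (ρ.comp (Subgroup.inclusion hW))) := by
  obtain ⟨b, hb, hb'⟩ := exists_basis_covariants hγ B
  let e := Fintype.equivFin B.Idx
  exact ⟨{ size := Fintype.card B.Idx
           basis := b.reindex e
           deg := fun i => B.deg (e.symm i)
           factor := fun i => (B.eig (e.symm i))⁻¹
           homogeneous := fun i => by rw [Module.Basis.reindex_apply]; exact hb _
           eigen := fun i => by rw [Module.Basis.reindex_apply]; exact hb' _ }⟩

/-- The weighted factors of any basis of `(H ⊗ M^*) ^ W` are those of a basis of the covariants in
`Sym V^* ⊗ M^*` over the invariants. -/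
theorem weightedFactors_eq
    (hγ : Subgroup.inclusion hW (adjoined W γ) ∈ Subgroup.normalizer (W.subgroupOf Γ : Set Γ))
    (B : CovBasis (natRep Γ) ρ (W.subgroupOf Γ) (Subgroup.inclusion hW (adjoined W γ)))
    (B' : CovBasis (natRep Γ).dual ρ.dual (W.subgroupOf Γ)
      (Subgroup.inclusion hW (adjoined W γ)))
    (F : FactorBasis W γ (ρ.comp (Subgroup.inclusion hW))) (ζ : K) :
    F.weightedFactors ζ =
      (Finset.univ : Finset B'.Idx).val.map (fun i => B'.eig i * ζ ^ B'.deg i) := by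
  obtain ⟨b, hb, hb'⟩ := exists_basis_covariants hγ B
  rw [weighted_eq_of_dual hγ B' B ζ]
  exact map_weighted_eq_of_bases (rU := (natRep Γ).dual) (rE := ρ.dual)
    (γ := Subgroup.inclusion hW (adjoined W γ)) F.basis b F.homogeneous hb F.eigen hb' ζ

end FactorBases

/-! ### Semisimple elements -/

section Semisimple

variable {K W Γ : Type*} [Field K] [IsAlgClosed K] [AddCommGroup W] [Module K W]
  [FiniteDimensional K W] [Group Γ] {r : Representation K Γ W} {γ : Γ}

omit [IsAlgClosed K] [FiniteDimensional K W] in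
theorem EigenSpanned.of_basis {ι : Type*} (b : Module.Basis ι K W) {f : Module.End K W} {μ : ι → K}
    (h : ∀ i, f (b i) = μ i • b i) : EigenSpanned f := by
  intro w
  have : w ∈ Submodule.span K (Set.range b) := by rw [b.span_eq]; trivial
  refine Submodule.span_mono ?_ this
  rintro _ ⟨i, rfl⟩
  exact ⟨μ i, h i⟩

theorem eigenSpanned_of_isSemisimple (h : Module.End.IsSemisimple (r γ)) : EigenSpanned (r γ) := by
  obtain ⟨ι, _, b, μ, hb⟩ := exists_eigenbasis_of_isSemisimple h
  exact EigenSpanned.of_basis b hb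

theorem eigenSpanned_dual_of_isSemisimple (h : Module.End.IsSemisimple (r γ)) :
    EigenSpanned (r.dual γ) := by
  classical
  obtain ⟨ι, _, b, μ, hb⟩ := exists_eigenbasis_of_isSemisimple h
  have h1 : ∀ i, b i = μ i • r γ⁻¹ (b i) := fun i => by
    rw [← map_smul, ← hb, ← Module.End.mul_apply, ← map_mul, inv_mul_cancel, map_one,
      Module.End.one_apply]
  have h2 : ∀ i, r γ⁻¹ (b i) = (μ i)⁻¹ • b i := fun i => by
    have h0 : μ i ≠ 0 := fun h0 => b.ne_zero i (by rw [h1 i, h0, zero_smul])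
    conv_rhs => rw [h1 i, smul_smul, inv_mul_cancel₀ h0, one_smul]
  refine EigenSpanned.of_basis b.dualBasis (μ := fun i => (μ i)⁻¹) fun i => b.ext fun j => ?_
  rw [Representation.dual_apply, Module.Dual.transpose_apply, LinearMap.comp_apply, h2, map_smul,
    LinearMap.smul_apply, b.dualBasis_apply_self]
  split_ifs with hij
  · rw [hij]
  · rw [smul_zero, smul_zero]

end Semisimple

/-! ### Reflections and parabolic subgroups -/

section Reflections

variable {K V : Type*} [Field K] [AddCommGroup V] [Module K V]
  {Γ W : Subgroup (V ≃ₗ[K] V)}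

theorem natRep_dual_apply (g : Γ) (φ : Module.Dual K V) (u : V) :
    (natRep Γ).dual g φ u = φ ((g : V ≃ₗ[K] V)⁻¹ u) := rfl

theorem IsReflection.actsAsReflection [FiniteDimensional K V] {g : Γ}
    (hg : IsReflection (g : V ≃ₗ[K] V)) :
    ActsAsReflection (natRep Γ) g := by
  have h1 := LinearMap.finrank_range_add_finrank_ker
    ((g : V ≃ₗ[K] V).toLinearMap - LinearMap.id)
  rw [IsReflection, ← h1, add_comm, add_right_cancel_iff] at hg
  obtain ⟨a, ha⟩ := finrank_le_one_iff.1 hg.ge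
  refine ⟨a, fun u => ?_⟩
  obtain ⟨c, hc⟩ := ha ⟨_, LinearMap.mem_range_self _ u⟩
  exact ⟨c, (congrArg Subtype.val hc).symm⟩

/-- If `g u - u = c u • a` for all `u`, then every `g φ - φ` is a multiple of `c ∘ g⁻¹`. If `g` is
not trivial, then `g ψ - ψ` is a nonzero multiple for any `ψ` with `ψ a ≠ 0`, and it serves as the
direction in which `g` moves the dual space. -/
theorem ActsAsReflection.dual {Γ : Type*} [Group Γ] {r : Representation K Γ V} {g : Γ}
    (h : ActsAsReflection r g) : ActsAsReflection r.dual g := by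
  obtain ⟨a, ha⟩ := h
  have hinv : ∀ u, r g (r g⁻¹ u) = u := fun u => by
    rw [← Module.End.mul_apply, ← map_mul, mul_inv_cancel, map_one, Module.End.one_apply]
  by_cases h0 : ∀ ψ : Module.Dual K V, ψ a = 0
  · refine ⟨0, fun φ => ⟨0, LinearMap.ext fun u => ?_⟩⟩
    obtain ⟨c, hc⟩ := ha (r g⁻¹ u)
    rw [hinv, (Module.forall_dual_apply_eq_zero_iff K a).1 h0, smul_zero, sub_eq_zero] at hc
    change φ (r g⁻¹ u) - φ u = _
    rw [← hc, sub_self]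
    simp
  · push Not at h0
    obtain ⟨ψ, hψ⟩ := h0
    refine ⟨r.dual g ψ - ψ, fun φ => ⟨φ a / ψ a, LinearMap.ext fun u => ?_⟩⟩
    obtain ⟨c, hc⟩ := ha (r g⁻¹ u)
    rw [hinv] at hc
    change φ (r g⁻¹ u) - φ u = φ a / ψ a * (ψ (r g⁻¹ u) - ψ u)
    rw [← neg_sub (φ u), ← neg_sub (ψ u), ← map_sub, ← map_sub, hc, map_smul, map_smul, smul_eq_mul,
      smul_eq_mul]
    field_simp

/-- If `g` moves all linear forms along `φ`, then it fixes the kernel of `φ`, which has codimension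
at most one. -/
theorem isReflection_of_actsAsReflection_dual [FiniteDimensional K V] {g : Γ}
    (hg : ActsAsReflection (natRep Γ).dual g) :
    g = 1 ∨ IsReflection (g : V ≃ₗ[K] V) := by
  obtain ⟨φ, hφ⟩ := hg
  set H := LinearMap.ker ((g : V ≃ₗ[K] V).toLinearMap - LinearMap.id) with hH
  have h1 : LinearMap.ker φ ≤ H := by
    intro u hu
    have h2 : (g : V ≃ₗ[K] V)⁻¹ u = u := by
      rw [← sub_eq_zero, ← Module.forall_dual_apply_eq_zero_iff K]
      intro ψ
      obtain ⟨c, hc⟩ := hφ ψ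
      have h3 := LinearMap.congr_fun hc u
      rw [LinearMap.sub_apply, natRep_dual_apply, LinearMap.smul_apply, LinearMap.mem_ker.1 hu,
        smul_zero] at h3
      rw [map_sub, h3]
    change (g : V ≃ₗ[K] V) u - u = 0
    rw [sub_eq_zero]
    conv_lhs => rw [← h2]
    exact (g : V ≃ₗ[K] V).apply_symm_apply u
  have h2 := Submodule.finrank_mono h1
  have h3 := LinearMap.finrank_range_add_finrank_ker φ
  have h4 : Module.finrank K (LinearMap.range φ) ≤ 1 := by
    simpa using Submodule.finrank_le (LinearMap.range φ)
  have h5 := Submodule.finrank_le H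
  rcases h5.lt_or_eq with h6 | h6
  · right
    rw [IsReflection, ← hH]
    omega
  · left
    have h7 := Submodule.eq_top_of_finrank_eq h6
    refine Subtype.ext (LinearEquiv.ext fun u => ?_)
    have : u ∈ H := by rw [h7]; trivial
    exact sub_eq_zero.1 this

/-- If every reflection acts on a space as a reflection, then a reflection group is generated by
elements that act as reflections. -/
theorem generatedByActing_of_isReflection {U : Type*} [AddCommGroup U] [Module K U]
    {rU : Representation K Γ U} (hWΓ : W ≤ Γ) (hW : GeneratedByReflections W)
    (h : ∀ g : Γ, IsReflection (g : V ≃ₗ[K] V) → ActsAsReflection rU g) :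
    GeneratedByActing rU (W.subgroupOf Γ) := by
  refine le_antisymm ((Subgroup.closure_le _).2 fun g hg => hg.1) ?_
  rw [← Subgroup.map_le_map_iff_of_injective Γ.subtype_injective,
    Subgroup.map_subgroupOf_eq_of_le hWΓ, MonoidHom.map_closure]
  conv_lhs => rw [← hW]
  refine Subgroup.closure_mono fun g hg => ?_
  exact ⟨⟨g, hWΓ hg.1⟩, ⟨hg.1, h _ hg.2⟩, rfl⟩

theorem generatedByReflections_parabolic (G : Subgroup (V ≃ₗ[K] V)) (v : V) :
    GeneratedByReflections (parabolic G v) := by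
  refine le_antisymm ((Subgroup.closure_le _).2 fun g hg => hg.1) ?_
  exact Subgroup.closure_mono fun g hg => ⟨Subgroup.subset_closure hg, hg.2.1⟩

theorem dual_faithful {g : Γ} (h : ∀ φ, (natRep Γ).dual g φ = φ) : g = 1 := by
  rw [← inv_eq_one]
  refine Subtype.ext (LinearEquiv.ext fun u => ?_)
  rw [← sub_eq_zero, ← Module.forall_dual_apply_eq_zero_iff K]
  intro φ
  rw [map_sub, sub_eq_zero]
  exact LinearMap.congr_fun (h φ) u

theorem apply_eq_of_eval_comp {g : Γ} {v : V}
    (h : Module.Dual.eval K V v ∘ₗ (natRep Γ).dual g = Module.Dual.eval K V v) :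
    (g : V ≃ₗ[K] V) v = v := by
  have h1 : (g : V ≃ₗ[K] V)⁻¹ v = v := by
    rw [← sub_eq_zero, ← Module.forall_dual_apply_eq_zero_iff K]
    intro φ
    rw [map_sub, sub_eq_zero]
    exact LinearMap.congr_fun h φ
  conv_lhs => rw [← h1]
  exact (g : V ≃ₗ[K] V).apply_symm_apply v

/-- Steinberg's theorem, from `mem_pointGroup` for the action on the dual space and the point given
by the evaluation at `v`. -/
theorem stabilizer_eq_parabolic [FiniteDimensional K V] [IsAlgClosed K] [CharZero K]
    (G : Subgroup (V ≃ₗ[K] V)) [Finite G]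
    (hG : GeneratedByReflections G) (v : V) :
    G ⊓ MulAction.stabilizer (V ≃ₗ[K] V) v = parabolic G v := by
  refine le_antisymm ?_ (le_inf (parabolic_le G v) ((Subgroup.closure_le _).2 fun g hg => hg.2.2))
  rintro g ⟨hg, hgv⟩
  have h1 : (⟨g, hg⟩ : G) ∈ pointGroup (natRep G).dual (Module.Dual.eval K V v) := by
    refine mem_pointGroup _ (fun _ => dual_faithful) ?_ _ ?_
    · rw [← Subgroup.subgroupOf_self G]
      exact generatedByActing_of_isReflection le_rfl hG
        fun _ hg => hg.actsAsReflection.dual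
    · refine LinearMap.ext fun φ => ?_
      have h2 : g⁻¹ v = v := by
        conv_lhs => rw [← show g v = v from hgv]
        exact g.symm_apply_apply v
      exact congrArg φ h2
  have h2 : pointGroup (natRep G).dual (Module.Dual.eval K V v) ≤
      (parabolic G v).subgroupOf G := by
    refine (Subgroup.closure_le _).2 fun g hg => ?_
    rcases isReflection_of_actsAsReflection_dual hg.1 with h3 | h3
    · rw [h3]; exact one_mem _
    · exact Subgroup.subset_closure ⟨g.2, h3, apply_eq_of_eval_comp hg.2⟩
  exact h2 h1

theorem IsReflection.conj {g : V ≃ₗ[K] V} (hg : IsReflection g) (x : V ≃ₗ[K] V) :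
    IsReflection (x * g * x⁻¹) := by
  have h : (LinearMap.ker (g.toLinearMap - LinearMap.id)).map x.toLinearMap =
      LinearMap.ker ((x * g * x⁻¹).toLinearMap - LinearMap.id) := by
    ext u
    constructor
    · rintro ⟨w, hw, rfl⟩
      have hw' : g w = w := sub_eq_zero.1 hw
      change x (g (x.symm (x w))) - x w = 0
      rw [x.symm_apply_apply, hw', sub_self]
    · intro hu
      have hu' : x (g (x.symm u)) = u := sub_eq_zero.1 hu
      refine ⟨x.symm u, ?_, x.apply_symm_apply u⟩
      change g (x.symm u) - x.symm u = 0
      conv_lhs => rw [sub_eq_zero.2 (x.injective (hu'.trans (x.apply_symm_apply u).symm))]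
  rw [IsReflection, ← h, LinearEquiv.finrank_map_eq]
  exact hg

theorem mem_normalizer_closure {Γ : Type*} [Group Γ] {S : Set Γ} {x : Γ}
    (h1 : ∀ g ∈ S, x * g * x⁻¹ ∈ S) (h2 : ∀ g ∈ S, x⁻¹ * g * x ∈ S) :
    x ∈ Subgroup.normalizer (Subgroup.closure S : Set Γ) := by
  have h3 : Subgroup.closure S ≤ (Subgroup.closure S).comap (MulAut.conj x).toMonoidHom :=
    (Subgroup.closure_le _).2 fun g hg => Subgroup.subset_closure (h1 g hg)
  have h4 : Subgroup.closure S ≤ (Subgroup.closure S).comap (MulAut.conj x⁻¹).toMonoidHom :=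
    (Subgroup.closure_le _).2 fun g hg => Subgroup.subset_closure (by simpa using h2 g hg)
  refine Subgroup.mem_normalizer_iff.2 fun g => ⟨fun hg => h3 hg, fun hg => ?_⟩
  have h5 : x⁻¹ * (x * g * x⁻¹) * x⁻¹⁻¹ ∈ Subgroup.closure S := h4 hg
  simpa [mul_assoc] using h5

theorem mem_normalizer_parabolic {G : Subgroup (V ≃ₗ[K] V)} {γ : V ≃ₗ[K] V}
    (hγ : γ ∈ Subgroup.normalizer (G : Set (V ≃ₗ[K] V))) {v : V} {ζ : K} (hv : γ v = ζ • v) :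
    γ ∈ Subgroup.normalizer (parabolic G v : Set (V ≃ₗ[K] V)) := by
  have hv' : γ.symm v = ζ⁻¹ • v := by
    rw [LinearEquiv.symm_apply_eq, map_smul, hv, smul_smul]
    -- If `ζ = 0`, then `v = 0`, and the claim holds with `0⁻¹ = 0`.
    by_cases h0 : ζ = 0
    · rw [h0, zero_smul] at hv
      rw [(map_eq_zero_iff γ γ.injective).1 hv, smul_zero]
    · rw [inv_mul_cancel₀ h0, one_smul]
  refine mem_normalizer_closure (fun g hg => ⟨(Subgroup.mem_normalizer_iff.1 hγ g).1 hg.1,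
    hg.2.1.conj γ, ?_⟩) fun g hg => ⟨?_, ?_, ?_⟩
  · change γ (g (γ.symm v)) = v
    rw [hv', map_smul, hg.2.2, ← hv', γ.apply_symm_apply]
  · simpa using (Subgroup.mem_normalizer_iff.1 (inv_mem hγ) g).1 hg.1
  · simpa using hg.2.1.conj γ⁻¹
  · change γ.symm (g (γ v)) = v
    rw [hv, map_smul, hg.2.2, ← hv, γ.symm_apply_apply]

theorem mem_normalizer_subgroupOf {x : Γ}
    (hx : (x : V ≃ₗ[K] V) ∈ Subgroup.normalizer (W : Set (V ≃ₗ[K] V))) :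
    x ∈ Subgroup.normalizer (W.subgroupOf Γ : Set Γ) :=
  Subgroup.mem_normalizer_iff.2 fun g => Subgroup.mem_normalizer_iff.1 hx g

end Reflections

/-! ### Weighted factors of a reflection group -/

section Comparison

variable {K V M : Type*} [Field K] [IsAlgClosed K] [CharZero K] [AddCommGroup V] [Module K V]
  [FiniteDimensional K V] [AddCommGroup M] [Module K M] [FiniteDimensional K M]

/-- For a reflection group `W` there are bases as in `FactorBasis`, and their weighted factors can
be read off from a basis of the covariants in `Sym V^* ⊗ M^*` over the invariants. -/
theorem exists_covBasis_weightedFactors {Γ W : Subgroup (V ≃ₗ[K] V)} {γ : V ≃ₗ[K] V}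
    (ρ : Representation K Γ M) (hWΓ : adjoinElem W γ ≤ Γ) [Finite W]
    (hW : GeneratedByReflections W) (hγ : γ ∈ Subgroup.normalizer (W : Set (V ≃ₗ[K] V)))
    (hss : Module.End.IsSemisimple γ.toLinearMap)
    (hρ : Module.End.IsSemisimple (ρ (Subgroup.inclusion hWΓ (adjoined W γ)))) :
    Nonempty (FactorBasis W γ (ρ.comp (Subgroup.inclusion hWΓ))) ∧
    ∃ C : CovBasis (natRep Γ).dual ρ.dual (W.subgroupOf Γ)
        (Subgroup.inclusion hWΓ (adjoined W γ)),
      ∀ (F : FactorBasis W γ (ρ.comp (Subgroup.inclusion hWΓ))) (ζ : K),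
        F.weightedFactors ζ =
          (Finset.univ : Finset C.Idx).val.map (fun i => C.eig i * ζ ^ C.deg i) := by
  have hle : W ≤ Γ := (le_adjoinElem W γ).trans hWΓ
  have : Finite (W.subgroupOf Γ) :=
    Finite.of_injective _ (Subgroup.subgroupOfEquivOfLe hle).injective
  have hn : Subgroup.inclusion hWΓ (adjoined W γ) ∈
      Subgroup.normalizer (W.subgroupOf Γ : Set Γ) := mem_normalizer_subgroupOf hγ
  have hss' : Module.End.IsSemisimple (natRep Γ (Subgroup.inclusion hWΓ (adjoined W γ))) := hss
  obtain ⟨B⟩ := nonempty_covBasis (natRep Γ) ρ (W.subgroupOf Γ)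
    (generatedByActing_of_isReflection hle hW fun _ h => h.actsAsReflection) hn
    (eigenSpanned_of_isSemisimple hss') (eigenSpanned_of_isSemisimple hρ)
  obtain ⟨C⟩ := nonempty_covBasis (natRep Γ).dual ρ.dual (W.subgroupOf Γ)
    (generatedByActing_of_isReflection hle hW fun _ h => h.actsAsReflection.dual) hn
    (eigenSpanned_dual_of_isSemisimple hss') (eigenSpanned_dual_of_isSemisimple hρ)
  exact ⟨nonempty_factorBasis hn B, C, weightedFactors_eq hn B C⟩

end Comparison

end ReflectionCoset

end

open ReflectionCoset in
theorem mainTheorem2 {K V : Type*} [Field K] [IsAlgClosed K] [CharZero K]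
    [AddCommGroup V] [Module K V] [FiniteDimensional K V]
    (G : Subgroup (V ≃ₗ[K] V)) [Finite G] (hG : GeneratedByReflections G) (v : V) :
    (∀ (γ : V ≃ₗ[K] V), Module.End.IsSemisimple γ.toLinearMap →
      γ ∈ Subgroup.normalizer (G : Set (V ≃ₗ[K] V)) →
      ∀ ζ : K, γ v = ζ • v →
      ∀ (M : Type*) [AddCommGroup M] [Module K M] [FiniteDimensional K M]
        (ρ : Representation K (adjoinElem G γ) M),
        Module.End.IsSemisimple (ρ (adjoined G γ)) →
        Nonempty (FactorBasis G γ ρ) ∧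
        Nonempty (FactorBasis (parabolic G v) γ
          (ρ.comp (Subgroup.inclusion (adjoinElem_mono (parabolic_le G v) γ)))) ∧
        ∀ (B : FactorBasis G γ ρ)
          (B' : FactorBasis (parabolic G v) γ
            (ρ.comp (Subgroup.inclusion (adjoinElem_mono (parabolic_le G v) γ)))),
          B.weightedFactors ζ = B'.weightedFactors ζ) ∧
    G ⊓ MulAction.stabilizer (V ≃ₗ[K] V) v = parabolic G v := by
  refine ⟨fun γ hss hγ ζ hζ M _ _ _ ρ hρ => ?_, stabilizer_eq_parabolic G hG v⟩
  have hPG := parabolic_le G v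
  have : Finite (parabolic G v) := Finite.of_injective _ (Subgroup.inclusion_injective hPG)
  have hn := mem_normalizer_parabolic hγ hζ
  obtain ⟨hF, C, hC⟩ := exists_covBasis_weightedFactors ρ le_rfl hG hγ hss hρ
  obtain ⟨hF', C', hC'⟩ := exists_covBasis_weightedFactors ρ (adjoinElem_mono hPG γ)
    (generatedByReflections_parabolic G v) hn hss hρ
  refine ⟨hF, hF', fun F F' => (hC F ζ).trans (Eq.trans ?_ (hC' F' ζ).symm)⟩
  have : Finite (G.subgroupOf (adjoinElem G γ)) :=
    Finite.of_injective _ (Subgroup.subgroupOfEquivOfLe (le_adjoinElem G γ)).injective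
  refine map_weighted_eq C C' (fun g hg => hPG hg) (fun g _ => dual_faithful)
    (mem_normalizer_subgroupOf hn) (y := Module.Dual.eval K V v) (fun g hg hgv => ?_) fun φ => ?_
  · have h1 : (g : V ≃ₗ[K] V) ∈ G ⊓ MulAction.stabilizer (V ≃ₗ[K] V) v :=
      ⟨hg, apply_eq_of_eval_comp hgv⟩
    rw [stabilizer_eq_parabolic G hG v] at h1
    exact h1
  · have h1 : γ.symm (ζ • v) = v := by rw [← hζ, γ.symm_apply_apply]
    change ζ * φ (γ.symm v) = φ v
    conv_rhs => rw [← h1, map_smul, map_smul, smul_eq_mul]
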